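/- **Setting.** Let $X_1,X_2,\dots$ be observations with common law $F_0$, and let $g(X,\theta)\in\mathbb R^m$ be moment functions with parameter $\theta\in\mathbb R^p$. Write $G(X,\theta)=\partial g(X,\theta)/\partial\theta'$, $F(X,\theta)=\partial\,\mathrm{vec}[G(X,\theta)']/\partial\theta'$, $\psi(X,\theta)=(g(X,\theta)',\mathrm{vec}[G(X,\theta)']')'\in\mathbb R^{m(p+1)}$, $g(\theta)=E[g(X,\theta)]$, $\Gamma(\theta)=E[\partial\psi(X,\theta)/\partial\theta']$, $\Sigma(\theta)=E[\psi(X,\theta)\psi(X,\theta)']-E[\psi(X,\theta)]E[\psi(X,\theta)]'$. Let $g_n,G_n,\psi_n$ denote sample averages over $X_1,\dots,X_n$, and $\|\cdot\|$ the Euclidean norm of vectors and the spectral norm of matrices. Argmins are over the parameter space $\Theta\subset\mathbb R^p$; any measurable selection of a minimizer is allowed. **Assumptions.** 1. $X_1,X_2,\dots$ are i.i.d. 2. $W$ is a positive definite $m\times m$ matrix, $\Theta$ is compact, $\theta_W=\arg\min_{\theta\in\Theta}g(\theta)'Wg(\theta)$ is unique and lies in the interior of $\Theta$, and $g(\theta)\ne0$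 for all $\theta\in\Theta$. 3. $g(X,\cdot)$ and $G(X,\cdot)$ are continuous at each $\theta\in\Theta$ with probability one, and $E\sup_{\theta\in\Theta}\|g(X,\theta)\|$, $E\sup_{\theta\in\Theta}\|G(X,\theta)\|$, $E\sup_{\theta\in\Theta}\|F(X,\theta)\|$ are finite. 4. With probability one, $g(X,\cdot)$ is twice continuously differentiable (in a neighborhood of each point of $\Theta$), and $E\|g(X,\theta_W)\|^2<\infty$, $E\|G(X,\theta_W)\|^2<\infty$. 5. With $\widetilde\psi(X,\theta)=\psi(X,\theta)-E[\psi(X,\theta_W)]$, $\theta=\theta_W$ is the unique solution in $\Theta$ of $E[\widetilde\psi(X,\theta)]=0$. Write $\Gamma=\Gamma(\theta_W)$ and $\Sigma=\Sigma(\theta_W)$. **Theorem.** (a) Let $\Delta$ be a symmetric positive definite matrix of order $m(p+1)$ such that $\Gamma'\Delta\Gamma$ is non-singular, and let $$\widehat\theta_{ME\text{-}GMM}(\Delta)=\arg\min_{\theta\in\Theta}\Bigl(\tfrac1n\sum_{i=1}^n\widetilde\psi(X_i,\theta)\Bigr)'\Delta\Bigl(\tfrac1n\sum_{i=1}^n\widetilde\psi(X_i,\theta)\Bigr).$$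 Then $$\sqrt n\,(\widehat\theta_{ME\text{-}GMM}(\Delta)-\theta_W)\overset{d}{\longrightarrow}N\bigl(0,(\Gamma'\Delta\Gamma)^{-1}\Gamma'\Delta\Sigma\Delta\Gamma(\Gamma'\Delta\Gamma)^{-1}\bigr).$$ (b) If $\Sigma$ and $\Gamma'\Sigma^{-1}\Gamma$ are non-singular, then $\Sigma^{-1}$ is positive definite, and for $\Delta=\Sigma^{-1}$ the variance in (a) equals $(\Gamma'\Sigma^{-1}\Gamma)^{-1}$. (c) Suppose that $\Sigma$ and $\Gamma'\Sigma^{-1}\Gamma$ are non-singular. Let $\widehat\theta_{GMM}=\arg\min_{\theta\in\Theta}g_n(\theta)'Wg_n(\theta)$. Let $X_1^*,\dots,X_n^*$ be drawn independently with replacement from $\{X_1,\dots,X_n\}$, let $P^*,E^*$ be probability and expectation conditional on the data, let $g_n^*,G_n^*,\psi_n^*$ be averages over the bootstrap sample, and let $$\widehat\theta{}^*_{ME}=\arg\min_{\theta\in\Theta}\bigl(\psi_n^*(\theta)-\psi_n(\widehat\theta_{GMM})\bigr)'\Delta^*\bigl(\psi_n^*(\theta)-\psi_n(\widehat\theta_{GMM})\bigr),$$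 $$\Delta^*=\Bigl(\tfrac1n\sum_{i=1}^n\psi(X_i,\widehat\theta_{GMM})\psi(X_i,\widehat\theta_{GMM})'-\psi_n(\widehat\theta_{GMM})\psi_n(\widehat\theta_{GMM})'\Bigr)^{-1}.$$ Let $\overset{p^*}{\to}$ and $\overset{d^*}{\to}$ denote convergence in probability and in distribution under $P^*$, in probability: $\xi_n\overset{p^*}{\to}0$ means that $P^*(\|\xi_n\|>\varepsilon)\to0$ in probability for every $\varepsilon>0$, and $\xi_n\overset{d^*}{\to}\nu$ that $E^*[f(\xi_n)]\to\int f\,d\nu$ in probability for every bounded continuous $f$. Suppose further that (i) $\widehat\theta{}^*_{ME}\overset{p^*}{\to}\theta_W$; (ii) $\sup_{\theta\in\Theta}\|g_n^*(\theta)-g_n(\theta)\|\overset{p^*}{\to}0$ and $\sup_{\theta\in\Theta}\|G_n^*(\theta)-G_n(\theta)\|\overset{p^*}{\to}0$; (iii) $\sqrt n\,\bigl(\psi_n^*(\widehat\theta_{GMM})-\psi_n(\widehat\theta_{GMM})\bigr)\overset{d^*}{\to}N(0,\Sigma)$. Then $$\sqrt n\,(\widehat\theta{}^*_{ME}-\widehat\theta_{GMM})\overset{d^*}{\longrightarrow}N\bigl(0,(\Gamma'\Sigma^{-1}\Gamma)^{-1}\bigr).$$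 -/

import Mathlib

open MeasureTheory ProbabilityTheory Filter Topology
open scoped ENNReal Matrix BoundedContinuousFunction Matrix.Norms.L2Operator

noncomputable section

/-! Vectors live in `EuclideanSpace`, and `‖A‖` for a matrix `A` is the spectral norm
(scoped instances `Matrix.Norms.L2Operator`). -/

/-- Index set of the augmented moment vector: `m` moments followed by the `m * p` entries of
their Jacobian. -/
abbrev AugIdx (m p : ℕ) : Type := Fin m ⊕ Fin m × Fin p

/-! ### Moment functions, Jacobians and augmented moments -/

/-- The Jacobian matrix `∂f/∂θ'` of `f` at `θ`. -/
def jacobian {ι κ : Type*} [Fintype ι] [DecidableEq ι] [Fintype κ]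
    (f : EuclideanSpace ℝ ι → EuclideanSpace ℝ κ) (θ : EuclideanSpace ℝ ι) : Matrix κ ι ℝ :=
  Matrix.of fun a k => fderiv ℝ f θ (EuclideanSpace.single k 1) a

/-- `G(x, θ) = ∂g(x, θ)/∂θ'`, an `m × p` matrix. -/
def momentJac {𝒳 : Type*} {m p : ℕ}
    (g : 𝒳 → EuclideanSpace ℝ (Fin p) → EuclideanSpace ℝ (Fin m))
    (x : 𝒳) (θ : EuclideanSpace ℝ (Fin p)) : Matrix (Fin m) (Fin p) ℝ :=
  jacobian (g x) θ

/-- `vec(G(x, θ)')`. -/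
def vecJac {𝒳 : Type*} {m p : ℕ}
    (g : 𝒳 → EuclideanSpace ℝ (Fin p) → EuclideanSpace ℝ (Fin m))
    (x : 𝒳) (θ : EuclideanSpace ℝ (Fin p)) : EuclideanSpace ℝ (Fin m × Fin p) :=
  WithLp.toLp 2 (Matrix.vec (momentJac g x θ)ᵀ)

/-- `F(x, θ) = ∂vec(G(x, θ)')/∂θ'`, an `mp × p` matrix. -/
def secondJac {𝒳 : Type*} {m p : ℕ}
    (g : 𝒳 → EuclideanSpace ℝ (Fin p) → EuclideanSpace ℝ (Fin m))
    (x : 𝒳) (θ : EuclideanSpace ℝ (Fin p)) : Matrix (Fin m × Fin p) (Fin p) ℝ :=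
  jacobian (vecJac g x) θ

/-- The augmented moment vector `ψ(x, θ) = (g(x, θ)', vec(G(x, θ)')')'`. -/
def augMoment {𝒳 : Type*} {m p : ℕ}
    (g : 𝒳 → EuclideanSpace ℝ (Fin p) → EuclideanSpace ℝ (Fin m))
    (x : 𝒳) (θ : EuclideanSpace ℝ (Fin p)) : EuclideanSpace ℝ (AugIdx m p) :=
  WithLp.toLp 2 (Sum.elim (g x θ) (vecJac g x θ))

/-! ### Population quantities under the law `F₀` of an observation -/

/-- `Γ(θ) = E[∂ψ(X, θ)/∂θ']`, with entrywise expectations. -/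
def popGamma {𝒳 : Type*} [MeasurableSpace 𝒳] {m p : ℕ} (F₀ : Measure 𝒳)
    (g : 𝒳 → EuclideanSpace ℝ (Fin p) → EuclideanSpace ℝ (Fin m))
    (θ : EuclideanSpace ℝ (Fin p)) : Matrix (AugIdx m p) (Fin p) ℝ :=
  Matrix.of fun a k => ∫ x, jacobian (augMoment g x) θ a k ∂F₀

/-- `Σ(θ) = E[ψ(X, θ) ψ(X, θ)'] - E[ψ(X, θ)] E[ψ(X, θ)]'`. -/
def popSigma {𝒳 : Type*} [MeasurableSpace 𝒳] {m p : ℕ} (F₀ : Measure 𝒳)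
    (g : 𝒳 → EuclideanSpace ℝ (Fin p) → EuclideanSpace ℝ (Fin m))
    (θ : EuclideanSpace ℝ (Fin p)) : Matrix (AugIdx m p) (AugIdx m p) ℝ :=
  Matrix.of fun a b => (∫ x, augMoment g x θ a * augMoment g x θ b ∂F₀)
    - (∫ x, augMoment g x θ a ∂F₀) * (∫ x, augMoment g x θ b ∂F₀)

/-- The recentered augmented moment `ψ̃(x, θ) = ψ(x, θ) - E[ψ(X, θ_W)]`. -/
def recentered {𝒳 : Type*} [MeasurableSpace 𝒳] {m p : ℕ} (F₀ : Measure 𝒳)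
    (g : 𝒳 → EuclideanSpace ℝ (Fin p) → EuclideanSpace ℝ (Fin m))
    (θW : EuclideanSpace ℝ (Fin p)) (x : 𝒳) (θ : EuclideanSpace ℝ (Fin p)) :
    EuclideanSpace ℝ (AugIdx m p) :=
  augMoment g x θ - ∫ y, augMoment g y θW ∂F₀

/-- The sandwich matrix `(Γ'ΔΓ)⁻¹ Γ'Δ S ΔΓ (Γ'ΔΓ)⁻¹`. -/
def sandwich {ι κ : Type*} [Fintype ι] [DecidableEq ι] [Fintype κ]
    (Γ : Matrix κ ι ℝ) (Δ S : Matrix κ κ ℝ) : Matrix ι ι ℝ :=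
  (Γᵀ * Δ * Γ)⁻¹ * Γᵀ * Δ * S * Δ * Γ * (Γᵀ * Δ * Γ)⁻¹

/-! ### Sample quantities and estimators -/

/-- The quadratic form `v'Av`. -/
def quadForm {ι : Type*} [Fintype ι] (A : Matrix ι ι ℝ) (v : EuclideanSpace ℝ ι) : ℝ :=
  v.ofLp ⬝ᵥ A *ᵥ v.ofLp

/-- `t` is a minimizer of `Q` over `S`. -/
def IsArgminOn {E : Type*} (Q : E → ℝ) (S : Set E) (t : E) : Prop :=
  t ∈ S ∧ ∀ s ∈ S, Q t ≤ Q s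

/-- The average `n⁻¹ ∑ i, h (x i)` over a sample `x` of size `n`. -/
def avg {𝒳 E : Type*} [AddCommGroup E] [Module ℝ E] {n : ℕ} (x : Fin n → 𝒳) (h : 𝒳 → E) : E :=
  (n : ℝ)⁻¹ • ∑ i, h (x i)

/-- The first `n` observations. -/
def sample {Ω 𝒳 : Type*} (X : ℕ → Ω → 𝒳) (n : ℕ) (ω : Ω) : Fin n → 𝒳 := fun i => X i ω

/-- The GMM objective `g_n(θ)' W g_n(θ)` on the sample `x`. -/
def gmmObjective {𝒳 : Type*} {m p n : ℕ}
    (g : 𝒳 → EuclideanSpace ℝ (Fin p) → EuclideanSpace ℝ (Fin m))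
    (W : Matrix (Fin m) (Fin m) ℝ) (x : Fin n → 𝒳) (θ : EuclideanSpace ℝ (Fin p)) : ℝ :=
  quadForm W (avg x fun y => g y θ)

/-- The population GMM objective `g(θ)' W g(θ)`, where `g(θ) = E[g(X, θ)]`. -/
def popObjective {𝒳 : Type*} [MeasurableSpace 𝒳] {m p : ℕ} (F₀ : Measure 𝒳)
    (g : 𝒳 → EuclideanSpace ℝ (Fin p) → EuclideanSpace ℝ (Fin m))
    (W : Matrix (Fin m) (Fin m) ℝ) (θ : EuclideanSpace ℝ (Fin p)) : ℝ :=
  quadForm W (∫ x, g x θ ∂F₀)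

/-- The objective of the (oracle) ME-GMM estimator with weight `Δ`:
`(n⁻¹ ∑ ψ̃(x_i, θ))' Δ (n⁻¹ ∑ ψ̃(x_i, θ))`. -/
def meObjective {𝒳 : Type*} [MeasurableSpace 𝒳] {m p n : ℕ} (F₀ : Measure 𝒳)
    (g : 𝒳 → EuclideanSpace ℝ (Fin p) → EuclideanSpace ℝ (Fin m))
    (θW : EuclideanSpace ℝ (Fin p)) (Δ : Matrix (AugIdx m p) (AugIdx m p) ℝ)
    (x : Fin n → 𝒳) (θ : EuclideanSpace ℝ (Fin p)) : ℝ :=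
  quadForm Δ (avg x fun y => recentered F₀ g θW y θ)

/-- The sample covariance matrix of `ψ(·, t)` on the sample `x`. This is
`E*[ψ(X*, t) ψ(X*, t)'] - E*[ψ(X*, t)] E*[ψ(X*, t)]'` for a bootstrap draw `X*`, which is uniform
on the sample `x`. -/
def sampleSigma {𝒳 : Type*} {m p n : ℕ}
    (g : 𝒳 → EuclideanSpace ℝ (Fin p) → EuclideanSpace ℝ (Fin m))
    (x : Fin n → 𝒳) (t : EuclideanSpace ℝ (Fin p)) : Matrix (AugIdx m p) (AugIdx m p) ℝ :=
  Matrix.of fun a b => (avg x fun y => augMoment g y t a * augMoment g y t b)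
    - (avg x fun y => augMoment g y t a) * (avg x fun y => augMoment g y t b)

/-- The objective of the double-recentered bootstrap ME-GMM estimator. Here `x` is the original
sample, `x ∘ I` the bootstrap sample, and `t` the GMM estimate on `x`; the bootstrap moments
are `ψ(X*_i, θ) - ψ_n(t)` and the weight is `Δ* = (sampleSigma g x t)⁻¹`. -/
def bootObjective {𝒳 : Type*} {m p n : ℕ}
    (g : 𝒳 → EuclideanSpace ℝ (Fin p) → EuclideanSpace ℝ (Fin m))
    (x : Fin n → 𝒳) (t : EuclideanSpace ℝ (Fin p)) (I : Fin n → Fin n)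
    (θ : EuclideanSpace ℝ (Fin p)) : ℝ :=
  quadForm (sampleSigma g x t)⁻¹
    (avg (x ∘ I) fun y => augMoment g y θ - avg x fun z => augMoment g z t)

/-! ### Bootstrap probability and modes of convergence

A bootstrap sample is `X*_i = X_{I i}` for `n` independent uniform indices `I i`; a bootstrap
statistic is a function of the data `ω` and of the drawn indices `I`. The conditional law given the
data is that of the statistic under `bootMeasure n` with `ω` fixed. -/

/-- The law of `n` independent uniform draws, with replacement, from `Fin n`. -/
def bootMeasure (n : ℕ) : Measure (Fin n → Fin n) :=
  Measure.pi fun _ => uniformOn Set.univ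

/-- Convergence in bootstrap probability to zero, in probability, of nonnegative bootstrap
statistics: `P*(ξ_n > ε) → 0` in `P`-probability for every `ε > 0`. -/
def TendstoZeroInBootProb {Ω : Type*} [MeasurableSpace Ω] (P : Measure Ω)
    (ξ : (n : ℕ) → Ω → (Fin n → Fin n) → ℝ≥0∞) : Prop :=
  ∀ ε : ℝ≥0∞, 0 < ε →
    TendstoInMeasure P (fun n ω => bootMeasure n {I | ε < ξ n ω I}) atTop (fun _ => 0)

/-- Convergence in bootstrap distribution to `ν`, in probability: `E*[f(ξ_n)] → ∫ f dν`
in `P`-probability for every bounded continuous `f`. -/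
def TendstoInBootDistribution {Ω E : Type*} [MeasurableSpace Ω] [TopologicalSpace E]
    [MeasurableSpace E] (P : Measure Ω)
    (ξ : (n : ℕ) → Ω → (Fin n → Fin n) → E) (ν : Measure E) : Prop :=
  ∀ f : E →ᵇ ℝ,
    TendstoInMeasure P (fun n ω => ∫ I, f (ξ n ω I) ∂(bootMeasure n)) atTop (fun _ => ∫ y, f y ∂ν)

/-! ### Assumptions -/

/-- Sampling, identification and regularity conditions for misspecified GMM: i.i.d. data with
common law `F₀`; `θW` the unique, interior pseudo-true value; misspecification; smoothness and
moment conditions. The continuity in `θ` of `g` and `G` is contained in `smooth`. -/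
structure GMMAssumptions {Ω 𝒳 : Type*} [MeasurableSpace Ω] [MeasurableSpace 𝒳] {m p : ℕ}
    (P : Measure Ω) (F₀ : Measure 𝒳) (X : ℕ → Ω → 𝒳)
    (g : 𝒳 → EuclideanSpace ℝ (Fin p) → EuclideanSpace ℝ (Fin m))
    (Θ : Set (EuclideanSpace ℝ (Fin p))) (W : Matrix (Fin m) (Fin m) ℝ)
    (θW : EuclideanSpace ℝ (Fin p)) : Prop where
  indep : iIndepFun X P
  law : ∀ i, HasLaw (X i) F₀ P
  posDef : W.PosDef
  compact : IsCompact Θ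
  argmin : ∀ θ, IsArgminOn (popObjective F₀ g W) Θ θ ↔ θ = θW
  interior : θW ∈ interior Θ
  misspecified : ∀ θ ∈ Θ, ∫ x, g x θ ∂F₀ ≠ 0
  measurable : ∀ θ, Measurable fun x => g x θ
  smooth : ∀ᵐ x ∂F₀, ∀ θ ∈ Θ, ContDiffAt ℝ 2 (g x) θ
  sup_moment : ∫⁻ x, ⨆ θ ∈ Θ, ‖g x θ‖ₑ ∂F₀ < ∞
  sup_momentJac : ∫⁻ x, ⨆ θ ∈ Θ, ‖momentJac g x θ‖ₑ ∂F₀ < ∞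
  sup_secondJac : ∫⁻ x, ⨆ θ ∈ Θ, ‖secondJac g x θ‖ₑ ∂F₀ < ∞
  sq_moment : ∫⁻ x, ‖g x θW‖ₑ ^ 2 ∂F₀ < ∞
  sq_momentJac : ∫⁻ x, ‖momentJac g x θW‖ₑ ^ 2 ∂F₀ < ∞

/-- Bootstrap conditions, for the GMM estimator `θGMM` and the bootstrap estimator `θstar`:
bootstrap consistency, uniform bootstrap laws of large numbers for the moments and their
Jacobian, and a bootstrap central limit theorem for the stacked moments and Jacobian. -/
structure BootAssumptions {Ω 𝒳 : Type*} [MeasurableSpace Ω] [MeasurableSpace 𝒳] {m p : ℕ}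
    (P : Measure Ω) (F₀ : Measure 𝒳) (X : ℕ → Ω → 𝒳)
    (g : 𝒳 → EuclideanSpace ℝ (Fin p) → EuclideanSpace ℝ (Fin m))
    (Θ : Set (EuclideanSpace ℝ (Fin p))) (θW : EuclideanSpace ℝ (Fin p))
    (θGMM : ℕ → Ω → EuclideanSpace ℝ (Fin p))
    (θstar : (n : ℕ) → Ω → (Fin n → Fin n) → EuclideanSpace ℝ (Fin p)) : Prop where
  consistent : TendstoZeroInBootProb P fun n ω I => ‖θstar n ω I - θW‖ₑ
  ulln_moment : TendstoZeroInBootProb P fun n ω I => ⨆ θ ∈ Θ,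
    ‖(avg (sample X n ω ∘ I) fun x => g x θ) - avg (sample X n ω) fun x => g x θ‖ₑ
  ulln_momentJac : TendstoZeroInBootProb P fun n ω I => ⨆ θ ∈ Θ,
    ‖(avg (sample X n ω ∘ I) fun x => momentJac g x θ)
      - avg (sample X n ω) fun x => momentJac g x θ‖ₑ
  clt : TendstoInBootDistribution P
    (fun n ω I => √(n : ℝ) •
      ((avg (sample X n ω ∘ I) fun x => augMoment g x (θGMM n ω))
        - avg (sample X n ω) fun x => augMoment g x (θGMM n ω)))
    (multivariateGaussian 0 (popSigma F₀ g θW))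

end

/-! ### Almost surely convergent subsequences -/

/-! Both estimators minimize a quadratic form v'Dv in an averaged moment v = f(θ) whose derivative
stays close to Γ near θW. At an interior minimizer t the first-order condition f'(t)'D f(t) = 0,
expanded around a reference point s, gives t - s ≈ -(Γ'DΓ)⁻¹Γ'D f(s), with an error that is small
relative to ‖f(s)‖. This is a deterministic fact with one tolerance for all f
(`exists_norm_sub_add_le_of_isLocalMin`). It serves the sample with s = θW and the bootstrap with s
= θGMM. A central limit theorem for √n f(s) and a Slutsky lemma
(`tendsto_integral_sub_of_negligible`) then yield the limit law.

Consistency in (a), consistency of θGMM, and closeness of the sample derivatives to Γ come from the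
strong law in the Banach space of continuous functions on a compact set
(`tendstoUniformlyOn_avg_sample_ae`). Bootstrap derivatives are compared with sample derivatives by
a bootstrap law of large numbers in the same space, which needs only a first moment
(`tendsto_bootDeviation_ae`).

The delicate point is the weight Δ*. Second moments of ψ are controlled at θW only, while Δ* is
evaluated at θGMM, so a uniform law of large numbers for ψψ' is not at hand. Convergence of the
sample covariance is instead extracted from the bootstrap central limit theorem by a converse
central limit theorem (`tendsto_variance_of_boot_clt`). The squared modulus of the bootstrap
characteristic function is (1 - w(t)/n)ⁿ with w the Fourier defect of the symmetrized empirical law,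
so w(t) → t²v. Tightness bounds the increments (c i - c j)/√n, and for small t the quadratic part of
w is t² times the empirical variance, with an error at most 4w(t) - w(2t) → 0.

Modes of convergence "in probability" are handled by subsequences. Only countably many test
functions and thresholds are needed, so every subsequence has a further one along which all
hypotheses hold for almost every ω (`exists_seq_forall_tendsto_ae`). For such a fixed ω the
bootstrap is a triangular array of finite probability spaces. -/

theorem ENNReal.edist_zero_right' (a : ℝ≥0∞) : edist a 0 = a := by
  cases a with
  | top => rfl
  | coe a =>
    change edist a 0 = (a : ℝ≥0∞)
    simp [edist_nndist]

/-- Instead of a diagonal argument, the countably many sequences are merged into the single sequence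
sup_k min(D k, c k), with weights c k tending to zero. -/
theorem exists_seq_forall_tendsto_ae {Ω ι : Type*} [MeasurableSpace Ω] [Countable ι]
    {μ : Measure Ω} {D : ι → ℕ → Ω → ℝ≥0∞}
    (h : ∀ k, TendstoInMeasure μ (D k) atTop fun _ => 0) :
    ∃ ns : ℕ → ℕ, StrictMono ns ∧
      ∀ᵐ ω ∂μ, ∀ k, Tendsto (fun i => D k (ns i) ω) atTop (𝓝 0) := by
  obtain ⟨e, he⟩ := exists_injective_nat ι
  set c : ι → ℝ≥0∞ := fun k => (2⁻¹ : ℝ≥0∞) ^ e k with hc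
  have hcpos : ∀ k, 0 < c k := fun k => ENNReal.pow_pos (by simp) _
  set U : ℕ → Ω → ℝ≥0∞ := fun n ω => ⨆ k, min (D k n ω) (c k) with hU
  have hUm : TendstoInMeasure μ U atTop fun _ => 0 := by
    intro ε hε
    simp only [ENNReal.edist_zero_right']
    obtain ⟨δ, hδ, hδε⟩ := exists_between hε
    obtain ⟨K, hK⟩ : ∃ K : ℕ, (2⁻¹ : ℝ≥0∞) ^ K < δ := ENNReal.exists_inv_two_pow_lt hδ.ne'
    have hfin : {k | e k < K}.Finite := (Set.finite_Iio K).preimage he.injOn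
    -- Indices with `e k ≥ K` are capped below δ by their weight, so only finitely many sequences
    -- can push the supremum up to ε.
    have hsub : ∀ n, {ω | ε ≤ U n ω} ⊆ ⋃ k ∈ hfin.toFinset, {ω | δ ≤ D k n ω} := by
      intro n ω hω
      by_contra hcon
      simp only [Set.mem_iUnion, Set.mem_ofPred_eq, not_exists, not_le, Set.Finite.mem_toFinset]
        at hcon
      have : U n ω ≤ δ := by
        refine iSup_le fun k => ?_
        by_cases hk : e k < K
        · exact (min_le_left _ _).trans (hcon k hk).le
        · refine (min_le_right _ _).trans (le_trans ?_ hK.le)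
          exact pow_le_pow_right_of_le_one' (by simp) (not_lt.1 hk)
      exact absurd (lt_of_le_of_lt this hδε) (not_lt.2 hω)
    have hlim : Tendsto (fun n => ∑ k ∈ hfin.toFinset, μ {ω | δ ≤ D k n ω}) atTop (𝓝 0) := by
      rw [← Finset.sum_const_zero (s := hfin.toFinset)]
      refine tendsto_finsetSum _ fun k _ => ?_
      simpa only [ENNReal.edist_zero_right'] using h k δ hδ
    refine tendsto_of_tendsto_of_tendsto_of_le_of_le tendsto_const_nhds hlim
      (fun _ => zero_le) fun n => ?_
    exact (measure_mono (hsub n)).trans (measure_biUnion_finset_le _ _)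
  -- the metric structure on `ℝ≥0∞` is only weak, so pass to real numbers
  have hUr : TendstoInMeasure μ (fun n ω => (min (U n ω) 1).toReal) atTop fun _ => (0 : ℝ) := by
    rw [tendstoInMeasure_iff_norm]
    intro ε hε
    refine tendsto_of_tendsto_of_tendsto_of_le_of_le tendsto_const_nhds
      (hUm (ENNReal.ofReal ε) (by simpa using hε)) (fun _ => zero_le) fun n => ?_
    refine measure_mono fun ω hω => ?_
    simp only [Set.mem_ofPred_eq, ENNReal.edist_zero_right', sub_zero, Real.norm_eq_abs,
      ENNReal.abs_toReal] at hω ⊢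
    exact (ENNReal.ofReal_le_of_le_toReal hω).trans (min_le_left _ _)
  obtain ⟨ns, hns, hae⟩ := hUr.exists_seq_tendsto_ae
  refine ⟨ns, hns, ?_⟩
  filter_upwards [hae] with ω hω k
  have h1 : Tendsto (fun i => min (U (ns i) ω) 1) atTop (𝓝 0) := by
    rw [← ENNReal.tendsto_toReal_iff (fun i => ne_top_of_le_ne_top ENNReal.one_ne_top
      (min_le_right _ _)) ENNReal.zero_ne_top]
    simpa using hω
  rw [ENNReal.tendsto_nhds_zero] at h1 ⊢
  intro ε hε
  -- With δ below both caps, `c k` and `1`, a truncated value at most δ forces the untruncated value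
  -- to be at most δ.
  obtain ⟨δ, hδ, hδε⟩ := exists_between (lt_min (lt_min hε (hcpos k)) one_pos)
  filter_upwards [h1 δ hδ] with i hi
  have h2 : U (ns i) ω ≤ δ := by
    rcases min_le_iff.1 hi with h | h
    · exact h
    · exact absurd (lt_of_lt_of_le hδε (min_le_right _ _)) (not_lt.2 h)
  have h3 : min (D k (ns i) ω) (c k) ≤ δ :=
    (le_iSup (fun k => min (D k (ns i) ω) (c k)) k).trans h2
  have h4 := lt_of_lt_of_le hδε (min_le_left _ _)
  rcases min_le_iff.1 h3 with h | h
  · exact h.trans (h4.le.trans (min_le_left _ _))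
  · exact absurd (lt_of_lt_of_le h4 (min_le_right _ _)) (not_lt.2 h)

/-! ### A Slutsky lemma for triangular arrays -/

section Slutsky

variable {E F : Type*} [NormedAddCommGroup E] [NormedSpace ℝ E] [ProperSpace E]
  [MeasurableSpace E] [BorelSpace E] [NormedAddCommGroup F] [NormedSpace ℝ F]
  [MeasurableSpace F] [BorelSpace F]

/-- If `ξ` is approximated by `A S` up to an error that is negligible relative to a tight `S`,
then integrals of bounded continuous functions of `ξ` and of `A S` are asymptotically equal. -/
theorem tendsto_integral_sub_of_negligible {Ω : ℕ → Type*} [∀ j, MeasurableSpace (Ω j)]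
    (μ : ∀ j, Measure (Ω j)) [∀ j, IsProbabilityMeasure (μ j)]
    {S : ∀ j, Ω j → F} {ξ : ∀ j, Ω j → E} (A : F →L[ℝ] E)
    (hS : ∀ j, AEMeasurable (S j) (μ j)) (hξ : ∀ j, AEMeasurable (ξ j) (μ j))
    (hneg : ∀ η : ℝ, 0 < η →
      Tendsto (fun j => μ j {ω | ¬ ‖ξ j ω - A (S j ω)‖ ≤ η * ‖S j ω‖}) atTop (𝓝 0))
    (htight : ∀ ε : ℝ, 0 < ε → ∃ M : ℝ, ∀ᶠ j in atTop, (μ j).real {ω | M < ‖S j ω‖} ≤ ε)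
    (f : E →ᵇ ℝ) :
    Tendsto (fun j => ∫ ω, f (ξ j ω) ∂(μ j) - ∫ ω, f (A (S j ω)) ∂(μ j)) atTop (𝓝 0) := by
  rw [Metric.tendsto_nhds]
  intro ε hε
  -- The added 1 keeps `C` positive when f = 0; likewise `M'` below is kept positive for the
  -- division κ / M'.
  set C : ℝ := ‖f‖ + 1 with hC
  have hCpos : 0 < C := by positivity
  obtain ⟨M, hM⟩ := htight (ε / (8 * C)) (by positivity)
  set M' : ℝ := max M 1 with hM'
  have hM'pos : 0 < M' := lt_of_lt_of_le one_pos (le_max_right _ _)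
  -- Off the bad event, A S has norm at most ‖A‖ M' and ξ is within κ ≤ 1 of it. Both points lie in
  -- a ball that is compact because E is proper, so f is uniformly continuous there even if it is
  -- not on E.
  set R : ℝ := ‖A‖ * M' + 1 with hR
  have huc : UniformContinuousOn f (Metric.closedBall (0 : E) R) :=
    (isCompact_closedBall _ _).uniformContinuousOn_of_continuous f.continuous.continuousOn
  rw [Metric.uniformContinuousOn_iff] at huc
  obtain ⟨δ, hδ, hfδ⟩ := huc (ε / 4) (by positivity)
  set κ : ℝ := min (δ / 2) 1 with hκ
  have hκpos : 0 < κ := by positivity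
  have hn := hneg (κ / M') (by positivity)
  have hn' : ∀ᶠ j in atTop,
      (μ j).real {ω | ¬ ‖ξ j ω - A (S j ω)‖ ≤ (κ / M') * ‖S j ω‖} < ε / (8 * C) := by
    have := (ENNReal.tendsto_toReal ENNReal.zero_ne_top).comp hn
    exact this.eventually_lt_const (by simp; positivity)
  filter_upwards [hM, hn'] with j h1 h2
  set B : Set (Ω j) := {ω | ¬ ‖ξ j ω - A (S j ω)‖ ≤ (κ / M') * ‖S j ω‖} ∪ {ω | M < ‖S j ω‖}
    with hB
  have hBm : NullMeasurableSet B (μ j) := by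
    have e1 : AEMeasurable (fun ω => A (S j ω)) (μ j) :=
      A.continuous.measurable.comp_aemeasurable (hS j)
    have e2 : AEMeasurable (fun ω => ‖ξ j ω - A (S j ω)‖) (μ j) := ((hξ j).sub e1).norm
    have e3 : AEMeasurable (fun ω => (κ / M') * ‖S j ω‖) (μ j) := (hS j).norm.const_mul _
    exact (nullMeasurableSet_le e2 e3).compl.union
      (nullMeasurableSet_lt aemeasurable_const (hS j).norm)
  have hBr : (μ j).real B ≤ ε / (4 * C) := by
    refine (measureReal_union_le _ _).trans ?_
    have : ε / (4 * C) = ε / (8 * C) + ε / (8 * C) := by field_simp; norm_num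
    rw [this]; exact add_le_add h2.le h1
  have if1 : Integrable (fun ω => f (ξ j ω)) (μ j) :=
    Integrable.of_bound (f.continuous.measurable.comp_aemeasurable (hξ j)).aestronglyMeasurable
      ‖f‖ (Eventually.of_forall fun ω => f.norm_coe_le_norm _)
  have if2 : Integrable (fun ω => f (A (S j ω))) (μ j) :=
    Integrable.of_bound ((f.continuous.comp A.continuous).measurable.comp_aemeasurable
      (hS j)).aestronglyMeasurable ‖f‖ (Eventually.of_forall fun ω => f.norm_coe_le_norm _)
  have hpt : ∀ ω, ‖f (ξ j ω) - f (A (S j ω))‖ ≤ ε / 4 + B.indicator (fun _ => 2 * C) ω := by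
    intro ω
    by_cases hω : ω ∈ B
    · rw [Set.indicator_of_mem hω]
      have a1 := f.norm_coe_le_norm (ξ j ω)
      have a2 := f.norm_coe_le_norm (A (S j ω))
      have := norm_sub_le (f (ξ j ω)) (f (A (S j ω)))
      linarith
    · rw [Set.indicator_of_notMem hω, add_zero]
      simp only [hB, Set.mem_union, Set.mem_ofPred_eq, not_or, not_not, not_lt] at hω
      have b1 : ‖S j ω‖ ≤ M' := hω.2.trans (le_max_left _ _)
      have b2 : ‖ξ j ω - A (S j ω)‖ ≤ κ := by
        refine hω.1.trans ?_
        calc κ / M' * ‖S j ω‖ ≤ κ / M' * M' := by gcongr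
          _ = κ := by field_simp
      have b3 : ‖A (S j ω)‖ ≤ ‖A‖ * M' := (A.le_opNorm _).trans (by gcongr)
      have b4 : ‖ξ j ω‖ ≤ R := by
        have : ξ j ω = (ξ j ω - A (S j ω)) + A (S j ω) := by abel
        rw [this]
        refine (norm_add_le _ _).trans ?_
        have : κ ≤ 1 := min_le_right _ _
        linarith
      have := hfδ (ξ j ω) (by simpa using b4) (A (S j ω)) (by simp; linarith) (by
        rw [dist_eq_norm]; exact lt_of_le_of_lt b2 ((min_le_left _ _).trans_lt (by linarith)))
      rw [Real.dist_eq] at this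
      exact this.le
  rw [dist_zero_right, ← integral_sub if1 if2]
  have iB : Integrable (B.indicator fun _ => 2 * C) (μ j) :=
    (integrable_const _).indicator₀ hBm
  calc ‖∫ ω, (f (ξ j ω) - f (A (S j ω))) ∂(μ j)‖
      ≤ ∫ ω, ‖f (ξ j ω) - f (A (S j ω))‖ ∂(μ j) := norm_integral_le_integral_norm _
    _ ≤ ∫ ω, (ε / 4 + B.indicator (fun _ => 2 * C) ω) ∂(μ j) :=
        integral_mono (if1.sub if2).norm ((integrable_const _).add iB) hpt
    _ = ε / 4 + (μ j).real B * (2 * C) := by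
        rw [integral_add (integrable_const _) iB, integral_indicator₀ hBm]
        simp
    _ ≤ ε / 4 + ε / (4 * C) * (2 * C) := by gcongr
    _ < ε := by
        have : ε / (4 * C) * (2 * C) = ε / 2 := by field_simp; norm_num
        linarith

end Slutsky

/-! ### Tightness from convergence of truncated norms -/

/-- The function `x ↦ max 0 (min 1 (‖x‖ - M))`, which vanishes for `‖x‖ ≤ M` and is `1` for
`‖x‖ ≥ M + 1`. -/
noncomputable def normCutoff (F : Type*) [NormedAddCommGroup F] (M : ℕ) : F →ᵇ ℝ :=
  BoundedContinuousFunction.ofNormedAddCommGroup (fun x : F => max 0 (min 1 (‖x‖ - M)))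
    (by fun_prop) 1 (fun x => by
      rw [Real.norm_eq_abs, abs_of_nonneg (le_max_left _ _)]
      exact max_le zero_le_one (min_le_left _ _))

theorem normCutoff_apply {F : Type*} [NormedAddCommGroup F] (M : ℕ) (x : F) :
    normCutoff F M x = max 0 (min 1 (‖x‖ - M)) := rfl

section Tight

variable {F : Type*} [NormedAddCommGroup F] [MeasurableSpace F] [BorelSpace F]

theorem tendsto_integral_normCutoff (ν : Measure F) [IsProbabilityMeasure ν] :
    Tendsto (fun M : ℕ => ∫ x, normCutoff F M x ∂ν) atTop (𝓝 0) := by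
  have : (0 : ℝ) = ∫ _x : F, (0 : ℝ) ∂ν := by simp
  rw [this]
  refine tendsto_integral_of_dominated_convergence (fun _ => 1)
    (fun M => (normCutoff F M).continuous.measurable.aestronglyMeasurable)
    (integrable_const _) (fun M => Eventually.of_forall fun x => ?_)
    (Eventually.of_forall fun x => ?_)
  · rw [normCutoff_apply, Real.norm_eq_abs, abs_of_nonneg (le_max_left _ _)]
    exact max_le zero_le_one (min_le_left _ _)
  · refine tendsto_const_nhds.congr' ?_
    obtain ⟨N, hN⟩ := exists_nat_ge ‖x‖
    filter_upwards [eventually_ge_atTop N] with M hM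
    have : (N : ℝ) ≤ M := by exact_mod_cast hM
    rw [normCutoff_apply, max_eq_left]
    exact (min_le_right _ _).trans (by linarith)

/-- The cutoff dominates the indicator of ‖x‖ > M + 1, and its integral under the limit law is small
for large M. Only the countable family of cutoffs enters, which is what makes the lemma usable along
an almost surely convergent subsequence. -/
theorem tight_of_tendsto_integral_normCutoff {Ω : ℕ → Type*} [∀ j, MeasurableSpace (Ω j)]
    (μ : ∀ j, Measure (Ω j)) [∀ j, IsProbabilityMeasure (μ j)] (ν : Measure F)
    [IsProbabilityMeasure ν] {S : ∀ j, Ω j → F} (hS : ∀ j, AEMeasurable (S j) (μ j))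
    (h : ∀ M : ℕ, Tendsto (fun j => ∫ ω, normCutoff F M (S j ω) ∂(μ j)) atTop
      (𝓝 (∫ x, normCutoff F M x ∂ν)))
    (ε : ℝ) (hε : 0 < ε) : ∃ M : ℝ, ∀ᶠ j in atTop, (μ j).real {ω | M < ‖S j ω‖} ≤ ε := by
  obtain ⟨M, hM⟩ := ((tendsto_integral_normCutoff ν).eventually_lt_const hε).exists
  refine ⟨M + 1, ?_⟩
  filter_upwards [(h M).eventually_lt_const hM] with j hj
  refine le_trans ?_ hj.le
  have hm : NullMeasurableSet {ω | (M : ℝ) + 1 < ‖S j ω‖} (μ j) :=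
    nullMeasurableSet_lt aemeasurable_const (hS j).norm
  have hi : (μ j).real {ω | (M : ℝ) + 1 < ‖S j ω‖}
      = ∫ ω, {ω | (M : ℝ) + 1 < ‖S j ω‖}.indicator (fun _ => (1 : ℝ)) ω ∂(μ j) := by
    rw [integral_indicator₀ hm]; simp
  rw [hi]
  refine integral_mono ((integrable_const (1 : ℝ)).indicator₀ hm)
    (Integrable.of_bound ((normCutoff F M).continuous.measurable.comp_aemeasurable
      (hS j)).aestronglyMeasurable ‖normCutoff F M‖
      (Eventually.of_forall fun ω => (normCutoff F M).norm_coe_le_norm _)) fun ω => ?_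
  by_cases hω : (M : ℝ) + 1 < ‖S j ω‖
  · rw [Set.indicator_of_mem (show ω ∈ {ω | (M : ℝ) + 1 < ‖S j ω‖} from hω), normCutoff_apply,
      min_eq_left (by linarith), max_eq_right zero_le_one]
  · rw [Set.indicator_of_notMem (show ω ∉ {ω | (M : ℝ) + 1 < ‖S j ω‖} from hω), normCutoff_apply]
    exact le_max_left _ _

end Tight

/-! ### First-order conditions and linearization -/

section Linearization

variable {E F : Type*} [NormedAddCommGroup E] [InnerProductSpace ℝ E] [CompleteSpace E]
  [NormedAddCommGroup F] [InnerProductSpace ℝ F] [CompleteSpace F]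

/-- By symmetry of D the derivative of the quadratic form in direction v is 2⟪J v, D f(t)⟫, and it
vanishes for every v. -/
theorem adjoint_apply_eq_zero_of_isLocalMin_quadratic {f : E → F} {J : E →L[ℝ] F} {D : F →L[ℝ] F}
    {t : E} (hD : ∀ x y, inner ℝ (D x) y = inner ℝ x (D y)) (hf : HasFDerivAt f J t)
    (hmin : IsLocalMin (fun s => inner ℝ (f s) (D (f s))) t) :
    J.adjoint (D (f t)) = 0 := by
  have h1 := hf.inner ℝ (D.hasFDerivAt.comp t hf)
  have h2 := hmin.hasFDerivAt_eq_zero h1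
  refine ext_inner_left ℝ fun v => ?_
  have h3 := congrArg (fun L : E →L[ℝ] ℝ => L v) h2
  simp only [ContinuousLinearMap.comp_apply, ContinuousLinearMap.prod_apply, Function.comp_apply,
    fderivInnerCLM_apply, zero_apply] at h3
  rw [ContinuousLinearMap.adjoint_inner_right, inner_zero_right]
  have h4 : inner ℝ (f t) (D (J v)) = inner ℝ (J v) (D (f t)) := by
    rw [← hD, real_inner_comm]
  linarith

/-- Solutions `δ` of the perturbed linear equation `J† D' (z + Γ δ + r) = 0` satisfy
`δ ≈ - (Γ† D Γ)⁻¹ Γ† D z`, up to a small multiple of `‖z‖`. -/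
theorem exists_norm_add_le_of_perturbed_equation (Γ : E →L[ℝ] F) (D : F →L[ℝ] F) (S : E →L[ℝ] E)
    (hS : ∀ v, S (Γ.adjoint (D (Γ v))) = v) {ε : ℝ} (hε : 0 < ε) :
    ∃ η : ℝ, 0 < η ∧ ∀ (J : E →L[ℝ] F) (D' : F →L[ℝ] F) (z r : F) (δ : E),
      ‖J - Γ‖ ≤ η → ‖D' - D‖ ≤ η → ‖r‖ ≤ η * ‖δ‖ → J.adjoint (D' (z + Γ δ + r)) = 0 →
      ‖δ + S (Γ.adjoint (D z))‖ ≤ ε * ‖z‖ := by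
  set T : F →L[ℝ] E := Γ.adjoint.comp D with hT
  set A : F →L[ℝ] E := S.comp T with hA
  set K : ℝ := ‖S‖ * (1 + ‖Γ‖ + 1 + ‖T‖) with hK
  have hK0 : 0 ≤ K := by positivity
  -- Three demands on α: ‖r‖ ≤ ‖δ‖, K α ≤ 1/2 so that the δ-term can be absorbed, and a final error
  -- of at most ε.
  set α : ℝ := min 1 (min (1 / (2 * K + 1)) (ε / (K * (2 * (‖A‖ + 1) + 1) + 1))) with hα
  have hαpos : 0 < α := by positivity
  have hcont : Tendsto (fun q : (E →L[ℝ] F) × (F →L[ℝ] F) => q.1.adjoint.comp q.2) (𝓝 (Γ, D))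
      (𝓝 T) := by
    have : Continuous fun q : (E →L[ℝ] F) × (F →L[ℝ] F) => q.1.adjoint.comp q.2 :=
      (ContinuousLinearMap.adjoint.continuous.comp continuous_fst).clm_comp continuous_snd
    exact this.tendsto (Γ, D)
  obtain ⟨β, hβ, hball⟩ := Metric.tendsto_nhds_nhds.1 hcont α hαpos
  refine ⟨min (β / 2) α, by positivity, fun J D' z r δ hJ hD' hr heq => ?_⟩
  set T' : F →L[ℝ] E := J.adjoint.comp D' with hT'
  have hTT : ‖T' - T‖ ≤ α := by
    have : dist (J, D') (Γ, D) < β := by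
      rw [Prod.dist_eq, dist_eq_norm, dist_eq_norm]
      exact max_lt ((hJ.trans (min_le_left _ _)).trans_lt (by linarith))
        ((hD'.trans (min_le_left _ _)).trans_lt (by linarith))
    have := hball this
    rw [dist_eq_norm] at this
    exact this.le
  have hr' : ‖r‖ ≤ α * ‖δ‖ := hr.trans (by gcongr; exact min_le_right _ _)
  have hα1 : α ≤ 1 := min_le_left _ _
  -- Since T' annihilates z + Γδ + r, applying S T to that vector equals applying S (T - T'), and S
  -- T Γ δ = δ isolates δ.
  have key : δ + A z = S ((T - T') (z + Γ δ + r) - T r) := by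
    have e1 : T' (z + Γ δ + r) = 0 := heq
    have e2 : S (T (Γ δ)) = δ := hS δ
    rw [sub_apply, e1, sub_zero, map_add, map_add, map_sub, map_add, map_add,
      e2]
    simp only [hA, ContinuousLinearMap.comp_apply]
    abel
  have hbound : ‖δ + A z‖ ≤ K * α * (‖z‖ + ‖δ‖) := by
    rw [key]
    have n1 : ‖z + Γ δ + r‖ ≤ ‖z‖ + ‖Γ‖ * ‖δ‖ + ‖δ‖ := by
      refine (norm_add_le _ _).trans (add_le_add ((norm_add_le _ _).trans
        (by gcongr; exact Γ.le_opNorm _)) (hr'.trans ?_))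
      exact mul_le_of_le_one_left (norm_nonneg _) hα1
    have n2 : ‖(T - T') (z + Γ δ + r)‖ ≤ α * (‖z‖ + ‖Γ‖ * ‖δ‖ + ‖δ‖) := by
      refine ((T - T').le_opNorm _).trans ?_
      rw [norm_sub_rev]
      gcongr
    have n3 : ‖T r‖ ≤ ‖T‖ * (α * ‖δ‖) := (T.le_opNorm _).trans (by gcongr)
    calc ‖S ((T - T') (z + Γ δ + r) - T r)‖
        ≤ ‖S‖ * (α * (‖z‖ + ‖Γ‖ * ‖δ‖ + ‖δ‖) + ‖T‖ * (α * ‖δ‖)) :=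
          (S.le_opNorm _).trans (by gcongr; exact (norm_sub_le _ _).trans (add_le_add n2 n3))
      _ = ‖S‖ * α * (‖z‖ + (‖Γ‖ + 1 + ‖T‖) * ‖δ‖) := by ring
      _ ≤ ‖S‖ * α * ((1 + ‖Γ‖ + 1 + ‖T‖) * ‖z‖ + (1 + ‖Γ‖ + 1 + ‖T‖) * ‖δ‖) := by
          have a1 := norm_nonneg Γ
          have a2 := norm_nonneg T
          gcongr
          · exact le_mul_of_one_le_left (norm_nonneg _) (by linarith)
          · linarith
      _ = K * α * (‖z‖ + ‖δ‖) := by rw [hK]; ring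
  have hKα : K * α ≤ 1 / 2 := by
    have : α ≤ 1 / (2 * K + 1) := (min_le_right _ _).trans (min_le_left _ _)
    rw [le_div_iff₀ (by positivity)] at this
    nlinarith
  -- Absorption: ‖δ‖ occurs on the right with coefficient at most 1/2, so no prior bound on δ is
  -- required.
  have hδ : ‖δ‖ ≤ 2 * (‖A‖ + 1) * ‖z‖ := by
    have e : δ = (δ + A z) - A z := by abel
    have a1 : ‖δ‖ ≤ ‖δ + A z‖ + ‖A z‖ := by
      conv_lhs => rw [e]
      exact norm_sub_le _ _
    have a2 := A.le_opNorm z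
    have a3 : K * α * (‖z‖ + ‖δ‖) ≤ 1 / 2 * (‖z‖ + ‖δ‖) := by gcongr
    have := norm_nonneg z
    nlinarith
  have hαε : α * (K * (2 * (‖A‖ + 1) + 1) + 1) ≤ ε := by
    have : α ≤ ε / (K * (2 * (‖A‖ + 1) + 1) + 1) := (min_le_right _ _).trans (min_le_right _ _)
    rwa [le_div_iff₀ (by positivity)] at this
  calc ‖δ + A z‖ ≤ K * α * (‖z‖ + ‖δ‖) := hbound
    _ ≤ K * α * (‖z‖ + 2 * (‖A‖ + 1) * ‖z‖) := by gcongr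
    _ = α * (K * (2 * (‖A‖ + 1) + 1)) * ‖z‖ := by ring
    _ ≤ ε * ‖z‖ := by gcongr; nlinarith

end Linearization

/-- Consistency of minimizers under uniform convergence of the objective functions. -/
theorem tendsto_of_isArgminOn {E : Type*} [MetricSpace E] {Θ : Set E} (hΘ : IsCompact Θ)
    {q : E → ℝ} {t₀ : E} (hq : ContinuousOn q Θ) (hmin : ∀ t, IsArgminOn q Θ t → t = t₀)
    {Q : ℕ → E → ℝ} (hQ : TendstoUniformlyOn Q q atTop Θ) {t : ℕ → E}
    (ht : ∀ᶠ n in atTop, IsArgminOn (Q n) Θ (t n)) : Tendsto t atTop (𝓝 t₀) := by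
  -- Along an ultrafilter compactness supplies a limit s of `t n` without extracting subsequences.
  -- Uniform convergence gives Q n (t n) → q s, and the limit of Q n (t n) ≤ Q n u shows that s
  -- minimizes q.
  rw [tendsto_iff_ultrafilter]
  intro U hU
  have hmem : ∀ᶠ n in (U : Filter ℕ), t n ∈ Θ := hU (ht.mono fun n h => h.1)
  obtain ⟨s, hsΘ, hs⟩ := isCompact_iff_ultrafilter_le_nhds.1 hΘ (U.map t)
    (le_principal_iff.2 hmem)
  suffices s = t₀ by rw [← this]; exact hs
  refine hmin s ⟨hsΘ, fun u hu => ?_⟩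
  have hts : Tendsto t U (𝓝[Θ] s) := tendsto_nhdsWithin_iff.2 ⟨hs, hmem⟩
  have h1 : Tendsto (fun n => q (t n)) U (𝓝 (q s)) := (hq s hsΘ).tendsto.comp hts
  have h2 : Tendsto (fun n => Q n (t n)) U (𝓝 (q s)) := by
    rw [Metric.tendsto_nhds] at h1 ⊢
    rw [Metric.tendstoUniformlyOn_iff] at hQ
    intro ε hε
    filter_upwards [h1 (ε / 2) (by positivity), hU (hQ (ε / 2) (by positivity)), hmem]
      with n a b c
    have b' := b (t n) c
    rw [dist_comm] at b'
    linarith [dist_triangle (Q n (t n)) (q (t n)) (q s)]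
  have h3 : Tendsto (fun n => Q n u) U (𝓝 (q u)) := (hQ.tendsto_at hu).mono_left hU
  exact le_of_tendsto_of_tendsto h2 h3 (hU (ht.mono fun n h => h.2 u hu))

/-! ### Laws of large numbers and central limit theorem for sample averages -/

theorem avg_sample_eq {Ω 𝒳 E : Type*} [AddCommGroup E] [Module ℝ E] (X : ℕ → Ω → 𝒳) (n : ℕ)
    (ω : Ω) (h : 𝒳 → E) :
    avg (sample X n ω) h = (n : ℝ)⁻¹ • ∑ i ∈ Finset.range n, h (X i ω) := by
  rw [avg, ← Fin.sum_univ_eq_sum_range fun i => h (X i ω)]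
  rfl

section Sampling

variable {Ω 𝒳 : Type*} [MeasurableSpace Ω] [MeasurableSpace 𝒳] {P : Measure Ω}
  {F₀ : Measure 𝒳} {X : ℕ → Ω → 𝒳}

theorem ae_forall_sample (hlaw : ∀ i, HasLaw (X i) F₀ P) {p : 𝒳 → Prop} (hp : ∀ᵐ x ∂F₀, p x) :
    ∀ᵐ ω ∂P, ∀ i, p (X i ω) := by
  refine ae_all_iff.2 fun i => ?_
  refine ae_of_ae_map (hlaw i).aemeasurable ?_
  rwa [(hlaw i).map_eq]

theorem identDistrib_comp_of_hasLaw (hlaw : ∀ i, HasLaw (X i) F₀ P) {B : Type*}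
    [MeasurableSpace B] {Φ : 𝒳 → B} (hΦ : Measurable Φ) (i j : ℕ) :
    IdentDistrib (fun ω => Φ (X i ω)) (fun ω => Φ (X j ω)) P P := by
  have : IdentDistrib (X i) (X j) P P :=
    ⟨(hlaw i).aemeasurable, (hlaw j).aemeasurable, (hlaw i).map_eq.trans (hlaw j).map_eq.symm⟩
  exact this.comp hΦ

theorem integral_comp_of_hasLaw (hlaw : ∀ i, HasLaw (X i) F₀ P) {B : Type*}
    [NormedAddCommGroup B] [NormedSpace ℝ B] {Φ : 𝒳 → B} (hΦ : AEStronglyMeasurable Φ F₀) (i : ℕ) :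
    ∫ ω, Φ (X i ω) ∂P = ∫ x, Φ x ∂F₀ := by
  rw [← (hlaw i).map_eq, integral_map (hlaw i).aemeasurable (by rwa [(hlaw i).map_eq])]

theorem tendsto_avg_sample_ae (hind : iIndepFun X P) (hlaw : ∀ i, HasLaw (X i) F₀ P)
    {B : Type*} [NormedAddCommGroup B] [NormedSpace ℝ B] [CompleteSpace B] {Φ : 𝒳 → B}
    (hΦ : Integrable Φ F₀) :
    ∀ᵐ ω ∂P, Tendsto (fun n => avg (sample X n ω) Φ) atTop (𝓝 (∫ x, Φ x ∂F₀)) := by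
  borelize B
  -- Independence and identical distribution of Φ ∘ X i are obtained from a measurable version of Φ;
  -- almost surely the two agree at all observations at once.
  set Ψ := hΦ.1.mk Φ with hΨ
  have hΨm : Measurable Ψ := hΦ.1.stronglyMeasurable_mk.measurable
  have heq : Φ =ᵐ[F₀] Ψ := hΦ.1.ae_eq_mk
  have hint : Integrable (fun ω => Ψ (X 0 ω)) P := by
    have h1 : Integrable Ψ (P.map (X 0)) := by
      rw [(hlaw 0).map_eq]; exact hΦ.congr heq
    exact h1.comp_aemeasurable (hlaw 0).aemeasurable
  have hpair : Pairwise (Function.onFun (fun f g => IndepFun f g P) fun i ω => Ψ (X i ω)) :=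
    fun i j hij => (hind.indepFun hij).comp hΨm hΨm
  have h := strong_law_ae (fun i ω => Ψ (X i ω)) hint hpair
    (fun i => identDistrib_comp_of_hasLaw hlaw hΨm i 0)
  filter_upwards [h, ae_forall_sample hlaw heq] with ω h1 h2
  rw [integral_comp_of_hasLaw hlaw hΦ.1.stronglyMeasurable_mk.aestronglyMeasurable] at h1
  rw [integral_congr_ae heq]
  refine h1.congr fun n => ?_
  rw [avg_sample_eq]
  simp only [h2]

/-- The covariance matrix of a random vector. -/
noncomputable def covMatrix (F₀ : Measure 𝒳) {ι : Type*} [Fintype ι]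
    (Y : 𝒳 → EuclideanSpace ℝ ι) : Matrix ι ι ℝ :=
  Matrix.of fun a b => (∫ x, Y x a * Y x b ∂F₀) - (∫ x, Y x a ∂F₀) * (∫ x, Y x b ∂F₀)

section Cov

variable {ι : Type*} [Fintype ι] {Y : 𝒳 → EuclideanSpace ℝ ι}

theorem memLp_coord {q : ℝ≥0∞} (hY : MemLp Y q F₀) (a : ι) : MemLp (fun x => Y x a) q F₀ := by
  refine hY.of_le ?_ (Eventually.of_forall fun x => PiLp.norm_apply_le (Y x) a)
  exact (EuclideanSpace.proj (𝕜 := ℝ) a).continuous.comp_aestronglyMeasurable hY.1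

/-- Expand the variance of the linear form. Positive semidefiniteness and the passage to the scalar
central limit theorem both rest on this identity. -/
theorem dotProduct_covMatrix_mulVec [IsProbabilityMeasure F₀] (hY : MemLp Y 2 F₀)
    (t : EuclideanSpace ℝ ι) :
    t.ofLp ⬝ᵥ covMatrix F₀ Y *ᵥ t.ofLp = Var[fun x => inner ℝ (Y x) t; F₀] := by
  have hY1 : ∀ a, Integrable (fun x => Y x a) F₀ := fun a =>
    (memLp_coord hY a).integrable (by norm_num)
  have hY2 : ∀ a b, Integrable (fun x => Y x a * Y x b) F₀ := fun a b =>
    (memLp_coord hY a).integrable_mul (memLp_coord hY b)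
  have hm : MemLp (fun x => inner ℝ (Y x) t) 2 F₀ := hY.inner_const t
  have hin : ∀ x, inner ℝ (Y x) t = ∑ a, t a * Y x a := fun x => by
    simp [PiLp.inner_apply]
  rw [variance_eq_sub hm]
  have e1 : ∫ x, inner ℝ (Y x) t ∂F₀ = ∑ a, t a * ∫ x, Y x a ∂F₀ := by
    simp_rw [hin]
    rw [integral_finsetSum _ fun a _ => (hY1 a).const_mul _]
    simp_rw [integral_const_mul]
  have e2 : ∫ x, (inner ℝ (Y x) t) ^ 2 ∂F₀ = ∑ a, ∑ b, t a * t b * ∫ x, Y x a * Y x b ∂F₀ := by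
    have : ∀ x, (inner ℝ (Y x) t) ^ 2 = ∑ a, ∑ b, t a * t b * (Y x a * Y x b) := fun x => by
      rw [hin, sq, Finset.sum_mul_sum]
      refine Finset.sum_congr rfl fun a _ => Finset.sum_congr rfl fun b _ => by ring
    simp_rw [this]
    rw [integral_finsetSum _ fun a _ => integrable_finsetSum _ fun b _ => (hY2 a b).const_mul _]
    refine Finset.sum_congr rfl fun a _ => ?_
    rw [integral_finsetSum _ fun b _ => (hY2 a b).const_mul _]
    simp_rw [integral_const_mul]
  have e3 : F₀[(fun x => inner ℝ (Y x) t) ^ 2] = ∫ x, (inner ℝ (Y x) t) ^ 2 ∂F₀ := rfl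
  rw [e3, e2, e1, sq, Finset.sum_mul_sum, ← Finset.sum_sub_distrib]
  simp only [dotProduct, Matrix.mulVec, covMatrix, Matrix.of_apply, Finset.mul_sum]
  refine Finset.sum_congr rfl fun a _ => ?_
  rw [← Finset.sum_sub_distrib]
  exact Finset.sum_congr rfl fun b _ => by ring

theorem posSemidef_covMatrix [IsProbabilityMeasure F₀] (hY : MemLp Y 2 F₀) :
    (covMatrix F₀ Y).PosSemidef := by
  refine Matrix.PosSemidef.of_dotProduct_mulVec_nonneg ?_ fun x => ?_
  · ext a b
    simp [covMatrix, mul_comm]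
  · have := dotProduct_covMatrix_mulVec hY (WithLp.toLp 2 x)
    simp only [star_trivial]
    rw [this]
    exact variance_nonneg _ _

theorem tendstoInDistribution_sqrt_avg_sample [IsProbabilityMeasure P] [DecidableEq ι]
    (hind : iIndepFun X P) (hlaw : ∀ i, HasLaw (X i) F₀ P) (hY : MemLp Y 2 F₀) :
    TendstoInDistribution
      (fun (n : ℕ) ω => √(n : ℝ) • (avg (sample X n ω) Y - ∫ x, Y x ∂F₀)) atTop id (fun _ => P)
      (multivariateGaussian 0 (covMatrix F₀ Y)) := by
  have hF : IsProbabilityMeasure F₀ := by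
    rw [← (hlaw 0).map_eq]; exact Measure.isProbabilityMeasure_map (hlaw 0).aemeasurable
  have hYX : ∀ i, AEMeasurable (fun ω => Y (X i ω)) P := fun i => by
    have : AEMeasurable Y (P.map (X i)) := by rw [(hlaw i).map_eq]; exact hY.1.aemeasurable
    exact this.comp_aemeasurable (hlaw i).aemeasurable
  have hmeas : ∀ n : ℕ, AEMeasurable
      (fun ω => √(n : ℝ) • (avg (sample X n ω) Y - ∫ x, Y x ∂F₀)) P := fun n => by
    simp_rw [avg_sample_eq]
    have h1 : AEMeasurable (fun ω => ∑ i ∈ Finset.range n, Y (X i ω)) P :=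
      Finset.aemeasurable_fun_sum _ fun i _ => hYX i
    exact ((h1.const_smul (n : ℝ)⁻¹).sub_const _).const_smul (√(n : ℝ))
  refine ⟨hmeas, aemeasurable_id, ProbabilityMeasure.tendsto_iff_tendsto_charFun.2 fun t => ?_⟩
  change Tendsto (fun n : ℕ => charFun
    (P.map fun ω => √(n : ℝ) • (avg (sample X n ω) Y - ∫ x, Y x ∂F₀)) t) atTop
    (𝓝 (charFun ((multivariateGaussian 0 (covMatrix F₀ Y)).map id) t))
  rw [Measure.map_id]
  -- reduction to the scalar central limit theorem for `⟪Y, t⟫`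
  set Z := hY.1.mk Y with hZ
  have hZm : Measurable Z := hY.1.stronglyMeasurable_mk.measurable
  have heq : Y =ᵐ[F₀] Z := hY.1.ae_eq_mk
  have hZ2 : MemLp Z 2 F₀ := hY.ae_eq heq
  have hφm : Measurable fun x => inner ℝ (Z x) t := hZm.inner_const
  have hφ2 : MemLp (fun x => inner ℝ (Z x) t) 2 F₀ := hZ2.inner_const t
  have h2 : MemLp (fun ω => inner ℝ (Z (X 0 ω)) t) 2 P := by
    have : MemLp (fun x => inner ℝ (Z x) t) 2 (P.map (X 0)) := by rwa [(hlaw 0).map_eq]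
    exact this.comp_of_map (hlaw 0).aemeasurable
  have hvar : Var[fun ω => inner ℝ (Z (X 0 ω)) t; P] = t.ofLp ⬝ᵥ covMatrix F₀ Y *ᵥ t.ofLp := by
    rw [dotProduct_covMatrix_mulVec hY]
    have e1 : Var[fun x => inner ℝ (Y x) t; F₀] = Var[fun x => inner ℝ (Z x) t; F₀] :=
      variance_congr (heq.mono fun x hx => by simp [hx])
    rw [e1, ← (hlaw 0).map_eq, variance_map hφm.aemeasurable (hlaw 0).aemeasurable]
    rfl
  have hclt := tendstoInDistribution_inv_sqrt_mul_sum_sub (P := P)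
    (P' := gaussianReal 0 (Var[fun ω => inner ℝ (Z (X 0 ω)) t; P]).toNNReal) (Y := id)
    (X := fun i ω => inner ℝ (Z (X i ω)) t) ⟨aemeasurable_id, Measure.map_id⟩ h2
    (hind.comp (fun _ x => inner ℝ (Z x) t) fun _ => hφm)
    (fun i => identDistrib_comp_of_hasLaw hlaw hφm i 0)
  -- Cramér–Wold: the characteristic function of the vector at t is that of its projection on t at
  -- 1.
  have hc := ProbabilityMeasure.tendsto_iff_tendsto_charFun.1 hclt.tendsto 1
  change Tendsto (fun n : ℕ => charFun (P.map fun ω => (√(n : ℝ))⁻¹ *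
    (∑ k ∈ Finset.range n, inner ℝ (Z (X k ω)) t - n * ∫ ω, inner ℝ (Z (X 0 ω)) t ∂P)) 1) atTop
    (𝓝 (charFun ((gaussianReal 0 (Var[fun ω => inner ℝ (Z (X 0 ω)) t; P]).toNNReal).map id) 1))
    at hc
  rw [Measure.map_id, charFun_gaussianReal, hvar, Real.coe_toNNReal _ (by
    rw [← hvar]; exact variance_nonneg _ _)] at hc
  rw [charFun_multivariateGaussian (posSemidef_covMatrix hY)]
  have hlim : Complex.exp ((inner ℝ t (0 : EuclideanSpace ℝ ι) : ℝ) * Complex.I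
        - ((t.ofLp ⬝ᵥ covMatrix F₀ Y *ᵥ t.ofLp : ℝ) : ℂ) / 2)
      = Complex.exp (((1 : ℝ) : ℂ) * ((0 : ℝ) : ℂ) * Complex.I
        - ((t.ofLp ⬝ᵥ covMatrix F₀ Y *ᵥ t.ofLp : ℝ) : ℂ) * ((1 : ℝ) : ℂ) ^ 2 / 2) := by simp
  rw [hlim]
  refine hc.congr fun n => ?_
  have hm0 : ∫ ω, inner ℝ (Z (X 0 ω)) t ∂P = inner ℝ (∫ x, Y x ∂F₀) t := by
    rw [integral_comp_of_hasLaw hlaw hφm.aestronglyMeasurable (Φ := fun x => inner ℝ (Z x) t),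
      integral_congr_ae heq]
    simp_rw [real_inner_comm]
    exact integral_inner (hZ2.integrable (by norm_num)) t
  rw [charFun_apply, charFun_apply, integral_map (hmeas n) (by fun_prop), integral_map
    (hclt.forall_aemeasurable n) (by fun_prop)]
  refine integral_congr_ae ?_
  filter_upwards [ae_forall_sample hlaw heq] with ω hω
  rcases Nat.eq_zero_or_pos n with rfl | hn
  · simp
  have hn' : (0 : ℝ) < n := by exact_mod_cast hn
  congr 3
  rw [hm0, avg_sample_eq]
  simp only [hω, inner_smul_left, inner_sub_left, sum_inner, RCLike.inner_apply, conj_trivial,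
    one_mul]
  have : √(n : ℝ) * √(n : ℝ) = n := Real.mul_self_sqrt hn'.le
  have h3 : √(n : ℝ) ≠ 0 := (Real.sqrt_pos.2 hn').ne'
  generalize √(n : ℝ) = s at this h3 ⊢
  rw [← this]
  field_simp

end Cov

end Sampling

/-! ### Linear images of centered Gaussian vectors -/

/-- The continuous linear map of Euclidean spaces given by a matrix. -/
noncomputable def matrixCLM {ι κ : Type*} [Fintype ι] [DecidableEq ι] [Fintype κ]
    (A : Matrix κ ι ℝ) : EuclideanSpace ℝ ι →L[ℝ] EuclideanSpace ℝ κ :=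
  (Matrix.toEuclideanLin A).toContinuousLinearMap

section MatrixCLM

variable {ι κ : Type*} [Fintype ι] [DecidableEq ι] [Fintype κ]

theorem ofLp_matrixCLM (A : Matrix κ ι ℝ) (x : EuclideanSpace ℝ ι) :
    (matrixCLM A x).ofLp = A *ᵥ x.ofLp := rfl

theorem norm_matrixCLM (A : Matrix κ ι ℝ) : ‖matrixCLM A‖ = ‖A‖ := rfl

theorem matrixCLM_mul {l : Type*} [Fintype l] [DecidableEq l] (A : Matrix κ ι ℝ)
    (B : Matrix ι l ℝ) (x : EuclideanSpace ℝ l) :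
    matrixCLM (A * B) x = matrixCLM A (matrixCLM B x) := by
  apply WithLp.ofLp_injective 2
  simp [ofLp_matrixCLM, Matrix.mulVec_mulVec]

theorem inner_matrixCLM_left [DecidableEq κ] (A : Matrix κ ι ℝ) (x : EuclideanSpace ℝ ι)
    (y : EuclideanSpace ℝ κ) :
    inner ℝ (matrixCLM A x) y = inner ℝ x (matrixCLM Aᵀ y) := by
  simp only [EuclideanSpace.inner_eq_star_dotProduct, ofLp_matrixCLM, star_trivial]
  rw [Matrix.dotProduct_mulVec, Matrix.mulVec_transpose, dotProduct_comm]

theorem adjoint_matrixCLM [DecidableEq κ] (A : Matrix κ ι ℝ) :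
    (matrixCLM A).adjoint = matrixCLM Aᵀ := by
  rw [eq_comm, ContinuousLinearMap.eq_adjoint_iff]
  intro x y
  rw [inner_matrixCLM_left, Matrix.transpose_transpose]

theorem quadForm_eq_inner (A : Matrix ι ι ℝ) (v : EuclideanSpace ℝ ι) :
    quadForm A v = inner ℝ v (matrixCLM A v) := by
  simp only [EuclideanSpace.inner_eq_star_dotProduct, ofLp_matrixCLM, star_trivial, quadForm]
  rw [dotProduct_comm]

theorem map_multivariateGaussian_matrixCLM [DecidableEq κ] {S : Matrix ι ι ℝ} (hS : S.PosSemidef)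
    (A : Matrix κ ι ℝ) :
    (multivariateGaussian 0 S).map (matrixCLM A) = multivariateGaussian 0 (A * S * Aᵀ) := by
  have hS' : (A * S * Aᵀ).PosSemidef := by
    simpa using hS.mul_mul_conjTranspose_same A
  have : IsProbabilityMeasure ((multivariateGaussian 0 S).map (matrixCLM A)) :=
    Measure.isProbabilityMeasure_map (matrixCLM A).continuous.measurable.aemeasurable
  apply Measure.ext_of_charFun
  ext t
  rw [charFun_multivariateGaussian hS', charFun_apply,
    integral_map (matrixCLM A).continuous.measurable.aemeasurable (by fun_prop)]
  simp_rw [inner_matrixCLM_left]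
  rw [← charFun_apply, charFun_multivariateGaussian hS]
  simp only [inner_zero_right, ofLp_matrixCLM]
  congr 4
  rw [← Matrix.mulVec_mulVec, ← Matrix.mulVec_mulVec, Matrix.dotProduct_mulVec t.ofLp A,
    Matrix.mulVec_transpose]

end MatrixCLM

/-! ### The bootstrap measure -/

theorem isProbabilityMeasure_uniformOn_fin {n : ℕ} (i : Fin n) :
    IsProbabilityMeasure (uniformOn (Set.univ : Set (Fin n))) :=
  isProbabilityMeasure_uniformOn Set.finite_univ ⟨i, trivial⟩

instance isProbabilityMeasure_bootMeasure (n : ℕ) : IsProbabilityMeasure (bootMeasure n) := by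
  have : ∀ _ : Fin n, IsProbabilityMeasure (uniformOn (Set.univ : Set (Fin n))) :=
    isProbabilityMeasure_uniformOn_fin
  unfold bootMeasure
  infer_instance

theorem integral_uniformOn_fin {n : ℕ} (hn : 0 < n) {E : Type*} [NormedAddCommGroup E]
    [NormedSpace ℝ E] [CompleteSpace E] (f : Fin n → E) :
    ∫ i, f i ∂(uniformOn (Set.univ : Set (Fin n))) = (n : ℝ)⁻¹ • ∑ i, f i := by
  have := isProbabilityMeasure_uniformOn_fin (⟨0, hn⟩ : Fin n)
  rw [integral_fintype Integrable.of_finite, Finset.smul_sum]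
  refine Finset.sum_congr rfl fun i _ => ?_
  congr 1
  rw [measureReal_def, uniformOn_univ]
  simp

theorem integral_bootMeasure_eval {n : ℕ} {E : Type*} [NormedAddCommGroup E] [NormedSpace ℝ E]
    [CompleteSpace E] (f : Fin n → E) (k : Fin n) :
    ∫ I, f (I k) ∂(bootMeasure n) = (n : ℝ)⁻¹ • ∑ i, f i := by
  have := isProbabilityMeasure_uniformOn_fin k
  rw [← integral_uniformOn_fin k.pos]
  exact integral_comp_eval (μ := fun _ : Fin n => uniformOn (Set.univ : Set (Fin n))) (i := k)
    (by fun_prop)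

/-! ### Bootstrap law of large numbers -/

section BootLLN

variable {𝒳 B : Type*} [NormedAddCommGroup B] [NormedSpace ℝ B]

/-- The bootstrap mean deviation `E*‖Φ_n^* - Φ_n‖` of a sample average. -/
noncomputable def bootDeviation {n : ℕ} (x : Fin n → 𝒳) (Φ : 𝒳 → B) : ℝ :=
  ∫ I, ‖avg (x ∘ I) Φ - avg x Φ‖ ∂(bootMeasure n)

theorem bootDeviation_nonneg {n : ℕ} (x : Fin n → 𝒳) (Φ : 𝒳 → B) : 0 ≤ bootDeviation x Φ :=
  integral_nonneg fun _ => norm_nonneg _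

theorem avg_add {n : ℕ} (x : Fin n → 𝒳) (Φ Ψ : 𝒳 → B) :
    avg x (Φ + Ψ) = avg x Φ + avg x Ψ := by
  simp [avg, Finset.sum_add_distrib]

theorem avg_sub {n : ℕ} (x : Fin n → 𝒳) (Φ Ψ : 𝒳 → B) :
    avg x (fun y => Φ y - Ψ y) = avg x Φ - avg x Ψ := by
  simp [avg, Finset.sum_sub_distrib, smul_sub]

theorem norm_avg_le {n : ℕ} (x : Fin n → 𝒳) (Φ : 𝒳 → B) :
    ‖avg x Φ‖ ≤ avg x fun y => ‖Φ y‖ := by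
  rw [avg, avg, norm_smul, smul_eq_mul, norm_inv, RCLike.norm_natCast]
  gcongr
  exact norm_sum_le _ _

theorem integral_bootMeasure_avg {n : ℕ} (x : Fin n → 𝒳) (h : 𝒳 → ℝ) :
    ∫ I, avg (x ∘ I) h ∂(bootMeasure n) = avg x h := by
  rcases Nat.eq_zero_or_pos n with rfl | hn
  · simp [avg]
  have hn' : (n : ℝ) ≠ 0 := by exact_mod_cast hn.ne'
  simp only [avg, smul_eq_mul, Function.comp_apply]
  rw [integral_const_mul, integral_finsetSum _ fun _ _ => Integrable.of_finite]
  simp_rw [integral_bootMeasure_eval fun i => h (x i)]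
  rw [Finset.sum_const, Finset.card_univ, Fintype.card_fin, nsmul_eq_mul, smul_eq_mul]
  field_simp

theorem bootDeviation_add_le {n : ℕ} (x : Fin n → 𝒳) (Φ Ψ : 𝒳 → B) :
    bootDeviation x (Φ + Ψ) ≤ bootDeviation x Φ + bootDeviation x Ψ := by
  unfold bootDeviation
  rw [← integral_add Integrable.of_finite Integrable.of_finite]
  refine integral_mono Integrable.of_finite Integrable.of_finite fun I => ?_
  simp only [avg_add]
  rw [add_sub_add_comm]
  exact norm_add_le _ _

/-- The bootstrap mean of an average is the sample average, so replacing Φ by Ψ costs the sample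
mean of ‖Φ - Ψ‖ twice, once for each average. This is the L¹-stability behind the approximation
argument for the bootstrap law of large numbers. -/
theorem bootDeviation_le {n : ℕ} (x : Fin n → 𝒳) (Φ Ψ : 𝒳 → B) :
    bootDeviation x Φ ≤ bootDeviation x Ψ + 2 * avg x fun y => ‖Φ y - Ψ y‖ := by
  have key : ∀ I : Fin n → Fin n, ‖avg (x ∘ I) Φ - avg x Φ‖ ≤ ‖avg (x ∘ I) Ψ - avg x Ψ‖
      + ((avg (x ∘ I) fun y => ‖Φ y - Ψ y‖) + avg x fun y => ‖Φ y - Ψ y‖) := fun I => by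
    have e : avg (x ∘ I) Φ - avg x Φ = (avg (x ∘ I) Ψ - avg x Ψ)
        + (avg (x ∘ I) (fun y => Φ y - Ψ y) - avg x fun y => Φ y - Ψ y) := by
      rw [avg_sub, avg_sub]; abel
    rw [e]
    refine (norm_add_le _ _).trans (add_le_add_right ((norm_sub_le _ _).trans ?_) _)
    exact add_le_add (norm_avg_le _ _) (norm_avg_le _ _)
  unfold bootDeviation
  refine (integral_mono Integrable.of_finite Integrable.of_finite key).trans (le_of_eq ?_)
  rw [integral_add Integrable.of_finite Integrable.of_finite,
    integral_add Integrable.of_finite Integrable.of_finite, integral_bootMeasure_avg]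
  simp
  ring

/-- The integral is the variance of a sum of n independent terms, each of variance at most 1. -/
theorem integral_bootMeasure_sq_sum_le {n : ℕ} (hn : 0 < n) (a : Fin n → ℝ)
    (ha : ∀ i, |a i| ≤ 1) :
    ∫ I, (∑ k, a (I k) - ∑ i, a i) ^ 2 ∂(bootMeasure n) ≤ n := by
  have hn' : (n : ℝ) ≠ 0 := by exact_mod_cast hn.ne'
  have hprob : ∀ _ : Fin n, IsProbabilityMeasure (uniformOn (Set.univ : Set (Fin n))) :=
    isProbabilityMeasure_uniformOn_fin
  have hprob0 := hprob ⟨0, hn⟩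
  have hv := variance_sum_pi (μ := fun _ : Fin n => uniformOn (Set.univ : Set (Fin n)))
    (X := fun _ => a) (fun _ => MemLp.of_discrete)
  have hmean : ∫ I, (∑ k, a (I k)) ∂(bootMeasure n) = ∑ i, a i := by
    rw [integral_finsetSum _ fun _ _ => Integrable.of_finite]
    simp_rw [integral_bootMeasure_eval a]
    simp
    field_simp
  have hle : Var[a; uniformOn (Set.univ : Set (Fin n))] ≤ 1 := by
    refine (variance_le_expectation_sq (by fun_prop)).trans ?_
    calc ∫ i, (a ^ 2) i ∂(uniformOn (Set.univ : Set (Fin n)))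
        ≤ ∫ _i, (1 : ℝ) ∂(uniformOn (Set.univ : Set (Fin n))) := by
          refine integral_mono Integrable.of_finite Integrable.of_finite fun i => ?_
          simpa using ha i
      _ = 1 := by simp
  have heq : ∫ I, (∑ k, a (I k) - ∑ i, a i) ^ 2 ∂(bootMeasure n)
      = Var[∑ k, fun I : Fin n → Fin n => a (I k); bootMeasure n] := by
    rw [variance_eq_integral (by fun_prop)]
    simp only [Finset.sum_apply]
    rw [hmean]
  rw [heq]
  refine (le_of_eq hv).trans ?_
  refine (Finset.sum_le_sum fun i _ => hle).trans (by simp)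

theorem bootDeviation_le_inv_sqrt {n : ℕ} (hn : 0 < n) (x : Fin n → 𝒳) (h : 𝒳 → ℝ)
    (hh : ∀ y, |h y| ≤ 1) : bootDeviation x h ≤ (√(n : ℝ))⁻¹ := by
  have hn' : (0 : ℝ) < n := by exact_mod_cast hn
  have hs : 0 < √(n : ℝ) := Real.sqrt_pos.2 hn'
  have hss : √(n : ℝ) * √(n : ℝ) = n := Real.mul_self_sqrt hn'.le
  have h1 := integral_bootMeasure_sq_sum_le hn (fun i => h (x i)) fun i => hh _
  -- The inequality |y| ≤ (y²/√n + √n)/2 replaces Cauchy–Schwarz and is sharp at the expected size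
  -- |y| = √n.
  have hpt : ∀ I : Fin n → Fin n, ‖avg (x ∘ I) h - avg x h‖ ≤
      (n : ℝ)⁻¹ * (((∑ k, h (x (I k)) - ∑ i, h (x i)) ^ 2 / √(n : ℝ) + √(n : ℝ)) / 2) := by
    intro I
    have e : avg (x ∘ I) h - avg x h = (n : ℝ)⁻¹ * (∑ k, h (x (I k)) - ∑ i, h (x i)) := by
      simp [avg, mul_sub]
    rw [e, norm_mul, norm_inv, RCLike.norm_natCast, Real.norm_eq_abs]
    gcongr
    set y := ∑ k, h (x (I k)) - ∑ i, h (x i)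
    rw [le_div_iff₀ two_pos, ← sub_nonneg]
    have : y ^ 2 / √(n : ℝ) + √(n : ℝ) - |y| * 2 = (|y| - √(n : ℝ)) ^ 2 / √(n : ℝ) := by
      field_simp
      rw [← sq_abs y]; ring
    rw [this]; positivity
  unfold bootDeviation
  calc _ ≤ ∫ I : Fin n → Fin n, (n : ℝ)⁻¹ *
        (((∑ k, h (x (I k)) - ∑ i, h (x i)) ^ 2 / √(n : ℝ) + √(n : ℝ)) / 2) ∂(bootMeasure n) :=
        integral_mono Integrable.of_finite Integrable.of_finite hpt
    _ = (n : ℝ)⁻¹ * (((∫ I : Fin n → Fin n, (∑ k, h (x (I k)) - ∑ i, h (x i)) ^ 2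
          ∂(bootMeasure n)) / √(n : ℝ) + √(n : ℝ)) / 2) := by
        rw [integral_const_mul, integral_div, integral_add Integrable.of_finite
          Integrable.of_finite, integral_div]
        simp
    _ ≤ (n : ℝ)⁻¹ * ((n / √(n : ℝ) + √(n : ℝ)) / 2) := by gcongr
    _ = (√(n : ℝ))⁻¹ := by
        generalize √(n : ℝ) = s at hs hss ⊢
        rw [← hss]; field_simp; norm_num

theorem bootDeviation_smul_const {n : ℕ} (x : Fin n → 𝒳) (h : 𝒳 → ℝ) (c : B) :
    bootDeviation x (fun y => h y • c) = bootDeviation x h * ‖c‖ := by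
  unfold bootDeviation
  rw [← integral_mul_const]
  congr 1
  ext I
  have : ∀ z : Fin n → 𝒳, avg z (fun y => h y • c) = avg z h • c := fun z => by
    simp [avg, smul_smul, Finset.sum_smul, Finset.smul_sum, Finset.mul_sum]
  rw [this, this, ← sub_smul, norm_smul]

variable {Ω : Type*} [MeasurableSpace Ω] [MeasurableSpace 𝒳] {P : Measure Ω}
  {F₀ : Measure 𝒳} {X : ℕ → Ω → 𝒳}

/-- Bootstrap law of large numbers for an integrable function with values in a Banach space. -/
theorem tendsto_bootDeviation_ae (hind : iIndepFun X P) (hlaw : ∀ i, HasLaw (X i) F₀ P)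
    {Φ : 𝒳 → B} (hΦ : Integrable Φ F₀) :
    ∀ᵐ ω ∂P, Tendsto (fun n => bootDeviation (sample X n ω) Φ) atTop (𝓝 0) := by
  have hinv : Tendsto (fun n : ℕ => (√(n : ℝ))⁻¹) atTop (𝓝 0) :=
    tendsto_inv_atTop_zero.comp (Real.tendsto_sqrt_atTop.comp tendsto_natCast_atTop_atTop)
  -- Indicators times a vector reduce to the scalar bound 1/√n, and sums are immediate. Closedness
  -- in L¹ follows from the stability bound and the law of large numbers for ‖Φ - Ψ‖. No geometry of
  -- the Banach space is used.
  refine Integrable.induction (P := fun Φ : 𝒳 → B =>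
    ∀ᵐ ω ∂P, Tendsto (fun n => bootDeviation (sample X n ω) Φ) atTop (𝓝 0)) ?_ ?_ ?_ ?_ hΦ
  · intro c s _ _
    refine Eventually.of_forall fun ω => ?_
    have e : s.indicator (fun _ => c) = fun y => s.indicator (fun _ => (1 : ℝ)) y • c := by
      ext y
      by_cases hy : y ∈ s <;> simp [hy]
    simp_rw [e, bootDeviation_smul_const]
    rw [← zero_mul ‖c‖]
    refine Tendsto.mul_const _ (squeeze_zero' (Eventually.of_forall fun n =>
      bootDeviation_nonneg _ _) ?_ hinv)
    filter_upwards [eventually_gt_atTop 0] with n hn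
    refine bootDeviation_le_inv_sqrt hn _ _ fun y => ?_
    by_cases hy : y ∈ s <;> simp [hy]
  · intro f g _ _ _ hf hg
    filter_upwards [hf, hg] with ω h1 h2
    refine squeeze_zero (fun n => bootDeviation_nonneg _ _)
      (fun n => bootDeviation_add_le _ _ _) ?_
    simpa using h1.add h2
  · refine IsSeqClosed.isClosed fun f g hf hfg => ?_
    have h1 : ∀ᵐ ω ∂P, ∀ k, Tendsto (fun n => bootDeviation (sample X n ω) (f k)) atTop (𝓝 0) :=
      ae_all_iff.2 hf
    have h2 : ∀ᵐ ω ∂P, ∀ k, Tendsto (fun n => avg (sample X n ω) fun y => ‖g y - f k y‖) atTop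
        (𝓝 (∫ x, ‖g x - f k x‖ ∂F₀)) :=
      ae_all_iff.2 fun k => tendsto_avg_sample_ae hind hlaw
        ((L1.integrable_coeFn g).sub (L1.integrable_coeFn (f k))).norm
    filter_upwards [h1, h2] with ω h1 h2
    rw [Metric.tendsto_nhds]
    intro ε hε
    obtain ⟨k, hk⟩ := ((Metric.tendsto_nhds.1 hfg) (ε / 4) (by positivity)).exists
    have hk' : ∫ x, ‖g x - f k x‖ ∂F₀ < ε / 4 := by
      rw [dist_comm, dist_eq_norm, L1.norm_eq_integral_norm] at hk
      refine lt_of_le_of_lt (le_of_eq (integral_congr_ae ?_)) hk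
      filter_upwards [Lp.coeFn_sub g (f k)] with x hx
      rw [hx]; rfl
    filter_upwards [(h1 k).eventually_lt_const (show (0 : ℝ) < ε / 4 by positivity),
      (h2 k).eventually_lt_const hk'] with n a b
    rw [dist_zero_right, Real.norm_eq_abs, abs_of_nonneg (bootDeviation_nonneg _ _)]
    linarith [bootDeviation_le (sample X n ω) g (f k)]
  · intro f g hfg _ hf
    filter_upwards [hf, ae_forall_sample hlaw hfg] with ω h1 h2
    refine h1.congr fun n => ?_
    have : ∀ i : Fin n, f (sample X n ω i) = g (sample X n ω i) := fun i => h2 i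
    simp [bootDeviation, avg, this]

end BootLLN

/-! ### The converse central limit theorem for the bootstrap

If the bootstrap distribution of a normalized centered sum converges to a centered Gaussian law, then
the variances of the underlying empirical distributions converge to the limiting variance. -/

section BootVariance

variable {n : ℕ}

/-- The normalized bootstrap sum `n^{-1/2} ∑ k, c (I k)`. -/
noncomputable def bootSum (c : Fin n → ℝ) (I : Fin n → Fin n) : ℝ :=
  (√(n : ℝ))⁻¹ * ∑ k, c (I k)

/-- The Fourier defect `n⁻¹ ∑ i j, (1 - cos (t (c i - c j) / √n))` of the symmetrized
empirical distribution. -/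
noncomputable def fourierDefect (c : Fin n → ℝ) (t : ℝ) : ℝ :=
  (n : ℝ)⁻¹ * ∑ i, ∑ j, (1 - Real.cos (t * ((c i - c j) / √(n : ℝ))))

theorem fourierDefect_nonneg (c : Fin n → ℝ) (t : ℝ) : 0 ≤ fourierDefect c t :=
  mul_nonneg (by positivity) (Finset.sum_nonneg fun i _ => Finset.sum_nonneg fun j _ => by
    linarith [Real.cos_le_one (t * ((c i - c j) / √(n : ℝ)))])

/-- Both sides equal |φ(t/√n)|², where φ is the characteristic function of the empirical law of c:
expand cos(a - b). -/
theorem one_sub_fourierDefect_div (hn : 0 < n) (c : Fin n → ℝ) (t : ℝ) :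
    1 - fourierDefect c t / n
      = ((n : ℝ)⁻¹ * ∑ i, Real.cos (t * (c i / √(n : ℝ)))) ^ 2
        + ((n : ℝ)⁻¹ * ∑ i, Real.sin (t * (c i / √(n : ℝ)))) ^ 2 := by
  have hn' : (n : ℝ) ≠ 0 := by exact_mod_cast hn.ne'
  have h : ∀ i j, Real.cos (t * ((c i - c j) / √(n : ℝ)))
      = Real.cos (t * (c i / √(n : ℝ))) * Real.cos (t * (c j / √(n : ℝ)))
        + Real.sin (t * (c i / √(n : ℝ))) * Real.sin (t * (c j / √(n : ℝ))) := fun i j => by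
    rw [sub_div, mul_sub, Real.cos_sub]
  simp only [fourierDefect, h, Finset.sum_sub_distrib, Finset.sum_add_distrib, mul_pow, sq
    (∑ i, _), Finset.sum_mul_sum]
  simp
  field_simp
  ring

/-- Independence of the draws makes the characteristic function of the bootstrap sum an n-th power;
then take squared moduli. The modulus discards the phase, so the defect can be read off from the
bootstrap law alone. -/
theorem sq_integral_cos_add_sq_integral_sin (hn : 0 < n) (c : Fin n → ℝ) (t : ℝ) :
    (∫ I, Real.cos (t * bootSum c I) ∂(bootMeasure n)) ^ 2
      + (∫ I, Real.sin (t * bootSum c I) ∂(bootMeasure n)) ^ 2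
      = (1 - fourierDefect c t / n) ^ n := by
  have hprob := isProbabilityMeasure_uniformOn_fin (⟨0, hn⟩ : Fin n)
  have hexp : ∫ I, Complex.exp ((t * bootSum c I : ℝ) * Complex.I) ∂(bootMeasure n)
      = ((n : ℂ)⁻¹ * ∑ i, Complex.exp ((t * (c i / √(n : ℝ)) : ℝ) * Complex.I)) ^ n := by
    have h1 : ∀ I : Fin n → Fin n, Complex.exp ((t * bootSum c I : ℝ) * Complex.I)
        = ∏ k, Complex.exp ((t * (c (I k) / √(n : ℝ)) : ℝ) * Complex.I) := fun I => by
      rw [← Complex.exp_sum, ← Finset.sum_mul, ← Complex.ofReal_sum]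
      congr 3
      rw [bootSum, Finset.mul_sum, Finset.mul_sum]
      exact Finset.sum_congr rfl fun k _ => by ring
    simp_rw [h1]
    have h2 := integral_fintype_prod_eq_pow (ι := Fin n) (μ := uniformOn (Set.univ : Set (Fin n)))
      (fun i : Fin n => Complex.exp ((t * (c i / √(n : ℝ)) : ℝ) * Complex.I))
    rw [integral_uniformOn_fin hn, Fintype.card_fin] at h2
    refine (show _ = _ from h2).trans ?_
    rw [Complex.real_smul]
    push_cast
    rfl
  have hre : (∫ I, Complex.exp ((t * bootSum c I : ℝ) * Complex.I) ∂(bootMeasure n)).re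
      = ∫ I, Real.cos (t * bootSum c I) ∂(bootMeasure n) := by
    have := integral_re (𝕜 := ℂ) (μ := bootMeasure n)
      (f := fun I => Complex.exp ((t * bootSum c I : ℝ) * Complex.I)) Integrable.of_finite
    refine Eq.trans this.symm (integral_congr_ae (Eventually.of_forall fun I => ?_))
    exact Complex.exp_ofReal_mul_I_re _
  have him : (∫ I, Complex.exp ((t * bootSum c I : ℝ) * Complex.I) ∂(bootMeasure n)).im
      = ∫ I, Real.sin (t * bootSum c I) ∂(bootMeasure n) := by
    have := integral_im (𝕜 := ℂ) (μ := bootMeasure n)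
      (f := fun I => Complex.exp ((t * bootSum c I : ℝ) * Complex.I)) Integrable.of_finite
    refine Eq.trans this.symm (integral_congr_ae (Eventually.of_forall fun I => ?_))
    exact Complex.exp_ofReal_mul_I_im _
  have h3 := congrArg Complex.normSq hexp
  rw [Complex.normSq_apply, hre, him, map_pow] at h3
  rw [sq, sq, h3, one_sub_fourierDefect_div hn]
  congr 1
  have e : (n : ℂ)⁻¹ * ∑ i, Complex.exp ((t * (c i / √(n : ℝ)) : ℝ) * Complex.I)
      = (((n : ℝ)⁻¹ * ∑ i, Real.cos (t * (c i / √(n : ℝ))) : ℝ) : ℂ)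
        + (((n : ℝ)⁻¹ * ∑ i, Real.sin (t * (c i / √(n : ℝ))) : ℝ) : ℂ) * Complex.I := by
    simp only [Complex.exp_mul_I, ← Complex.ofReal_cos, ← Complex.ofReal_sin]
    push_cast
    rw [Finset.sum_add_distrib, ← Finset.sum_mul]
    ring
  rw [e, Complex.normSq_add_mul_I]

/-- From 1 - 1/x ≤ log x ≤ x - 1 at x = 1 - w/n. For L = -n log x this gives w ≤ L and L(1 - w/n) ≤
w, so w and L have the same limit whenever L converges and n → ∞. -/
theorem fourierDefect_bounds (hn : 0 < n) (c : Fin n → ℝ) (t : ℝ)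
    (hpos : 0 < (1 - fourierDefect c t / n) ^ n) :
    fourierDefect c t ≤ -Real.log ((1 - fourierDefect c t / n) ^ n) ∧
    -Real.log ((1 - fourierDefect c t / n) ^ n)
      - (-Real.log ((1 - fourierDefect c t / n) ^ n)) ^ 2 / n ≤ fourierDefect c t := by
  have hn' : (0 : ℝ) < n := by exact_mod_cast hn
  set w := fourierDefect c t
  have hw : 0 ≤ w := fourierDefect_nonneg c t
  have hx0 : 0 ≤ 1 - w / n := by
    rw [one_sub_fourierDefect_div hn]; positivity
  have hx : 0 < 1 - w / n := by
    refine lt_of_le_of_ne hx0 fun h => ?_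
    rw [← h, zero_pow hn.ne'] at hpos
    exact lt_irrefl _ hpos
  rw [Real.log_pow]
  have l1 : Real.log (1 - w / n) ≤ - (w / n) := by
    have := Real.log_le_sub_one_of_pos hx
    linarith
  have l2 : 1 - (1 - w / n)⁻¹ ≤ Real.log (1 - w / n) := Real.one_sub_inv_le_log_of_pos hx
  set L := -((n : ℝ) * Real.log (1 - w / n)) with hL
  have hwL : w ≤ L := by
    have : (n : ℝ) * Real.log (1 - w / n) ≤ n * (-(w / n)) := by gcongr
    have e : (n : ℝ) * (-(w / n)) = -w := by field_simp
    linarith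
  refine ⟨hwL, ?_⟩
  have h3 : L * (1 - w / n) ≤ w := by
    have : (n : ℝ) * (1 - (1 - w / n)⁻¹) ≤ n * Real.log (1 - w / n) := by gcongr
    have h4 : L ≤ n * ((1 - w / n)⁻¹ - 1) := by linarith
    calc L * (1 - w / n) ≤ n * ((1 - w / n)⁻¹ - 1) * (1 - w / n) := by gcongr
      _ = n * (1 - (1 - w / n)) := by rw [mul_assoc, sub_mul, inv_mul_cancel₀ hx.ne', one_mul]
      _ = w := by field_simp; ring
  have h5 : L * (w / n) ≤ L ^ 2 / n := by
    rw [sq, mul_div_assoc]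
    have : 0 ≤ L := hw.trans hwL
    gcongr
  linarith

theorem integral_one_sub_cos (δ b : ℝ) (hb : b ≠ 0) :
    ∫ t in (0 : ℝ)..δ, (1 - Real.cos (t * b)) = δ - Real.sin (δ * b) / b := by
  rw [intervalIntegral.integral_sub (by simp) (by
    exact (Continuous.intervalIntegrable (by fun_prop) _ _)),
    intervalIntegral.integral_comp_mul_right (fun x => Real.cos x) hb]
  simp
  ring

/-- Tightness of the normalized bootstrap sum bounds all increments `(c i - c j) / √n`. -/
theorem abs_increment_le_of_tight (hn : 0 < n) (c : Fin n → ℝ) {δ : ℝ} (hδ : 0 < δ)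
    (h : ∫ I, min 2 (δ ^ 2 * bootSum c I ^ 2 / 2) ∂(bootMeasure n) ≤ 1 / 8) (i₀ j₀ : Fin n) :
    |(c i₀ - c j₀) / √(n : ℝ)| ≤ 8 / δ := by
  have hn' : (0 : ℝ) < n := by exact_mod_cast hn
  -- The mean cosine is at least 7/8, so the n-th power is at least 49/64, and -log y ≤ 1/y - 1
  -- gives 64/49 - 1 = 15/49.
  have hw : ∀ t ∈ Set.Icc 0 δ, fourierDefect c t ≤ 15 / 49 := by
    intro t ht
    have hcos : 7 / 8 ≤ ∫ I, Real.cos (t * bootSum c I) ∂(bootMeasure n) := by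
      have h1 : ∀ I, 1 - min 2 (δ ^ 2 * bootSum c I ^ 2 / 2) ≤ Real.cos (t * bootSum c I) := by
        intro I
        rw [sub_le_comm]
        refine le_min (by linarith [Real.neg_one_le_cos (t * bootSum c I)]) ?_
        have h2 := Real.one_sub_sq_div_two_le_cos (x := t * bootSum c I)
        have h3 : (t * bootSum c I) ^ 2 ≤ δ ^ 2 * bootSum c I ^ 2 := by
          rw [mul_pow]
          have := ht.1
          have := ht.2
          gcongr
        linarith
      have h2 := integral_mono (μ := bootMeasure n) (Integrable.of_finite) (Integrable.of_finite) h1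
      rw [integral_sub Integrable.of_finite Integrable.of_finite] at h2
      simp only [integral_const, probReal_univ, smul_eq_mul, mul_one] at h2
      linarith
    have hK : 49 / 64 ≤ (1 - fourierDefect c t / n) ^ n := by
      rw [← sq_integral_cos_add_sq_integral_sin hn]
      nlinarith [sq_nonneg (∫ I, Real.sin (t * bootSum c I) ∂(bootMeasure n))]
    have h4 := (fourierDefect_bounds hn c t (by linarith)).1
    have h5 := Real.one_sub_inv_le_log_of_pos
      (show 0 < (1 - fourierDefect c t / n) ^ n by linarith)
    have h6 : ((1 - fourierDefect c t / n) ^ n)⁻¹ ≤ 64 / 49 := by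
      rw [inv_le_comm₀ (by linarith) (by norm_num)]
      linarith
    linarith
  set b : Fin n → Fin n → ℝ := fun i j => (c i - c j) / √(n : ℝ) with hb
  set g : Fin n → Fin n → ℝ := fun i j => ∫ t in (0 : ℝ)..δ, (1 - Real.cos (t * b i j)) with hg
  have hg0 : ∀ i j, 0 ≤ g i j := fun i j => intervalIntegral.integral_nonneg hδ.le fun t _ => by
    linarith [Real.cos_le_one (t * b i j)]
  have hint : ∀ i j, IntervalIntegrable (fun t => 1 - Real.cos (t * b i j)) volume 0 δ :=
    fun i j => Continuous.intervalIntegrable (by fun_prop) _ _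
  have hsum : (n : ℝ)⁻¹ * ∑ i, ∑ j, g i j ≤ δ * (15 / 49) := by
    have h1 : ∫ t in (0 : ℝ)..δ, fourierDefect c t = (n : ℝ)⁻¹ * ∑ i, ∑ j, g i j := by
      unfold fourierDefect
      rw [intervalIntegral.integral_const_mul,
        intervalIntegral.integral_finsetSum fun i _ => ?_]
      · congr 1
        refine Finset.sum_congr rfl fun i _ => ?_
        rw [intervalIntegral.integral_finsetSum fun j _ => hint i j]
      · exact Continuous.intervalIntegrable (by fun_prop) _ _
    rw [← h1]
    have h2 : ∫ t in (0 : ℝ)..δ, fourierDefect c t ≤ ∫ _t in (0 : ℝ)..δ, (15 / 49 : ℝ) := by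
      refine intervalIntegral.integral_mono_on hδ.le ?_ (by simp) hw
      unfold fourierDefect
      exact Continuous.intervalIntegrable (by fun_prop) _ _
    refine h2.trans (le_of_eq (by simp; ring))
  by_contra! hcon
  -- Averaging over t in [0, δ] turns a large increment into a definite contribution, because the
  -- oscillating term integrates to at most δ/4.
  have hlow : ∀ i j, 4 / δ ≤ |b i j| → 3 / 4 * δ ≤ g i j := by
    intro i j hij
    have hbpos : 0 < |b i j| := lt_of_lt_of_le (by positivity) hij
    have hb0 : b i j ≠ 0 := abs_pos.1 hbpos
    change 3 / 4 * δ ≤ ∫ t in (0 : ℝ)..δ, (1 - Real.cos (t * b i j))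
    rw [integral_one_sub_cos _ _ hb0]
    have h1 : Real.sin (δ * b i j) / b i j ≤ δ / 4 := by
      refine (le_abs_self _).trans ?_
      rw [abs_div]
      calc |Real.sin (δ * b i j)| / |b i j| ≤ 1 / |b i j| := by
            gcongr; exact Real.abs_sin_le_one _
        _ ≤ 1 / (4 / δ) := by gcongr
        _ = δ / 4 := by field_simp
    linarith
  -- A single large increment is amplified to n large ones: through any k, one of the two legs has
  -- at least half the length. Summing over k yields 3nδ/4, whereas one row plus one column of g is
  -- at most 30nδ/49.
  have hpair : ∀ k, 3 / 4 * δ ≤ g i₀ k + g k j₀ := by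
    intro k
    have hadd : b i₀ j₀ = b i₀ k + b k j₀ := by simp only [hb]; ring
    have h8 : 8 / δ = 4 / δ + 4 / δ := by ring
    have : 4 / δ ≤ |b i₀ k| ∨ 4 / δ ≤ |b k j₀| := by
      by_contra! hh
      have h9 : |b i₀ j₀| ≤ |b i₀ k| + |b k j₀| := by rw [hadd]; exact abs_add_le _ _
      change 8 / δ < |b i₀ j₀| at hcon
      linarith [hh.1, hh.2]
    rcases this with h | h
    · linarith [hlow _ _ h, hg0 k j₀]
    · linarith [hlow _ _ h, hg0 i₀ k]
  have hA : ∑ k, g i₀ k ≤ ∑ i, ∑ j, g i j :=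
    Finset.single_le_sum (f := fun i => ∑ j, g i j)
      (fun i _ => Finset.sum_nonneg fun j _ => hg0 i j) (Finset.mem_univ i₀)
  have hB : ∑ k, g k j₀ ≤ ∑ i, ∑ j, g i j :=
    Finset.sum_le_sum fun i _ => Finset.single_le_sum (f := fun j => g i j)
      (fun j _ => hg0 i j) (Finset.mem_univ j₀)
  have hC : (n : ℝ) * (3 / 4 * δ) ≤ ∑ k, (g i₀ k + g k j₀) := by
    have := Finset.sum_le_sum fun k (_ : k ∈ (Finset.univ : Finset (Fin n))) => hpair k
    simpa using this
  rw [Finset.sum_add_distrib] at hC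
  rw [inv_mul_le_iff₀ hn'] at hsum
  nlinarith [mul_pos hn' hδ]

/-- The Taylor error is at most 5x⁴/96, while 1 - cos x ≥ 43x²/96. The right-hand side is chosen
because it equals 4(1 - cos x) - (1 - cos 2x), a combination of Fourier defects at t and 2t. -/
theorem abs_one_sub_cos_sub_sq_le {x : ℝ} (hx : |x| ≤ 1) :
    |(1 - Real.cos x) - x ^ 2 / 2| ≤ 2 * (1 - Real.cos x) ^ 2 := by
  have h1 := Real.cos_bound hx
  have hx2 : x ^ 2 ≤ 1 := by rw [← sq_abs]; exact pow_le_one₀ (abs_nonneg _) hx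
  have h4 : |x| ^ 4 = (x ^ 2) ^ 2 := by rw [← sq_abs x]; ring
  rw [h4] at h1
  rw [abs_le] at h1
  have h5 : (x ^ 2) ^ 2 ≤ x ^ 2 := by nlinarith [sq_nonneg x]
  have h6 : 43 / 96 * x ^ 2 ≤ 1 - Real.cos x := by linarith [h1.2]
  have h7 : (43 / 96 * x ^ 2) ^ 2 ≤ (1 - Real.cos x) ^ 2 := by gcongr
  rw [abs_le]
  constructor <;> nlinarith [h1.1, h1.2, sq_nonneg (x ^ 2)]

/-- Centering makes the double sum of (c i - c j)² equal to 2n ∑ c i², so the quadratic part of the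
defect is t² times the empirical variance. The error is controlled termwise by the cosine inequality
above. -/
theorem abs_fourierDefect_sub_variance_le (hn : 0 < n) (c : Fin n → ℝ) (hc : ∑ i, c i = 0)
    {t : ℝ} (h : ∀ i j, |t * ((c i - c j) / √(n : ℝ))| ≤ 1) :
    |fourierDefect c t - t ^ 2 * ((n : ℝ)⁻¹ * ∑ i, c i ^ 2)|
      ≤ 4 * fourierDefect c t - fourierDefect c (2 * t) := by
  have hn' : (0 : ℝ) < n := by exact_mod_cast hn
  have hss : √(n : ℝ) ^ 2 = n := Real.sq_sqrt hn'.le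
  have e1 : t ^ 2 * ((n : ℝ)⁻¹ * ∑ i, c i ^ 2)
      = (n : ℝ)⁻¹ * ∑ i, ∑ j, (t * ((c i - c j) / √(n : ℝ))) ^ 2 / 2 := by
    have : ∀ i j, (t * ((c i - c j) / √(n : ℝ))) ^ 2 / 2
        = t ^ 2 / (2 * n) * (c i ^ 2 + c j ^ 2 - 2 * (c i * c j)) := fun i j => by
      rw [mul_pow, div_pow, hss]; field_simp; ring
    have h2 : ∑ i, ∑ j, (c i ^ 2 + c j ^ 2 - 2 * (c i * c j)) = 2 * n * ∑ i, c i ^ 2 := by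
      have h3 : ∀ i, ∑ j, (c i ^ 2 + c j ^ 2 - 2 * (c i * c j))
          = n * c i ^ 2 + ∑ j, c j ^ 2 := fun i => by
        rw [Finset.sum_sub_distrib, Finset.sum_add_distrib, ← Finset.mul_sum, ← Finset.mul_sum, hc]
        simp
      simp_rw [h3, Finset.sum_add_distrib, ← Finset.mul_sum]
      simp
      ring
    simp_rw [this]
    simp_rw [← Finset.mul_sum]
    rw [h2]
    field_simp
  have e2 : 4 * fourierDefect c t - fourierDefect c (2 * t)
      = (n : ℝ)⁻¹ * ∑ i, ∑ j, 2 * (1 - Real.cos (t * ((c i - c j) / √(n : ℝ)))) ^ 2 := by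
    unfold fourierDefect
    rw [← mul_assoc, mul_comm 4, mul_assoc, ← mul_sub, Finset.mul_sum, ← Finset.sum_sub_distrib]
    congr 1
    refine Finset.sum_congr rfl fun i _ => ?_
    rw [Finset.mul_sum, ← Finset.sum_sub_distrib]
    refine Finset.sum_congr rfl fun j _ => ?_
    rw [mul_assoc 2 t, Real.cos_two_mul]
    ring
  rw [e1, e2, fourierDefect, ← mul_sub, abs_mul, abs_of_pos (inv_pos.2 hn')]
  gcongr
  rw [← Finset.sum_sub_distrib]
  refine (Finset.abs_sum_le_sum_abs _ _).trans (Finset.sum_le_sum fun i _ => ?_)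
  rw [← Finset.sum_sub_distrib]
  exact (Finset.abs_sum_le_sum_abs _ _).trans
    (Finset.sum_le_sum fun j _ => abs_one_sub_cos_sub_sq_le (h i j))

theorem tendsto_fourierDefect {N : ℕ → ℕ} (hN : Tendsto N atTop atTop)
    {c : ∀ j, Fin (N j) → ℝ} {t τ : ℝ}
    (hcos : Tendsto (fun j => ∫ I, Real.cos (t * bootSum (c j) I) ∂(bootMeasure (N j))) atTop
      (𝓝 (Real.exp (-τ / 2))))
    (hsin : Tendsto (fun j => ∫ I, Real.sin (t * bootSum (c j) I) ∂(bootMeasure (N j))) atTop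
      (𝓝 0)) :
    Tendsto (fun j => fourierDefect (c j) t) atTop (𝓝 τ) := by
  have hNpos : ∀ᶠ j in atTop, 0 < N j := hN.eventually_gt_atTop 0
  have hK : Tendsto (fun j => (1 - fourierDefect (c j) t / (N j : ℝ)) ^ N j) atTop
      (𝓝 (Real.exp (-τ))) := by
    have h1 := (hcos.pow 2).add (hsin.pow 2)
    have e : Real.exp (-τ / 2) ^ 2 + (0 : ℝ) ^ 2 = Real.exp (-τ) := by
      rw [sq, ← Real.exp_add]; simp
    rw [e] at h1
    refine h1.congr' ?_
    filter_upwards [hNpos] with j hj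
    exact sq_integral_cos_add_sq_integral_sin hj _ _
  have hL : Tendsto (fun j => -Real.log ((1 - fourierDefect (c j) t / (N j : ℝ)) ^ N j)) atTop
      (𝓝 τ) := by
    have := (hK.log (Real.exp_pos _).ne').neg
    simpa using this
  have hpos : ∀ᶠ j in atTop, 0 < (1 - fourierDefect (c j) t / (N j : ℝ)) ^ N j :=
    hK.eventually_const_lt (Real.exp_pos _)
  have hlow : Tendsto (fun j => -Real.log ((1 - fourierDefect (c j) t / (N j : ℝ)) ^ N j)
      - (-Real.log ((1 - fourierDefect (c j) t / (N j : ℝ)) ^ N j)) ^ 2 / (N j : ℝ)) atTop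
      (𝓝 τ) := by
    have := hL.sub ((hL.pow 2).div_atTop (tendsto_natCast_atTop_atTop.comp hN))
    simpa using this
  refine tendsto_of_tendsto_of_tendsto_of_le_of_le' hlow hL ?_ ?_
  · filter_upwards [hNpos, hpos] with j h1 h2
    exact (fourierDefect_bounds h1 _ _ h2).2
  · filter_upwards [hNpos, hpos] with j h1 h2
    exact (fourierDefect_bounds h1 _ _ h2).1

/-- The converse central limit theorem for centered bootstrap sums. -/
theorem tendsto_variance_of_boot_clt {N : ℕ → ℕ} (hN : Tendsto N atTop atTop)
    {c : ∀ j, Fin (N j) → ℝ} (hc : ∀ j, ∑ i, c j i = 0) {v : ℝ}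
    (hcos : ∀ k : ℕ, 0 < k → Tendsto
      (fun j => ∫ I, Real.cos ((k : ℝ)⁻¹ * bootSum (c j) I) ∂(bootMeasure (N j))) atTop
      (𝓝 (Real.exp (-((k : ℝ)⁻¹ ^ 2 * v) / 2))))
    (hsin : ∀ k : ℕ, 0 < k → Tendsto
      (fun j => ∫ I, Real.sin ((k : ℝ)⁻¹ * bootSum (c j) I) ∂(bootMeasure (N j))) atTop (𝓝 0))
    {L : ℕ → ℝ} (hL : ∀ k, L k ≤ (k : ℝ)⁻¹ ^ 2 * v / 2)
    (hmin : ∀ k : ℕ, 0 < k → Tendsto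
      (fun j => ∫ I, min 2 ((k : ℝ)⁻¹ ^ 2 * bootSum (c j) I ^ 2 / 2) ∂(bootMeasure (N j))) atTop
      (𝓝 (L k))) :
    Tendsto (fun j => (N j : ℝ)⁻¹ * ∑ i, c j i ^ 2) atTop (𝓝 v) := by
  -- The increment bound is applied with δ = 1/k, which gives increments at most 8k. Taking t =
  -- 1/(8k) keeps all arguments in [-1, 1], and 2t = 1/(4k) is again the reciprocal of a positive
  -- integer.
  obtain ⟨k, hk, hk8⟩ : ∃ k : ℕ, 0 < k ∧ (k : ℝ)⁻¹ ^ 2 * v / 2 < 1 / 8 := by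
    have h0 : Tendsto (fun k : ℕ => (k : ℝ)⁻¹ ^ 2 * v / 2) atTop (𝓝 0) := by
      have : Tendsto (fun k : ℕ => (k : ℝ)⁻¹) atTop (𝓝 0) :=
        tendsto_inv_atTop_zero.comp tendsto_natCast_atTop_atTop
      simpa using ((this.pow 2).mul_const v).div_const 2
    exact ((eventually_gt_atTop 0).and (h0.eventually_lt_const (by norm_num))).exists
  have hk' : (0 : ℝ) < k := by exact_mod_cast hk
  have h1 := tendsto_fourierDefect hN (hcos (8 * k) (by positivity)) (hsin (8 * k) (by positivity))
  have h2 := tendsto_fourierDefect hN (hcos (4 * k) (by positivity)) (hsin (4 * k) (by positivity))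
  set t : ℝ := ((8 * k : ℕ) : ℝ)⁻¹ with ht
  have htpos : 0 < t := by rw [ht]; positivity
  have h2t : ((4 * k : ℕ) : ℝ)⁻¹ = 2 * t := by rw [ht]; push_cast; field_simp; norm_num
  rw [h2t] at h2
  have hbound : ∀ᶠ j in atTop, |fourierDefect (c j) t
      - t ^ 2 * ((N j : ℝ)⁻¹ * ∑ i, c j i ^ 2)|
      ≤ 4 * fourierDefect (c j) t - fourierDefect (c j) (2 * t) := by
    filter_upwards [hN.eventually_gt_atTop 0,
      (hmin k hk).eventually_lt_const ((hL k).trans_lt hk8)] with j hj hm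
    refine abs_fourierDefect_sub_variance_le hj _ (hc j) fun i i' => ?_
    have := abs_increment_le_of_tight hj (c j) (inv_pos.2 hk') hm.le i i'
    rw [abs_mul, abs_of_pos htpos]
    calc t * |(c j i - c j i') / √(N j : ℝ)| ≤ t * (8 / (k : ℝ)⁻¹) := by gcongr
      _ = 1 := by rw [ht]; push_cast; field_simp
  have hdiff : Tendsto (fun j => fourierDefect (c j) t
      - t ^ 2 * ((N j : ℝ)⁻¹ * ∑ i, c j i ^ 2)) atTop (𝓝 0) := by
    -- The limiting defect t²v is exactly quadratic in t, so this combination vanishes in the limit.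
    -- This is where Gaussianity of the limit enters.
    have h3 : Tendsto (fun j => 4 * fourierDefect (c j) t - fourierDefect (c j) (2 * t)) atTop
        (𝓝 0) := by
      have := (h1.const_mul 4).sub h2
      have e : 4 * (t ^ 2 * v) - (2 * t) ^ 2 * v = 0 := by ring
      rwa [e] at this
    exact squeeze_zero_norm' hbound h3
  have h4 := ((h1.sub hdiff).const_mul ((t ^ 2)⁻¹))
  have e : (t ^ 2)⁻¹ * (t ^ 2 * v - 0) = v := by field_simp; ring
  rw [e] at h4
  refine h4.congr fun j => ?_
  field_simp
  ring

end BootVariance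

/-! ### Random continuous functions on a compact set -/

/-- An open set is a countable union of balls with rational radii about a dense sequence. For
continuous functions on a compact set this reduces Borel measurability to that of sup-distances. -/
theorem measurable_of_measurable_dist {α Z : Type*} [MeasurableSpace α] [PseudoMetricSpace Z]
    [TopologicalSpace.SeparableSpace Z] [MeasurableSpace Z] [BorelSpace Z] {g : α → Z}
    (h : ∀ c, Measurable fun x => dist (g x) c) : Measurable g := by
  obtain ⟨D, hDc, hD⟩ := TopologicalSpace.exists_countable_dense Z
  refine measurable_of_isOpen fun U hU => ?_
  have : g ⁻¹' U = ⋃ d ∈ D, ⋃ q : ℚ, ⋃ _ : Metric.ball d (q : ℝ) ⊆ U,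
      {x | dist (g x) d < (q : ℝ)} := by
    ext x
    simp only [Set.mem_preimage, Set.mem_iUnion, Set.mem_ofPred_eq, exists_prop]
    constructor
    · intro hx
      obtain ⟨r, hr, hrU⟩ := Metric.isOpen_iff.1 hU _ hx
      obtain ⟨q, hq0, hqr⟩ := exists_rat_btwn (half_pos hr)
      obtain ⟨d, hdD, hd⟩ := hD.exists_dist_lt (g x) hq0
      refine ⟨d, hdD, q, fun z hz => hrU ?_, hd⟩
      rw [Metric.mem_ball] at hz ⊢
      rw [dist_comm] at hd
      linarith [dist_triangle z d (g x)]
    · rintro ⟨d, _, q, hq, hx⟩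
      exact hq hx
  rw [this]
  exact MeasurableSet.biUnion hDc fun d _ => MeasurableSet.iUnion fun q =>
    MeasurableSet.iUnion fun _ => measurableSet_lt (h d) measurable_const

/-- The random continuous function `x ↦ (φ x restricted to s)`, with value `0` where `φ x` is not
continuous on `s`. -/
noncomputable def restrictMap {𝒳 Y F : Type*} [TopologicalSpace Y] [NormedAddCommGroup F]
    (s : Set Y) (φ : 𝒳 → Y → F) (x : 𝒳) : C(s, F) :=
  ContinuousMap.mkD (s.domRestrict (φ x)) 0

theorem restrictMap_apply {𝒳 Y F : Type*} [TopologicalSpace Y] [NormedAddCommGroup F]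
    {s : Set Y} {φ : 𝒳 → Y → F} {x : 𝒳} (h : ContinuousOn (φ x) s) (t : s) :
    restrictMap s φ x t = φ x t :=
  ContinuousMap.mkD_apply_of_continuousOn h

section RandomContinuousMap

variable {𝒳 Y F : Type*} [MeasurableSpace 𝒳] {μ : Measure 𝒳} [MetricSpace Y]
  [NormedAddCommGroup F] [SecondCountableTopology F] [MeasurableSpace F] [BorelSpace F]
  {s : Set Y} [CompactSpace s] {φ : 𝒳 → Y → F}

/-- The sup-distance to a fixed function is determined on a countable dense set. A single null set N
then covers the failures of continuity and all discrepancies with the measurable versions at the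
dense points. -/
theorem aestronglyMeasurable_restrictMap (hcont : ∀ᵐ x ∂μ, ContinuousOn (φ x) s)
    (hmeas : ∀ t ∈ s, AEMeasurable (fun x => φ x t) μ) :
    AEStronglyMeasurable (restrictMap s φ) μ := by
  borelize C(s, F)
  obtain ⟨D, hDc, hD⟩ := TopologicalSpace.exists_countable_dense s
  have : Countable D := hDc.to_subtype
  have hae : ∀ᵐ x ∂μ, ContinuousOn (φ x) s ∧ ∀ d : D,
      φ x (d : s) = (hmeas (d : s) (d : s).2).mk (fun x => φ x (d : s)) x :=
    hcont.and (ae_all_iff.2 fun d => (hmeas (d : s) (d : s).2).ae_eq_mk)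
  obtain ⟨N, hNsub, hNm, hN0⟩ := exists_measurable_superset_of_null (ae_iff.1 hae)
  have hgood : ∀ x ∉ N, ContinuousOn (φ x) s ∧ ∀ d : D,
      φ x (d : s) = (hmeas (d : s) (d : s).2).mk (fun x => φ x (d : s)) x := fun x hx => by
    by_contra hcon
    exact hx (hNsub hcon)
  classical
  set G : 𝒳 → C(s, F) := restrictMap s φ with hG
  set G' : 𝒳 → C(s, F) := fun x => if x ∈ N then 0 else G x with hG'
  have hG'm : Measurable G' := by
    refine measurable_of_measurable_dist fun c => ?_
    refine measurable_of_Iic fun r => ?_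
    rcases lt_or_ge r 0 with hr | hr
    · convert! MeasurableSet.empty
      ext x
      simp only [Set.mem_preimage, Set.mem_Iic, Set.mem_empty_iff_false, iff_false, not_le]
      exact hr.trans_le dist_nonneg
    have hdense : ∀ f : C(s, F), dist f c ≤ r ↔ ∀ d : D, dist (f (d : s)) (c (d : s)) ≤ r := by
      intro f
      rw [ContinuousMap.dist_le hr]
      refine ⟨fun h d => h d, fun h t => ?_⟩
      have hcl : IsClosed {t : s | dist (f t) (c t) ≤ r} :=
        isClosed_le (f.continuous.dist c.continuous) continuous_const
      exact hcl.closure_subset_iff.2 (fun d hd => h ⟨d, hd⟩) (hD t)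
    have e : (fun x => dist (G' x) c) ⁻¹' Set.Iic r = ⋂ d : D, {x | dist (if x ∈ N then 0 else
        (hmeas (d : s) (d : s).2).mk (fun x => φ x (d : s)) x) (c (d : s)) ≤ r} := by
      ext x
      simp only [Set.mem_preimage, Set.mem_Iic, Set.mem_iInter, Set.mem_ofPred_eq, hdense]
      refine forall_congr' fun d => ?_
      by_cases hx : x ∈ N
      · simp [hG', hx]
      · simp only [hG', hx, if_false, hG]
        rw [restrictMap_apply (hgood x hx).1, (hgood x hx).2 d]
    rw [e]
    refine MeasurableSet.iInter fun d => measurableSet_le ?_ measurable_const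
    exact (Measurable.ite hNm measurable_const (AEMeasurable.measurable_mk _)).dist
      measurable_const
  refine ⟨G', hG'm.stronglyMeasurable, ?_⟩
  have hNae : ∀ᵐ x ∂μ, x ∉ N := by rw [ae_iff]; simpa using hN0
  filter_upwards [hNae] with x hx
  simp [hG', hx]

theorem integrable_restrictMap_of_bound (hcont : ∀ᵐ x ∂μ, ContinuousOn (φ x) s)
    (hmeas : ∀ t ∈ s, AEMeasurable (fun x => φ x t) μ) {b : 𝒳 → ℝ} (hb : Integrable b μ)
    (hle : ∀ᵐ x ∂μ, ∀ t ∈ s, ‖φ x t‖ ≤ b x) :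
    Integrable (restrictMap s φ) μ :=
  ⟨aestronglyMeasurable_restrictMap hcont hmeas,
    ContinuousMap.hasFiniteIntegral_mkD_restrict_of_bound _ _ hcont b hb.2 hle⟩

theorem integrable_restrictMap_of_lintegral (hcont : ∀ᵐ x ∂μ, ContinuousOn (φ x) s)
    (hmeas : ∀ t ∈ s, AEMeasurable (fun x => φ x t) μ)
    (hfin : ∫⁻ x, ⨆ t ∈ s, ‖φ x t‖ₑ ∂μ < ∞) :
    Integrable (restrictMap s φ) μ := by
  refine ⟨aestronglyMeasurable_restrictMap hcont hmeas, ?_⟩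
  refine lt_of_le_of_lt (lintegral_mono_ae ?_) hfin
  filter_upwards [hcont] with x hx
  by_cases htop : (⨆ t ∈ s, ‖φ x t‖ₑ) = ∞
  · rw [htop]; exact le_top
  rw [← ofReal_norm]
  refine ENNReal.ofReal_le_of_le_toReal ?_
  rw [ContinuousMap.norm_le _ ENNReal.toReal_nonneg]
  intro t
  rw [restrictMap_apply hx, ← toReal_enorm]
  exact ENNReal.toReal_mono htop (le_iSup₂ (f := fun t (_ : t ∈ s) => ‖φ x t‖ₑ) (t : Y) t.2)

end RandomContinuousMap

/-- A limit of difference quotients. Measurability is asked only near t because the Jacobian is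
known to be measurable only on the parameter space. -/
theorem aemeasurable_fderiv_apply {𝒳 E F : Type*} [MeasurableSpace 𝒳] {μ : Measure 𝒳}
    [NormedAddCommGroup E] [NormedSpace ℝ E] [NormedAddCommGroup F] [NormedSpace ℝ F]
    [SecondCountableTopology F] [MeasurableSpace F] [BorelSpace F] {φ : 𝒳 → E → F} {t v : E}
    (hdiff : ∀ᵐ x ∂μ, DifferentiableAt ℝ (φ x) t)
    (hmeas : ∀ᶠ s in 𝓝 t, AEMeasurable (fun x => φ x s) μ) :
    AEMeasurable (fun x => fderiv ℝ (φ x) t v) μ := by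
  have hlim : Tendsto (fun n : ℕ => t + (n : ℝ)⁻¹ • v) atTop (𝓝 t) := by
    have h0 : Tendsto (fun n : ℕ => (n : ℝ)⁻¹) atTop (𝓝 0) :=
      tendsto_inv_atTop_zero.comp tendsto_natCast_atTop_atTop
    simpa using (h0.smul_const v).const_add t
  obtain ⟨N, hN⟩ := eventually_atTop.1 (hlim.eventually hmeas)
  refine aemeasurable_of_tendsto_metrizable_ae atTop
    (f := fun (n : ℕ) x => ((n + N : ℕ) : ℝ) • (φ x (t + ((n + N : ℕ) : ℝ)⁻¹ • v) - φ x t)) ?_ ?_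
  · intro n
    have h1 := hN (n + N) (Nat.le_add_left _ _)
    exact (h1.sub hmeas.self_of_nhds).const_smul _
  · filter_upwards [hdiff] with x hx
    exact (hx.hasFDerivAt.lim_real v).comp
      (tendsto_natCast_atTop_atTop.comp (tendsto_add_atTop_nat N))

theorem sum_smul_single_one {ι : Type*} [Fintype ι] [DecidableEq ι] (v : EuclideanSpace ℝ ι) :
    ∑ k, v k • EuclideanSpace.single k (1 : ℝ) = v := by
  ext i
  simp [Pi.single_apply]

theorem aemeasurable_fderiv {𝒳 ι F : Type*} [MeasurableSpace 𝒳] {μ : Measure 𝒳} [Fintype ι]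
    [DecidableEq ι] [NormedAddCommGroup F] [NormedSpace ℝ F] [FiniteDimensional ℝ F]
    [MeasurableSpace F] [BorelSpace F]
    [MeasurableSpace (EuclideanSpace ℝ ι →L[ℝ] F)] [BorelSpace (EuclideanSpace ℝ ι →L[ℝ] F)]
    {φ : 𝒳 → EuclideanSpace ℝ ι → F} {t : EuclideanSpace ℝ ι}
    (hdiff : ∀ᵐ x ∂μ, DifferentiableAt ℝ (φ x) t)
    (hmeas : ∀ᶠ s in 𝓝 t, AEMeasurable (fun x => φ x s) μ) :
    AEMeasurable (fun x => fderiv ℝ (φ x) t) μ := by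
  have : ProperSpace F := FiniteDimensional.proper_real F
  have e : ∀ L : EuclideanSpace ℝ ι →L[ℝ] F, L = ∑ k,
      (EuclideanSpace.proj k : EuclideanSpace ℝ ι →L[ℝ] ℝ).smulRight
        (L (EuclideanSpace.single k 1)) := fun L => by
    ext v
    conv_lhs => rw [← sum_smul_single_one v]
    simp
  have h : (fun x => fderiv ℝ (φ x) t) = fun x => ∑ k,
      (EuclideanSpace.proj k : EuclideanSpace ℝ ι →L[ℝ] ℝ).smulRight
        (fderiv ℝ (φ x) t (EuclideanSpace.single k 1)) := funext fun x => e _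
  rw [h]
  refine Finset.aemeasurable_fun_sum _ fun k _ => ?_
  have hc : Continuous fun w : F =>
      (EuclideanSpace.proj k : EuclideanSpace ℝ ι →L[ℝ] ℝ).smulRight w :=
    (ContinuousLinearMap.smulRightL ℝ (EuclideanSpace ℝ ι) F
      (EuclideanSpace.proj k : EuclideanSpace ℝ ι →L[ℝ] ℝ)).continuous
  exact hc.measurable.comp_aemeasurable (aemeasurable_fderiv_apply hdiff hmeas)

/-! ### Jacobians and augmented moments -/

section Moments

variable {𝒳 : Type*} {m p : ℕ} {g : 𝒳 → EuclideanSpace ℝ (Fin p) → EuclideanSpace ℝ (Fin m)}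

theorem matrixCLM_jacobian {ι κ : Type*} [Fintype ι] [DecidableEq ι] [Fintype κ]
    (f : EuclideanSpace ℝ ι → EuclideanSpace ℝ κ) (t : EuclideanSpace ℝ ι) :
    matrixCLM (jacobian f t) = fderiv ℝ f t := by
  ext v a
  conv_rhs => rw [← sum_smul_single_one v]
  simp [ofLp_matrixCLM, Matrix.mulVec, dotProduct, jacobian, mul_comm]

theorem norm_jacobian {ι κ : Type*} [Fintype ι] [DecidableEq ι] [Fintype κ]
    (f : EuclideanSpace ℝ ι → EuclideanSpace ℝ κ) (t : EuclideanSpace ℝ ι) :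
    ‖jacobian f t‖ = ‖fderiv ℝ f t‖ := by
  rw [← matrixCLM_jacobian, norm_matrixCLM]

theorem enorm_jacobian {ι κ : Type*} [Fintype ι] [DecidableEq ι] [Fintype κ]
    (f : EuclideanSpace ℝ ι → EuclideanSpace ℝ κ) (t : EuclideanSpace ℝ ι) :
    ‖jacobian f t‖ₑ = ‖fderiv ℝ f t‖ₑ := by
  rw [← ofReal_norm, ← ofReal_norm, norm_jacobian]

theorem vecJac_apply (x : 𝒳) (t : EuclideanSpace ℝ (Fin p)) (q : Fin m × Fin p) :
    vecJac g x t q = fderiv ℝ (g x) t (EuclideanSpace.single q.2 1) q.1 := rfl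

theorem norm_vecJac_le (x : 𝒳) (t : EuclideanSpace ℝ (Fin p)) :
    ‖vecJac g x t‖ ≤ (m * p : ℕ) * ‖momentJac g x t‖ := by
  have h1 : ‖vecJac g x t‖ ≤ ∑ q, ‖vecJac g x t q‖ := by
    rw [EuclideanSpace.norm_eq]
    refine Real.sqrt_le_iff.2 ⟨Finset.sum_nonneg fun _ _ => norm_nonneg _, ?_⟩
    exact Finset.sum_sq_le_sq_sum_of_nonneg fun _ _ => norm_nonneg _
  refine h1.trans ?_
  have h2 : ∀ q : Fin m × Fin p, ‖vecJac g x t q‖ ≤ ‖momentJac g x t‖ := fun q => by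
    rw [vecJac_apply, momentJac, norm_jacobian]
    refine (PiLp.norm_apply_le _ _).trans ?_
    simpa using (fderiv ℝ (g x) t).le_opNorm (EuclideanSpace.single q.2 1)
  refine (Finset.sum_le_sum fun q _ => h2 q).trans ?_
  simp

/-- Stacking of two Euclidean vectors. -/
noncomputable def stackCLM (ι κ : Type*) [Fintype ι] [Fintype κ] :
    (EuclideanSpace ℝ ι × EuclideanSpace ℝ κ) →L[ℝ] EuclideanSpace ℝ (ι ⊕ κ) :=
  LinearMap.toContinuousLinearMap
    { toFun := fun u => WithLp.toLp 2 (Sum.elim u.1 u.2)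
      map_add' := fun u v => by ext (i | i) <;> simp
      map_smul' := fun r u => by ext (i | i) <;> simp }

theorem stackCLM_apply {ι κ : Type*} [Fintype ι] [Fintype κ] (u : EuclideanSpace ℝ ι)
    (v : EuclideanSpace ℝ κ) : stackCLM ι κ (u, v) = WithLp.toLp 2 (Sum.elim u v) := rfl

theorem norm_stackCLM_le {ι κ : Type*} [Fintype ι] [Fintype κ] (u : EuclideanSpace ℝ ι)
    (v : EuclideanSpace ℝ κ) : ‖stackCLM ι κ (u, v)‖ ≤ ‖u‖ + ‖v‖ := by
  refine le_of_sq_le_sq ?_ (by positivity)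
  rw [stackCLM_apply, EuclideanSpace.norm_sq_eq, Fintype.sum_sum_type]
  simp only [Sum.elim_inl, Sum.elim_inr]
  rw [← EuclideanSpace.norm_sq_eq, ← EuclideanSpace.norm_sq_eq]
  nlinarith [norm_nonneg u, norm_nonneg v]

theorem contDiffAt_vecJac {x : 𝒳} {t : EuclideanSpace ℝ (Fin p)} (h : ContDiffAt ℝ 2 (g x) t) :
    ContDiffAt ℝ 1 (vecJac g x) t := by
  rw [contDiffAt_piLp]
  intro q
  have h1 : ContDiffAt ℝ 1 (fderiv ℝ (g x)) t := h.fderiv_right (by norm_num)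
  have h2 : ContDiffAt ℝ 1 (fun s => fderiv ℝ (g x) s (EuclideanSpace.single q.2 1)) t :=
    h1.clm_apply contDiffAt_const
  exact (contDiffAt_piLp 2).1 h2 q.1

theorem contDiffAt_augMoment {x : 𝒳} {t : EuclideanSpace ℝ (Fin p)}
    (h : ContDiffAt ℝ 2 (g x) t) : ContDiffAt ℝ 1 (augMoment g x) t :=
  (stackCLM (Fin m) (Fin m × Fin p)).contDiff.contDiffAt.comp t
    ((h.of_le (by norm_num)).prodMk (contDiffAt_vecJac h))

theorem norm_fderiv_augMoment_le {x : 𝒳} {t : EuclideanSpace ℝ (Fin p)}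
    (h : ContDiffAt ℝ 2 (g x) t) :
    ‖fderiv ℝ (augMoment g x) t‖ ≤ ‖fderiv ℝ (g x) t‖ + ‖fderiv ℝ (vecJac g x) t‖ := by
  have h1 : HasFDerivAt (g x) (fderiv ℝ (g x) t) t :=
    (h.differentiableAt (by norm_num)).hasFDerivAt
  have h2 : HasFDerivAt (vecJac g x) (fderiv ℝ (vecJac g x) t) t :=
    ((contDiffAt_vecJac h).differentiableAt (by norm_num)).hasFDerivAt
  have h3 : HasFDerivAt (augMoment g x) ((stackCLM (Fin m) (Fin m × Fin p)).comp
      ((fderiv ℝ (g x) t).prod (fderiv ℝ (vecJac g x) t))) t :=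
    (stackCLM (Fin m) (Fin m × Fin p)).hasFDerivAt.comp t (h1.prodMk h2)
  rw [h3.fderiv]
  refine ContinuousLinearMap.opNorm_le_bound _ (by positivity) fun v => ?_
  refine (norm_stackCLM_le _ _).trans ?_
  rw [add_mul]
  exact add_le_add (ContinuousLinearMap.le_opNorm _ _) (ContinuousLinearMap.le_opNorm _ _)

end Moments

/-! ### Local behaviour of minimizers of quadratic forms -/

/-- The tolerance η depends on Γ, D, S and ε alone. Hence one η works for every sample and every
bootstrap draw, and for a data-dependent weight D' and reference point s. -/
theorem exists_norm_sub_add_le_of_isLocalMin {E F : Type*} [NormedAddCommGroup E]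
    [InnerProductSpace ℝ E] [CompleteSpace E] [NormedAddCommGroup F] [InnerProductSpace ℝ F]
    [CompleteSpace F] (Γ : E →L[ℝ] F) (D : F →L[ℝ] F) (S : E →L[ℝ] E)
    (hS : ∀ v, S (Γ.adjoint (D (Γ v))) = v) {ε : ℝ} (hε : 0 < ε) :
    ∃ η : ℝ, 0 < η ∧ ∀ (t₀ : E) (ρ : ℝ) (f : E → F) (f' : E → E →L[ℝ] F) (D' : F →L[ℝ] F)
      (s t : E), (∀ u ∈ Metric.closedBall t₀ ρ, HasFDerivAt f (f' u) u) →
      (∀ u ∈ Metric.closedBall t₀ ρ, ‖f' u - Γ‖ ≤ η) → ‖D' - D‖ ≤ η →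
      (∀ x y, inner ℝ (D' x) y = inner ℝ x (D' y)) →
      s ∈ Metric.closedBall t₀ ρ → t ∈ Metric.closedBall t₀ ρ →
      IsLocalMin (fun u => inner ℝ (f u) (D' (f u))) t →
      ‖(t - s) + S (Γ.adjoint (D (f s)))‖ ≤ ε * ‖f s‖ := by
  obtain ⟨η, hη, h⟩ := exists_norm_add_le_of_perturbed_equation Γ D S hS hε
  refine ⟨η, hη, fun t₀ ρ f f' D' s t hf hf' hD' hsymm hs ht hmin => ?_⟩
  refine h (f' t) D' (f s) (f t - f s - Γ (t - s)) (t - s) (hf' t ht) hD' ?_ ?_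
  -- The mean value inequality for f - Γ bounds the remainder; no mean value point, and so no
  -- row-by-row expansion, is needed.
  · exact (convex_closedBall t₀ ρ).norm_image_sub_le_of_norm_hasFDerivWithin_le'
      (fun u hu => (hf u hu).hasFDerivWithinAt) hf' hs ht
  · have e : f s + Γ (t - s) + (f t - f s - Γ (t - s)) = f t := by abel
    rw [e]
    exact adjoint_apply_eq_zero_of_isLocalMin_quadratic hsymm (hf t ht) hmin

/-! ### Uniform laws of large numbers -/

theorem avg_restrictMap_apply {𝒳 Y F : Type*} [TopologicalSpace Y] [NormedAddCommGroup F]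
    [NormedSpace ℝ F] {s : Set Y} {φ : 𝒳 → Y → F} {n : ℕ} (x : Fin n → 𝒳)
    (hx : ∀ i, ContinuousOn (φ (x i)) s) (t : s) :
    (avg x (restrictMap s φ)) t = avg x fun y => φ y t := by
  simp only [avg, ContinuousMap.smul_apply, ContinuousMap.sum_apply]
  congr 1
  refine Finset.sum_congr rfl fun i _ => ?_
  rw [restrictMap_apply (hx i)]

theorem integrable_apply_of_integrable_restrictMap {𝒳 Y F : Type*} [MeasurableSpace 𝒳]
    {F₀ : Measure 𝒳} [MetricSpace Y] [NormedAddCommGroup F] [NormedSpace ℝ F] {s : Set Y}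
    [CompactSpace s] {φ : 𝒳 → Y → F} (hcont : ∀ᵐ x ∂F₀, ContinuousOn (φ x) s)
    (hint : Integrable (restrictMap s φ) F₀) {t : Y}
    (ht : t ∈ s) : Integrable (fun x => φ x t) F₀ := by
  refine ((ContinuousMap.evalCLM ℝ (⟨t, ht⟩ : s)).integrable_comp hint).congr ?_
  filter_upwards [hcont] with x hx
  exact restrictMap_apply hx (⟨t, ht⟩ : s)

section Uniform

variable {Ω 𝒳 Y F : Type*} [MeasurableSpace Ω] [MeasurableSpace 𝒳] {P : Measure Ω}
  {F₀ : Measure 𝒳} {X : ℕ → Ω → 𝒳} [MetricSpace Y] [NormedAddCommGroup F] [NormedSpace ℝ F]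
  [CompleteSpace F] {s : Set Y} [CompactSpace s] {φ : 𝒳 → Y → F}

theorem integral_restrictMap_apply (hcont : ∀ᵐ x ∂F₀, ContinuousOn (φ x) s)
    (hint : Integrable (restrictMap s φ) F₀) (t : s) :
    (∫ x, restrictMap s φ x ∂F₀) t = ∫ x, φ x t ∂F₀ := by
  have h := (ContinuousMap.evalCLM ℝ t).integral_comp_comm hint
  refine Eq.trans h.symm (integral_congr_ae ?_)
  filter_upwards [hcont] with x hx
  exact restrictMap_apply hx t

theorem continuousOn_integral (hcont : ∀ᵐ x ∂F₀, ContinuousOn (φ x) s)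
    (hint : Integrable (restrictMap s φ) F₀) :
    ContinuousOn (fun t => ∫ x, φ x t ∂F₀) s := by
  rw [continuousOn_iff_continuous_domRestrict]
  refine (∫ x, restrictMap s φ x ∂F₀).continuous.congr fun t => ?_
  exact integral_restrictMap_apply hcont hint t

/-- A uniform law of large numbers is the strong law for random elements of the space of continuous
functions with the sup norm. -/
theorem tendstoUniformlyOn_avg_sample_ae (hind : iIndepFun X P) (hlaw : ∀ i, HasLaw (X i) F₀ P)
    (hcont : ∀ᵐ x ∂F₀, ContinuousOn (φ x) s)
    (hint : Integrable (restrictMap s φ) F₀) :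
    ∀ᵐ ω ∂P, TendstoUniformlyOn (fun n t => avg (sample X n ω) fun x => φ x t)
      (fun t => ∫ x, φ x t ∂F₀) atTop s := by
  filter_upwards [tendsto_avg_sample_ae hind hlaw hint, ae_forall_sample hlaw hcont] with ω h1 h2
  rw [Metric.tendstoUniformlyOn_iff]
  intro ε hε
  filter_upwards [(Metric.tendsto_nhds.1 h1) ε hε] with n hn t ht
  have h3 := ContinuousMap.dist_apply_le_dist (f := ∫ x, restrictMap s φ x ∂F₀)
    (g := avg (sample X n ω) (restrictMap s φ)) (⟨t, ht⟩ : s)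
  rw [avg_restrictMap_apply (sample X n ω) (fun i => h2 i),
    integral_restrictMap_apply hcont hint] at h3
  rw [dist_comm] at hn
  exact h3.trans_lt hn

end Uniform

/-! ### Consequences of the GMM assumptions -/

section GMM

variable {Ω 𝒳 : Type*} [MeasurableSpace Ω] [MeasurableSpace 𝒳] {m p : ℕ} {P : Measure Ω}
  {F₀ : Measure 𝒳} {X : ℕ → Ω → 𝒳}
  {g : 𝒳 → EuclideanSpace ℝ (Fin p) → EuclideanSpace ℝ (Fin m)}
  {Θ : Set (EuclideanSpace ℝ (Fin p))} {W : Matrix (Fin m) (Fin m) ℝ}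
  {θW : EuclideanSpace ℝ (Fin p)}

namespace GMMAssumptions

theorem isProbabilityMeasure_law [IsProbabilityMeasure P] (h : GMMAssumptions P F₀ X g Θ W θW) :
    IsProbabilityMeasure F₀ := by
  rw [← (h.law 0).map_eq]
  exact Measure.isProbabilityMeasure_map (h.law 0).aemeasurable

theorem mem (h : GMMAssumptions P F₀ X g Θ W θW) : θW ∈ Θ := interior_subset h.interior

theorem aemeasurable_vecJac (h : GMMAssumptions P F₀ X g Θ W θW) {t : EuclideanSpace ℝ (Fin p)}
    (ht : t ∈ Θ) : AEMeasurable (fun x => vecJac g x t) F₀ := by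
  have e : (fun x => vecJac g x t)
      = fun x => ∑ q, vecJac g x t q • EuclideanSpace.single q (1 : ℝ) :=
    funext fun x => (sum_smul_single_one _).symm
  rw [e]
  refine Finset.aemeasurable_fun_sum _ fun q _ => AEMeasurable.smul_const ?_ _
  have h1 : AEMeasurable (fun x => fderiv ℝ (g x) t (EuclideanSpace.single q.2 1)) F₀ :=
    aemeasurable_fderiv_apply
      (h.smooth.mono fun x hx => (hx t ht).differentiableAt (by norm_num))
      (Eventually.of_forall fun s => (h.measurable s).aemeasurable)
  exact (EuclideanSpace.proj (𝕜 := ℝ) q.1).continuous.measurable.comp_aemeasurable h1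

theorem aemeasurable_augMoment (h : GMMAssumptions P F₀ X g Θ W θW)
    {t : EuclideanSpace ℝ (Fin p)} (ht : t ∈ Θ) :
    AEMeasurable (fun x => augMoment g x t) F₀ :=
  (stackCLM (Fin m) (Fin m × Fin p)).continuous.measurable.comp_aemeasurable
    ((h.measurable t).aemeasurable.prodMk (h.aemeasurable_vecJac ht))

theorem eventually_mem {t : EuclideanSpace ℝ (Fin p)} (ht : t ∈ _root_.interior Θ) :
    ∀ᶠ s in 𝓝 t, s ∈ Θ := mem_interior_iff_mem_nhds.1 ht

theorem continuousOn_moment (h : GMMAssumptions P F₀ X g Θ W θW) :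
    ∀ᵐ x ∂F₀, ContinuousOn (g x) Θ :=
  h.smooth.mono fun _ hx t ht => (hx t ht).continuousAt.continuousWithinAt

theorem continuousOn_vecJac (h : GMMAssumptions P F₀ X g Θ W θW) :
    ∀ᵐ x ∂F₀, ContinuousOn (vecJac g x) Θ :=
  h.smooth.mono fun _ hx t ht => (contDiffAt_vecJac (hx t ht)).continuousAt.continuousWithinAt

theorem continuousOn_augMoment (h : GMMAssumptions P F₀ X g Θ W θW) :
    ∀ᵐ x ∂F₀, ContinuousOn (augMoment g x) Θ :=
  h.smooth.mono fun _ hx t ht => (contDiffAt_augMoment (hx t ht)).continuousAt.continuousWithinAt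

theorem integrable_restrictMap_moment (h : GMMAssumptions P F₀ X g Θ W θW) [CompactSpace Θ] :
    Integrable (restrictMap Θ g) F₀ :=
  integrable_restrictMap_of_lintegral h.continuousOn_moment
    (fun t _ => (h.measurable t).aemeasurable) h.sup_moment

theorem lintegral_sup_vecJac_lt_top (h : GMMAssumptions P F₀ X g Θ W θW) :
    ∫⁻ x, ⨆ t ∈ Θ, ‖vecJac g x t‖ₑ ∂F₀ < ∞ := by
  have h1 : ∀ x, (⨆ t ∈ Θ, ‖vecJac g x t‖ₑ)
      ≤ ((m * p : ℕ) : ℝ≥0∞) * ⨆ t ∈ Θ, ‖momentJac g x t‖ₑ := fun x => by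
    refine iSup₂_le fun t ht => ?_
    refine le_trans ?_ (mul_le_mul_right (le_iSup₂ (f := fun t (_ : t ∈ Θ) =>
      ‖momentJac g x t‖ₑ) t ht) _)
    rw [← ofReal_norm, ← ofReal_norm, ← ENNReal.ofReal_natCast, ← ENNReal.ofReal_mul (by positivity)]
    exact ENNReal.ofReal_le_ofReal (norm_vecJac_le x t)
  refine (lintegral_mono h1).trans_lt ?_
  rw [lintegral_const_mul' _ _ (ENNReal.natCast_ne_top _)]
  exact ENNReal.mul_lt_top (ENNReal.natCast_lt_top _) h.sup_momentJac

theorem integrable_restrictMap_augMoment (h : GMMAssumptions P F₀ X g Θ W θW) [CompactSpace Θ] :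
    Integrable (restrictMap Θ (augMoment g)) F₀ := by
  have h1 := h.integrable_restrictMap_moment
  have h2 : Integrable (restrictMap Θ (vecJac g)) F₀ :=
    integrable_restrictMap_of_lintegral h.continuousOn_vecJac
      (fun t ht => h.aemeasurable_vecJac ht) h.lintegral_sup_vecJac_lt_top
  refine integrable_restrictMap_of_bound h.continuousOn_augMoment
    (fun t ht => h.aemeasurable_augMoment ht) (h1.norm.add h2.norm) ?_
  filter_upwards [h.continuousOn_moment, h.continuousOn_vecJac] with x hx1 hx2 t ht
  have e1 := ContinuousMap.norm_coe_le_norm (restrictMap Θ g x) ⟨t, ht⟩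
  have e2 := ContinuousMap.norm_coe_le_norm
    (restrictMap Θ (vecJac g) x) ⟨t, ht⟩
  rw [restrictMap_apply hx1] at e1
  rw [restrictMap_apply hx2] at e2
  exact (norm_stackCLM_le _ _).trans (add_le_add e1 e2)

theorem continuousOn_fderiv_augMoment (h : GMMAssumptions P F₀ X g Θ W θW)
    {B : Set (EuclideanSpace ℝ (Fin p))} (hB : B ⊆ Θ) :
    ∀ᵐ x ∂F₀, ContinuousOn (fderiv ℝ (augMoment g x)) B :=
  h.smooth.mono fun _ hx t ht =>
    ((contDiffAt_augMoment (hx t (hB ht))).continuousAt_fderiv (by norm_num)).continuousWithinAt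

/-- The derivative of ψ is dominated by the sum of the derivative norms of its two blocks. The set B
stays inside the interior because difference quotients of the Jacobian need a neighborhood on which
it is measurable. -/
theorem integrable_restrictMap_fderiv_augMoment (h : GMMAssumptions P F₀ X g Θ W θW)
    {B : Set (EuclideanSpace ℝ (Fin p))} [CompactSpace B] (hB : B ⊆ _root_.interior Θ) :
    Integrable (restrictMap B fun x => fderiv ℝ (augMoment g x)) F₀ := by
  have hBΘ : B ⊆ Θ := hB.trans interior_subset
  have c1 : ∀ᵐ x ∂F₀, ContinuousOn (fderiv ℝ (g x)) B :=
    h.smooth.mono fun _ hx t ht =>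
      ((hx t (hBΘ ht)).continuousAt_fderiv (by norm_num)).continuousWithinAt
  have c2 : ∀ᵐ x ∂F₀, ContinuousOn (fderiv ℝ (vecJac g x)) B :=
    h.smooth.mono fun _ hx t ht =>
      ((contDiffAt_vecJac (hx t (hBΘ ht))).continuousAt_fderiv (by norm_num)).continuousWithinAt
  have h1 : Integrable (restrictMap B fun x => fderiv ℝ (g x)) F₀ := by
    refine integrable_restrictMap_of_lintegral c1 (fun t ht => ?_)
      ((lintegral_mono fun x => ?_).trans_lt h.sup_momentJac)
    · exact aemeasurable_fderiv
        (h.smooth.mono fun x hx => (hx t (hBΘ ht)).differentiableAt (by norm_num))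
        (Eventually.of_forall fun s => (h.measurable s).aemeasurable)
    · refine iSup₂_le fun t ht => ?_
      rw [← enorm_jacobian]
      exact le_iSup₂ (f := fun t (_ : t ∈ Θ) => ‖momentJac g x t‖ₑ) t (hBΘ ht)
  have h2 : Integrable (restrictMap B fun x => fderiv ℝ (vecJac g x)) F₀ := by
    refine integrable_restrictMap_of_lintegral c2 (fun t ht => ?_)
      ((lintegral_mono fun x => ?_).trans_lt h.sup_secondJac)
    · exact aemeasurable_fderiv
        (h.smooth.mono fun x hx =>
          (contDiffAt_vecJac (hx t (hBΘ ht))).differentiableAt (by norm_num))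
        ((eventually_mem (hB ht)).mono fun s hs => h.aemeasurable_vecJac hs)
    · refine iSup₂_le fun t ht => ?_
      rw [← enorm_jacobian]
      exact le_iSup₂ (f := fun t (_ : t ∈ Θ) => ‖secondJac g x t‖ₑ) t (hBΘ ht)
  refine integrable_restrictMap_of_bound (h.continuousOn_fderiv_augMoment hBΘ)
    (fun t ht => ?_) (h1.norm.add h2.norm) ?_
  · exact aemeasurable_fderiv
      (h.smooth.mono fun x hx =>
        (contDiffAt_augMoment (hx t (hBΘ ht))).differentiableAt (by norm_num))
      ((eventually_mem (hB ht)).mono fun s hs => h.aemeasurable_augMoment hs)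
  filter_upwards [c1, c2, h.smooth] with x hx1 hx2 hx t ht
  have e1 := ContinuousMap.norm_coe_le_norm
    (restrictMap B (fun x => fderiv ℝ (g x)) x) ⟨t, ht⟩
  have e2 := ContinuousMap.norm_coe_le_norm
    (restrictMap B (fun x => fderiv ℝ (vecJac g x)) x) ⟨t, ht⟩
  rw [restrictMap_apply (φ := fun x => fderiv ℝ (g x)) hx1] at e1
  rw [restrictMap_apply (φ := fun x => fderiv ℝ (vecJac g x)) hx2] at e2
  exact (norm_fderiv_augMoment_le (hx t (hBΘ ht))).trans (add_le_add e1 e2)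

theorem memLp_augMoment (h : GMMAssumptions P F₀ X g Θ W θW) :
    MemLp (fun x => augMoment g x θW) 2 F₀ := by
  have h1 : MemLp (fun x => g x θW) 2 F₀ := by
    refine ⟨(h.measurable θW).aestronglyMeasurable, ?_⟩
    rw [eLpNorm_lt_top_iff_lintegral_rpow_enorm_lt_top (by norm_num) (by norm_num)]
    simpa using h.sq_moment
  have h2 : MemLp (fun x => vecJac g x θW) 2 F₀ := by
    refine ⟨(h.aemeasurable_vecJac h.mem).aestronglyMeasurable, ?_⟩
    rw [eLpNorm_lt_top_iff_lintegral_rpow_enorm_lt_top (by norm_num) (by norm_num)]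
    have h3 : ∀ x, ‖vecJac g x θW‖ₑ ^ (2 : ℝ≥0∞).toReal
        ≤ ((m * p : ℕ) : ℝ≥0∞) ^ 2 * ‖momentJac g x θW‖ₑ ^ 2 := fun x => by
      rw [← mul_pow]
      simp only [ENNReal.toReal_ofNat, ENNReal.rpow_ofNat]
      gcongr
      rw [← ofReal_norm, ← ofReal_norm, ← ENNReal.ofReal_natCast, ← ENNReal.ofReal_mul (by positivity)]
      exact ENNReal.ofReal_le_ofReal (norm_vecJac_le x θW)
    refine (lintegral_mono h3).trans_lt ?_
    rw [lintegral_const_mul' _ _ (ENNReal.pow_ne_top (ENNReal.natCast_ne_top _))]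
    exact ENNReal.mul_lt_top (ENNReal.pow_lt_top (ENNReal.natCast_lt_top _)) h.sq_momentJac
  refine (h1.norm.add h2.norm).of_le (h.aemeasurable_augMoment h.mem).aestronglyMeasurable
    (Eventually.of_forall fun x => ?_)
  refine (norm_stackCLM_le _ _).trans ?_
  simp only [Pi.add_apply, Real.norm_eq_abs]
  exact le_abs_self _

theorem posSemidef_popSigma [IsProbabilityMeasure P] (h : GMMAssumptions P F₀ X g Θ W θW) :
    (popSigma F₀ g θW).PosSemidef := by
  have := h.isProbabilityMeasure_law
  exact posSemidef_covMatrix h.memLp_augMoment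

/-- A closed ball around the pseudo-true value contained in the interior of the parameter
space. -/
theorem exists_closedBall_subset (h : GMMAssumptions P F₀ X g Θ W θW) :
    ∃ r : ℝ, 0 < r ∧ Metric.closedBall θW r ⊆ _root_.interior Θ :=
  Metric.nhds_basis_closedBall.mem_iff.1 (isOpen_interior.mem_nhds h.interior)

theorem integral_fderiv_augMoment
    (hint : Integrable (fun x => fderiv ℝ (augMoment g x) θW) F₀) :
    ∫ x, fderiv ℝ (augMoment g x) θW ∂F₀ = matrixCLM (popGamma F₀ g θW) := by
  ext v a
  have e1 : ∀ w, (∫ x, fderiv ℝ (augMoment g x) θW ∂F₀) w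
      = ∫ x, fderiv ℝ (augMoment g x) θW w ∂F₀ := fun w =>
    ContinuousLinearMap.integral_apply hint w
  have e2 : ∀ w, (∫ x, fderiv ℝ (augMoment g x) θW w ∂F₀) a
      = ∫ x, fderiv ℝ (augMoment g x) θW w a ∂F₀ := fun w =>
    ((EuclideanSpace.proj (𝕜 := ℝ) (ι := AugIdx m p) a).integral_comp_comm
      (hint.apply_continuousLinearMap w)).symm
  have e3 : ∀ L : EuclideanSpace ℝ (Fin p) →L[ℝ] EuclideanSpace ℝ (AugIdx m p),
      L v a = ∑ k, v k * L (EuclideanSpace.single k 1) a := fun L => by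
    conv_lhs => rw [← sum_smul_single_one v]
    simp
  rw [e3]
  simp only [e1, e2]
  simp [ofLp_matrixCLM, Matrix.mulVec, dotProduct, popGamma, jacobian, mul_comm]

end GMMAssumptions

end GMM

/-! ### Matrix algebra of the asymptotic variance -/

section Sandwich

variable {ι κ : Type*} [Fintype ι] [DecidableEq ι] [Fintype κ]

theorem inv_apply_adjoint_apply_eq [DecidableEq κ] (Γ : Matrix κ ι ℝ) (Δ : Matrix κ κ ℝ)
    (z : EuclideanSpace ℝ κ) :
    matrixCLM (Γᵀ * Δ * Γ)⁻¹ ((matrixCLM Γ).adjoint (matrixCLM Δ z))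
      = matrixCLM ((Γᵀ * Δ * Γ)⁻¹ * Γᵀ * Δ) z := by
  rw [adjoint_matrixCLM, matrixCLM_mul, matrixCLM_mul]

theorem inv_apply_adjoint_apply_self [DecidableEq κ] {Γ : Matrix κ ι ℝ} {Δ : Matrix κ κ ℝ}
    (h : IsUnit (Γᵀ * Δ * Γ).det) (v : EuclideanSpace ℝ ι) :
    matrixCLM (Γᵀ * Δ * Γ)⁻¹ ((matrixCLM Γ).adjoint (matrixCLM Δ (matrixCLM Γ v))) = v := by
  rw [inv_apply_adjoint_apply_eq, ← matrixCLM_mul]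
  have : (Γᵀ * Δ * Γ)⁻¹ * Γᵀ * Δ * Γ = 1 := by
    rw [Matrix.mul_assoc, Matrix.mul_assoc, ← Matrix.mul_assoc Γᵀ, Matrix.nonsing_inv_mul _ h]
  rw [this]
  apply WithLp.ofLp_injective 2
  simp [ofLp_matrixCLM]

/-- The left side is the covariance of the image of N(0, S) under the linear map that appears in the
expansion of the estimators. -/
theorem mul_mul_transpose_eq_sandwich (Γ : Matrix κ ι ℝ) {Δ : Matrix κ κ ℝ} (hΔ : Δᵀ = Δ)
    (S : Matrix κ κ ℝ) :
    -((Γᵀ * Δ * Γ)⁻¹ * Γᵀ * Δ) * S * (-((Γᵀ * Δ * Γ)⁻¹ * Γᵀ * Δ))ᵀ = sandwich Γ Δ S := by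
  simp only [sandwich, Matrix.transpose_neg, Matrix.transpose_mul, Matrix.transpose_transpose,
    Matrix.transpose_nonsing_inv, hΔ, Matrix.neg_mul, Matrix.mul_neg, neg_neg, Matrix.mul_assoc]

theorem sandwich_inv [DecidableEq κ] {Γ : Matrix κ ι ℝ} {S : Matrix κ κ ℝ} (hS : IsUnit S.det)
    (h : IsUnit (Γᵀ * S⁻¹ * Γ).det) : sandwich Γ S⁻¹ S = (Γᵀ * S⁻¹ * Γ)⁻¹ := by
  have e : (Γᵀ * S⁻¹ * Γ)⁻¹ * Γᵀ * S⁻¹ * S * S⁻¹ * Γ = 1 := by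
    rw [Matrix.mul_assoc _ S⁻¹ S, Matrix.nonsing_inv_mul _ hS, Matrix.mul_one, Matrix.mul_assoc,
      Matrix.mul_assoc, ← Matrix.mul_assoc Γᵀ, Matrix.nonsing_inv_mul _ h]
  rw [sandwich, e, Matrix.one_mul]

theorem inner_matrixCLM_symm [DecidableEq κ] {Δ : Matrix κ κ ℝ} (hΔ : Δᵀ = Δ)
    (x y : EuclideanSpace ℝ κ) :
    inner ℝ (matrixCLM Δ x) y = inner ℝ x (matrixCLM Δ y) := by
  rw [inner_matrixCLM_left, hΔ]

theorem eq_zero_of_quadForm_nonpos {Δ : Matrix κ κ ℝ} (hΔ : Δ.PosDef) {v : EuclideanSpace ℝ κ}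
    (hv : quadForm Δ v ≤ 0) : v = 0 := by
  by_contra hne
  have h1 : v.ofLp ≠ 0 := fun h => hne (WithLp.ofLp_injective 2 h)
  have h2 := hΔ.dotProduct_mulVec_pos h1
  rw [star_trivial] at h2
  exact absurd h2 (not_lt.2 hv)

theorem continuous_quadForm [DecidableEq κ] (A : Matrix κ κ ℝ) : Continuous (quadForm A) := by
  have : quadForm A = fun v => inner ℝ v (matrixCLM A v) := funext fun v => quadForm_eq_inner A v
  rw [this]
  exact continuous_id.inner (matrixCLM A).continuous

end Sandwich

/-! ### Consistency and linearization for sample objectives -/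

/-- A quadratic form need not be uniformly continuous on the whole space, but it is on the compact
1-thickening of f(Θ), which eventually contains the values of the approximating functions. -/
theorem tendsto_of_isArgminOn_quadForm {E κ : Type*} [MetricSpace E] [Fintype κ] [DecidableEq κ]
    {Θ : Set E} (hΘ : IsCompact Θ) (A : Matrix κ κ ℝ) {f : E → EuclideanSpace ℝ κ}
    (hf : ContinuousOn f Θ) {t₀ : E}
    (hmin : ∀ t, IsArgminOn (fun s => quadForm A (f s)) Θ t → t = t₀)
    {fn : ℕ → E → EuclideanSpace ℝ κ} (hfn : TendstoUniformlyOn fn f atTop Θ) {t : ℕ → E}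
    (ht : ∀ᶠ n in atTop, IsArgminOn (fun s => quadForm A (fn n s)) Θ (t n)) :
    Tendsto t atTop (𝓝 t₀) := by
  refine tendsto_of_isArgminOn hΘ ((continuous_quadForm A).comp_continuousOn hf) hmin ?_ ht
  have hK : IsCompact (Metric.cthickening 1 (f '' Θ)) := (hΘ.image_of_continuousOn hf).cthickening
  refine (hK.uniformContinuousOn_of_continuous
    (continuous_quadForm A).continuousOn).comp_tendstoUniformlyOn_eventually ?_ ?_ hfn
  · filter_upwards [Metric.tendstoUniformlyOn_iff.1 hfn 1 one_pos] with n hn x hx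
    refine Metric.mem_cthickening_of_dist_le _ (f x) _ _ ⟨x, hx, rfl⟩ ?_
    rw [dist_comm]
    exact (hn x hx).le
  · exact fun x hx => Metric.self_subset_cthickening _ ⟨x, hx, rfl⟩

theorem avg_const {𝒳 E : Type*} [NormedAddCommGroup E] [NormedSpace ℝ E] {n : ℕ} (hn : 0 < n)
    (x : Fin n → 𝒳) (c : E) : (avg x fun _ => c) = c := by
  have hn' : (n : ℝ) ≠ 0 := by exact_mod_cast hn.ne'
  simp [avg, ← Nat.cast_smul_eq_nsmul ℝ, smul_smul, hn']

theorem avg_sub_const {𝒳 E : Type*} [NormedAddCommGroup E] [NormedSpace ℝ E] {n : ℕ} (hn : 0 < n)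
    (x : Fin n → 𝒳) (h : 𝒳 → E) (c : E) : (avg x fun y => h y - c) = avg x h - c := by
  rw [avg_sub, avg_const hn]

theorem hasFDerivAt_avg {𝒳 E F : Type*} [NormedAddCommGroup E] [NormedSpace ℝ E]
    [NormedAddCommGroup F] [NormedSpace ℝ F] {φ : 𝒳 → E → F} {n : ℕ} (x : Fin n → 𝒳) {t : E}
    (hx : ∀ i, DifferentiableAt ℝ (φ (x i)) t) :
    HasFDerivAt (fun s => avg x fun y => φ y s) (avg x fun y => fderiv ℝ (φ y) t) t := by
  have h := (HasFDerivAt.fun_sum (u := Finset.univ) fun i _ => (hx i).hasFDerivAt).const_smul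
    ((n : ℝ)⁻¹)
  exact h

theorem tendsto_measure_of_ae_eventually_notMem {α : Type*} [MeasurableSpace α] {μ : Measure α}
    [IsFiniteMeasure μ] {s : ℕ → Set α} (hs : ∀ n, NullMeasurableSet (s n) μ)
    (h : ∀ᵐ a ∂μ, ∀ᶠ n in atTop, a ∉ s n) : Tendsto (fun n => μ (s n)) atTop (𝓝 0) := by
  have h1 : TendstoInMeasure μ (fun n => (s n).indicator fun _ => (1 : ℝ)) atTop fun _ => 0 := by
    refine tendstoInMeasure_of_tendsto_ae
      (fun n => aestronglyMeasurable_const.indicator₀ (hs n)) ?_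
    filter_upwards [h] with a ha
    refine tendsto_const_nhds.congr' ?_
    filter_upwards [ha] with n hn
    rw [Set.indicator_of_notMem hn]
  rw [tendstoInMeasure_iff_norm] at h1
  refine (h1 1 one_pos).congr fun n => ?_
  congr 1
  ext a
  by_cases ha : a ∈ s n <;> simp [ha]

section GMM

variable {Ω 𝒳 : Type*} [MeasurableSpace Ω] [MeasurableSpace 𝒳] {m p : ℕ} {P : Measure Ω}
  {F₀ : Measure 𝒳} {X : ℕ → Ω → 𝒳}
  {g : 𝒳 → EuclideanSpace ℝ (Fin p) → EuclideanSpace ℝ (Fin m)}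
  {Θ : Set (EuclideanSpace ℝ (Fin p))} {W : Matrix (Fin m) (Fin m) ℝ}
  {θW : EuclideanSpace ℝ (Fin p)}

theorem isLocalMin_inner_of_isArgminOn {κ : Type*} [Fintype κ] [DecidableEq κ]
    {f : EuclideanSpace ℝ (Fin p) → EuclideanSpace ℝ κ} {A : Matrix κ κ ℝ}
    {t : EuclideanSpace ℝ (Fin p)} (h : IsArgminOn (fun s => quadForm A (f s)) Θ t)
    (ht : t ∈ interior Θ) :
    IsLocalMin (fun s => inner ℝ (f s) (matrixCLM A (f s))) t := by
  filter_upwards [mem_interior_iff_mem_nhds.1 ht] with s hs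
  simpa only [quadForm_eq_inner] using h.2 s hs

namespace GMMAssumptions

/-- The population derivative is close to `Γ` near the pseudo-true value. -/
theorem exists_closedBall_norm_integral_fderiv_sub_le (h : GMMAssumptions P F₀ X g Θ W θW)
    {r : ℝ} (hr : 0 < r) (hrΘ : Metric.closedBall θW r ⊆ _root_.interior Θ) {η : ℝ} (hη : 0 < η) :
    ∃ ρ : ℝ, 0 < ρ ∧ ρ ≤ r ∧ ∀ t ∈ Metric.closedBall θW ρ,
      ‖∫ x, fderiv ℝ (augMoment g x) t ∂F₀ - matrixCLM (popGamma F₀ g θW)‖ ≤ η := by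
  have hc : CompactSpace (Metric.closedBall θW r) :=
    isCompact_iff_compactSpace.1 (isCompact_closedBall _ _)
  have hcont := h.continuousOn_fderiv_augMoment (hrΘ.trans interior_subset)
  have hint := h.integrable_restrictMap_fderiv_augMoment hrΘ
  have h1 : ContinuousAt (fun t => ∫ x, fderiv ℝ (augMoment g x) t ∂F₀) θW :=
    (continuousOn_integral (φ := fun x => fderiv ℝ (augMoment g x)) hcont hint).continuousAt
      (Metric.closedBall_mem_nhds _ hr)
  have h2 := integral_fderiv_augMoment (integrable_apply_of_integrable_restrictMap
    (φ := fun x => fderiv ℝ (augMoment g x)) hcont hint (Metric.mem_closedBall_self hr.le))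
  obtain ⟨δ, hδ, hball⟩ := Metric.continuousAt_iff.1 h1 η hη
  refine ⟨min (δ / 2) r, by positivity, min_le_right _ _, fun t ht => ?_⟩
  have h3 := hball (x := t) ((Metric.mem_closedBall.1 ht).trans_lt
    ((min_le_left _ _).trans_lt (half_lt_self hδ)))
  rw [h2, dist_eq_norm] at h3
  exact h3.le

theorem tendsto_gmm_ae (h : GMMAssumptions P F₀ X g Θ W θW)
    {θGMM : ℕ → Ω → EuclideanSpace ℝ (Fin p)}
    (hmin : ∀ n, 0 < n → ∀ᵐ ω ∂P, IsArgminOn (gmmObjective g W (sample X n ω)) Θ (θGMM n ω)) :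
    ∀ᵐ ω ∂P, Tendsto (fun n => θGMM n ω) atTop (𝓝 θW) := by
  have hΘ : CompactSpace Θ := isCompact_iff_compactSpace.1 h.compact
  have hmin' : ∀ᵐ ω ∂P, ∀ n, 0 < n → IsArgminOn (gmmObjective g W (sample X n ω)) Θ (θGMM n ω) :=
    ae_all_iff.2 fun n => by
      by_cases hn : 0 < n
      · filter_upwards [hmin n hn] with ω hω _ using hω
      · exact Eventually.of_forall fun ω hn' => absurd hn' hn
  filter_upwards [hmin', tendstoUniformlyOn_avg_sample_ae h.indep h.law h.continuousOn_moment
    h.integrable_restrictMap_moment] with ω h1 h2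
  refine tendsto_of_isArgminOn_quadForm h.compact W
    (continuousOn_integral h.continuousOn_moment h.integrable_restrictMap_moment)
    (fun t ht => (h.argmin t).1 ht) h2 ?_
  filter_upwards [eventually_gt_atTop 0] with n hn using h1 n hn

theorem integrable_augMoment (h : GMMAssumptions P F₀ X g Θ W θW)
    {t : EuclideanSpace ℝ (Fin p)} (ht : t ∈ Θ) : Integrable (fun x => augMoment g x t) F₀ := by
  have hΘ : CompactSpace Θ := isCompact_iff_compactSpace.1 h.compact
  exact integrable_apply_of_integrable_restrictMap h.continuousOn_augMoment
    h.integrable_restrictMap_augMoment ht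

/-- Moves the recentering outside the average. Positivity of n matters: the empty average is zero,
so it loses the constant. -/
theorem meObjective_eq {n : ℕ} (hn : 0 < n) (Δ : Matrix (AugIdx m p) (AugIdx m p) ℝ)
    (x : Fin n → 𝒳) :
    meObjective F₀ g θW Δ x = fun t => quadForm Δ
      ((avg x fun y => augMoment g y t) - ∫ y, augMoment g y θW ∂F₀) := by
  ext t
  simp only [meObjective, recentered]
  rw [avg_sub_const hn]

theorem tendsto_me_ae [IsProbabilityMeasure P] (h : GMMAssumptions P F₀ X g Θ W θW)
    (hunique : ∀ θ ∈ Θ, ∫ x, recentered F₀ g θW x θ ∂F₀ = 0 ↔ θ = θW)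
    {Δ : Matrix (AugIdx m p) (AugIdx m p) ℝ} (hΔ : Δ.PosDef)
    {θME : ℕ → Ω → EuclideanSpace ℝ (Fin p)}
    (hmin : ∀ᵐ ω ∂P, ∀ n, 0 < n →
      IsArgminOn (meObjective F₀ g θW Δ (sample X n ω)) Θ (θME n ω)) :
    ∀ᵐ ω ∂P, Tendsto (fun n => θME n ω) atTop (𝓝 θW) := by
  have hF := h.isProbabilityMeasure_law
  have hΘ : CompactSpace Θ := isCompact_iff_compactSpace.1 h.compact
  set c : EuclideanSpace ℝ (AugIdx m p) := ∫ y, augMoment g y θW ∂F₀ with hc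
  filter_upwards [hmin, tendstoUniformlyOn_avg_sample_ae h.indep h.law h.continuousOn_augMoment
    h.integrable_restrictMap_augMoment] with ω h1 h2
  refine tendsto_of_isArgminOn_quadForm h.compact Δ
    (f := fun t => (∫ x, augMoment g x t ∂F₀) - c)
    ((continuousOn_integral h.continuousOn_augMoment h.integrable_restrictMap_augMoment).sub
      continuousOn_const) (fun t ht => ?_)
    (fn := fun n t => (avg (sample X n ω) fun x => augMoment g x t) - c) ?_ ?_
  -- The population objective vanishes at θW, so a minimizer has value at most 0; positive
  -- definiteness then makes its recentered moment zero.
  · have h3 := ht.2 θW h.mem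
    have h4 : quadForm Δ ((∫ x, augMoment g x θW ∂F₀) - c) = 0 := by
      rw [hc, sub_self]; simp [quadForm]
    replace h3 := h3.trans_eq h4
    refine (hunique t ht.1).1 ?_
    simp only [recentered]
    rw [integral_sub (h.integrable_augMoment ht.1) (integrable_const _)]
    simpa using eq_zero_of_quadForm_nonpos hΔ h3
  · rw [Metric.tendstoUniformlyOn_iff] at h2 ⊢
    intro ε hε
    filter_upwards [h2 ε hε] with n hn t ht
    rw [dist_sub_right]
    exact hn t ht
  · filter_upwards [eventually_gt_atTop 0] with n hn
    have := h1 n hn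
    rwa [meObjective_eq hn] at this

/-- Linearization of the ME-GMM estimator. -/
theorem eventually_norm_me_sub_le [IsProbabilityMeasure P] (h : GMMAssumptions P F₀ X g Θ W θW)
    (hunique : ∀ θ ∈ Θ, ∫ x, recentered F₀ g θW x θ ∂F₀ = 0 ↔ θ = θW)
    {Δ : Matrix (AugIdx m p) (AugIdx m p) ℝ} (hΔ : Δ.PosDef)
    (hdet : IsUnit ((popGamma F₀ g θW)ᵀ * Δ * popGamma F₀ g θW).det)
    {θME : ℕ → Ω → EuclideanSpace ℝ (Fin p)}
    (hmin : ∀ᵐ ω ∂P, ∀ n, 0 < n →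
      IsArgminOn (meObjective F₀ g θW Δ (sample X n ω)) Θ (θME n ω)) {ε : ℝ} (hε : 0 < ε) :
    ∀ᵐ ω ∂P, ∀ᶠ n in atTop,
      ‖(θME n ω - θW) + matrixCLM (((popGamma F₀ g θW)ᵀ * Δ * popGamma F₀ g θW)⁻¹
        * (popGamma F₀ g θW)ᵀ * Δ)
          ((avg (sample X n ω) fun x => augMoment g x θW) - ∫ x, augMoment g x θW ∂F₀)‖
      ≤ ε * ‖(avg (sample X n ω) fun x => augMoment g x θW) - ∫ x, augMoment g x θW ∂F₀‖ := by
  have hsymm : Δᵀ = Δ := by simpa using hΔ.isHermitian.eq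
  obtain ⟨η, hη, hlin⟩ := exists_norm_sub_add_le_of_isLocalMin (matrixCLM (popGamma F₀ g θW))
    (matrixCLM Δ) _ (inv_apply_adjoint_apply_self hdet) hε
  obtain ⟨r, hr, hrΘ⟩ := h.exists_closedBall_subset
  have hB : CompactSpace (Metric.closedBall θW r) :=
    isCompact_iff_compactSpace.1 (isCompact_closedBall _ _)
  -- One half of η is spent on the population derivative against Γ, the other on the sample
  -- derivative against the population derivative.
  obtain ⟨ρ, hρ, hρr, hpop⟩ := h.exists_closedBall_norm_integral_fderiv_sub_le hr hrΘ
    (half_pos hη)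
  have hcont := h.continuousOn_fderiv_augMoment (hrΘ.trans interior_subset)
  have hint := h.integrable_restrictMap_fderiv_augMoment hrΘ
  filter_upwards [hmin, h.tendsto_me_ae hunique hΔ hmin, ae_forall_sample h.law h.smooth,
    tendstoUniformlyOn_avg_sample_ae (φ := fun x => fderiv ℝ (augMoment g x)) h.indep h.law
      hcont hint] with ω h1 h2 h3 h4
  have hsub : Metric.closedBall θW ρ ⊆ Metric.closedBall θW r := Metric.closedBall_subset_closedBall
    hρr
  filter_upwards [eventually_gt_atTop 0, h2.eventually (Metric.closedBall_mem_nhds θW hρ),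
    Metric.tendstoUniformlyOn_iff.1 h4 (η / 2) (half_pos hη)] with n hn hball hder
  have harg := h1 n hn
  rw [meObjective_eq hn] at harg
  rw [← inv_apply_adjoint_apply_eq]
  refine hlin θW ρ (fun t => (avg (sample X n ω) fun x => augMoment g x t)
      - ∫ x, augMoment g x θW ∂F₀)
    (fun t => avg (sample X n ω) fun x => fderiv ℝ (augMoment g x) t) (matrixCLM Δ) θW (θME n ω)
    ?_ ?_ (by simpa using hη.le) (inner_matrixCLM_symm hsymm) (Metric.mem_closedBall_self hρ.le)
    hball (isLocalMin_inner_of_isArgminOn harg (hrΘ (hsub hball)))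
  · intro u hu
    refine (hasFDerivAt_avg (sample X n ω) fun i => ?_).sub_const _
    exact (contDiffAt_augMoment (h3 i u (interior_subset (hrΘ (hsub hu))))).differentiableAt
      (by norm_num)
  · intro u hu
    have a1 := hder u (hsub hu)
    rw [dist_comm, dist_eq_norm] at a1
    have a2 := norm_sub_le_norm_sub_add_norm_sub
      (avg (sample X n ω) fun x => fderiv ℝ (augMoment g x) u)
      (∫ x, fderiv ℝ (augMoment g x) u ∂F₀) (matrixCLM (popGamma F₀ g θW))
    linarith [hpop u hu]

/-- Asymptotic normality of the ME-GMM estimator. -/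
theorem tendstoInDistribution_me [IsProbabilityMeasure P] (h : GMMAssumptions P F₀ X g Θ W θW)
    (hunique : ∀ θ ∈ Θ, ∫ x, recentered F₀ g θW x θ ∂F₀ = 0 ↔ θ = θW)
    {Δ : Matrix (AugIdx m p) (AugIdx m p) ℝ} (hΔ : Δ.PosDef)
    (hdet : IsUnit ((popGamma F₀ g θW)ᵀ * Δ * popGamma F₀ g θW).det)
    {θME : ℕ → Ω → EuclideanSpace ℝ (Fin p)} (hmeas : ∀ n, AEMeasurable (θME n) P)
    (hmin : ∀ n, 0 < n → ∀ᵐ ω ∂P,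
      IsArgminOn (meObjective F₀ g θW Δ (sample X n ω)) Θ (θME n ω)) :
    TendstoInDistribution (fun (n : ℕ) ω => √(n : ℝ) • (θME n ω - θW)) atTop id (fun _ => P)
      (multivariateGaussian 0 (sandwich (popGamma F₀ g θW) Δ (popSigma F₀ g θW))) := by
  have hmin' : ∀ᵐ ω ∂P, ∀ n, 0 < n →
      IsArgminOn (meObjective F₀ g θW Δ (sample X n ω)) Θ (θME n ω) :=
    ae_all_iff.2 fun n => by
      by_cases hn : 0 < n
      · filter_upwards [hmin n hn] with ω hω _ using hω
      · exact Eventually.of_forall fun ω hn' => absurd hn' hn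
  have hF := h.isProbabilityMeasure_law
  have hsymm : Δᵀ = Δ := by simpa using hΔ.isHermitian.eq
  have hclt := tendstoInDistribution_sqrt_avg_sample h.indep h.law h.memLp_augMoment
  set c : EuclideanSpace ℝ (AugIdx m p) := ∫ x, augMoment g x θW ∂F₀ with hc
  set M := -(((popGamma F₀ g θW)ᵀ * Δ * popGamma F₀ g θW)⁻¹ * (popGamma F₀ g θW)ᵀ * Δ) with hM
  set Z : ℕ → Ω → EuclideanSpace ℝ (AugIdx m p) := fun n ω =>
    √(n : ℝ) • ((avg (sample X n ω) fun x => augMoment g x θW) - c) with hZ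
  have hξ : ∀ n : ℕ, AEMeasurable (fun ω => √(n : ℝ) • (θME n ω - θW)) P := fun n =>
    ((hmeas n).sub_const θW).const_smul (√(n : ℝ))
  have hZm : ∀ n, AEMeasurable (Z n) P := hclt.forall_aemeasurable
  have hZlim : ∀ f : EuclideanSpace ℝ (AugIdx m p) →ᵇ ℝ, Tendsto (fun n => ∫ ω, f (Z n ω) ∂P)
      atTop (𝓝 (∫ y, f y ∂(multivariateGaussian 0 (popSigma F₀ g θW)))) := fun f => by
    have h1 := (ProbabilityMeasure.tendsto_iff_forall_integral_tendsto.1 hclt.tendsto) f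
    simp only [ProbabilityMeasure.coe_mk, Measure.map_id] at h1
    refine h1.congr fun n => ?_
    exact integral_map (hZm n) f.continuous.measurable.aestronglyMeasurable
  have htight := tight_of_tendsto_integral_normCutoff (fun _ : ℕ => P)
    (multivariateGaussian 0 (popSigma F₀ g θW)) hZm fun M => hZlim _
  -- The linearization bound is homogeneous, so both sides may be multiplied by √n; a prior rate of
  -- convergence for the estimator is not needed.
  have hneg : ∀ ε : ℝ, 0 < ε → Tendsto (fun n : ℕ => P {ω | ¬ ‖√(n : ℝ) • (θME n ω - θW)
      - matrixCLM M (Z n ω)‖ ≤ ε * ‖Z n ω‖}) atTop (𝓝 0) := by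
    intro ε hε
    refine tendsto_measure_of_ae_eventually_notMem (fun n => ?_) ?_
    · have e1 : AEMeasurable (fun ω => matrixCLM M (Z n ω)) P :=
        (matrixCLM M).continuous.measurable.comp_aemeasurable (hZm n)
      exact (nullMeasurableSet_le ((hξ n).sub e1).norm ((hZm n).norm.const_mul ε)).compl
    · filter_upwards [h.eventually_norm_me_sub_le hunique hΔ hdet hmin' hε] with ω hω
      filter_upwards [hω] with n hn
      simp only [not_not]
      have e : √(n : ℝ) • (θME n ω - θW) - matrixCLM M (Z n ω)
          = √(n : ℝ) • ((θME n ω - θW) + matrixCLM (((popGamma F₀ g θW)ᵀ * Δ *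
            popGamma F₀ g θW)⁻¹ * (popGamma F₀ g θW)ᵀ * Δ)
              ((avg (sample X n ω) fun x => augMoment g x θW) - c)) := by
        have : ∀ v, matrixCLM M v = - matrixCLM (((popGamma F₀ g θW)ᵀ * Δ *
            popGamma F₀ g θW)⁻¹ * (popGamma F₀ g θW)ᵀ * Δ) v := fun v => by
          simp [hM, matrixCLM]
        rw [this, hZ, map_smul, sub_neg_eq_add, smul_add]
      rw [e, norm_smul, hZ, norm_smul, mul_left_comm]
      gcongr
  refine ⟨hξ, aemeasurable_id, ProbabilityMeasure.tendsto_iff_forall_integral_tendsto.2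
    fun f => ?_⟩
  simp only [ProbabilityMeasure.coe_mk, Measure.map_id]
  have h1 := tendsto_integral_sub_of_negligible (fun _ : ℕ => P) (matrixCLM M) hZm hξ hneg htight f
  have h2 := hZlim (f.compContinuous ⟨matrixCLM M, (matrixCLM M).continuous⟩)
  have h3 := h1.add h2
  have hmap : (multivariateGaussian 0 (popSigma F₀ g θW)).map (matrixCLM M)
      = multivariateGaussian 0 (sandwich (popGamma F₀ g θW) Δ (popSigma F₀ g θW)) := by
    rw [map_multivariateGaussian_matrixCLM h.posSemidef_popSigma, hM,
      mul_mul_transpose_eq_sandwich _ hsymm]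
  rw [← hmap, integral_map (matrixCLM M).continuous.measurable.aemeasurable
    f.continuous.measurable.aestronglyMeasurable]
  rw [zero_add] at h3
  refine h3.congr fun n => ?_
  rw [integral_map (hξ n) f.continuous.measurable.aestronglyMeasurable]
  simp

end GMMAssumptions

end GMM

/-! ### Test functions of one-dimensional projections -/

section TestFunctions

variable {E : Type*} [NormedAddCommGroup E] [InnerProductSpace ℝ E]

/-- The test function `x ↦ cos (t ⟪x, u⟫)`. -/
noncomputable def cosInner (u : E) (t : ℝ) : E →ᵇ ℝ :=
  BoundedContinuousFunction.ofNormedAddCommGroup (fun x => Real.cos (t * inner ℝ x u))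
    (by fun_prop) 1 fun x => by simpa using Real.abs_cos_le_one _

/-- The test function `x ↦ sin (t ⟪x, u⟫)`. -/
noncomputable def sinInner (u : E) (t : ℝ) : E →ᵇ ℝ :=
  BoundedContinuousFunction.ofNormedAddCommGroup (fun x => Real.sin (t * inner ℝ x u))
    (by fun_prop) 1 fun x => by simpa using Real.abs_sin_le_one _

/-- The test function `x ↦ min 2 (t² ⟪x, u⟫² / 2)`. -/
noncomputable def minSqInner (u : E) (t : ℝ) : E →ᵇ ℝ :=
  BoundedContinuousFunction.ofNormedAddCommGroup (fun x => min 2 (t ^ 2 * inner ℝ x u ^ 2 / 2))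
    (by fun_prop) 2 fun x => by
      rw [Real.norm_of_nonneg (le_min (by norm_num) (by positivity))]
      exact min_le_left _ _

theorem cosInner_apply (u : E) (t : ℝ) (x : E) :
    cosInner u t x = Real.cos (t * inner ℝ x u) := rfl

theorem sinInner_apply (u : E) (t : ℝ) (x : E) :
    sinInner u t x = Real.sin (t * inner ℝ x u) := rfl

theorem minSqInner_apply (u : E) (t : ℝ) (x : E) :
    minSqInner u t x = min 2 (t ^ 2 * inner ℝ x u ^ 2 / 2) := rfl

theorem integrable_exp_inner [MeasurableSpace E] [OpensMeasurableSpace E]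
    [SecondCountableTopology E] (ν : Measure E) [IsFiniteMeasure ν] (u : E) (t : ℝ) :
    Integrable (fun x => Complex.exp ((t * inner ℝ x u : ℝ) * Complex.I)) ν := by
  refine Integrable.of_bound (C := 1) ?_ (Eventually.of_forall fun x => ?_)
  · exact Continuous.aestronglyMeasurable (by fun_prop)
  · rw [Complex.norm_exp_ofReal_mul_I]

end TestFunctions

section Gaussian

variable {ι : Type*} [Fintype ι] [DecidableEq ι] {S : Matrix ι ι ℝ}

theorem integral_exp_inner_multivariateGaussian (hS : S.PosSemidef) (u : EuclideanSpace ℝ ι)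
    (t : ℝ) : ∫ x, Complex.exp ((t * inner ℝ x u : ℝ) * Complex.I) ∂(multivariateGaussian 0 S)
      = (Real.exp (-(t ^ 2 * quadForm S u) / 2) : ℝ) := by
  have h := charFun_multivariateGaussian (μ := 0) hS (t • u)
  rw [charFun_apply] at h
  simp only [inner_smul_right] at h
  rw [h]
  push_cast
  congr 1
  simp [quadForm, Matrix.mulVec_smul]
  ring

theorem integral_cosInner_multivariateGaussian (hS : S.PosSemidef) (u : EuclideanSpace ℝ ι)
    (t : ℝ) : ∫ x, cosInner u t x ∂(multivariateGaussian 0 S)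
      = Real.exp (-(t ^ 2 * quadForm S u) / 2) := by
  have h := congrArg Complex.re (integral_exp_inner_multivariateGaussian hS u t)
  rw [Complex.ofReal_re, ← RCLike.re_eq_complex_re,
    ← integral_re (integrable_exp_inner _ u t)] at h
  rw [← h]
  refine integral_congr_ae (Eventually.of_forall fun x => ?_)
  simp only [cosInner_apply, RCLike.re_eq_complex_re, Complex.exp_ofReal_mul_I_re]

theorem integral_sinInner_multivariateGaussian (hS : S.PosSemidef) (u : EuclideanSpace ℝ ι)
    (t : ℝ) : ∫ x, sinInner u t x ∂(multivariateGaussian 0 S) = 0 := by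
  have h := congrArg Complex.im (integral_exp_inner_multivariateGaussian hS u t)
  rw [Complex.ofReal_im, ← RCLike.im_eq_complex_im,
    ← integral_im (integrable_exp_inner _ u t)] at h
  rw [← h]
  refine integral_congr_ae (Eventually.of_forall fun x => ?_)
  simp only [sinInner_apply, RCLike.im_eq_complex_im, Complex.exp_ofReal_mul_I_im]

/-- Dropping the truncation leaves half the Gaussian variance of the scaled projection. For small t
this supplies the smallness that bounds the bootstrap increments. -/
theorem integral_minSqInner_multivariateGaussian_le (hS : S.PosSemidef)
    (u : EuclideanSpace ℝ ι) (t : ℝ) :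
    ∫ x, minSqInner u t x ∂(multivariateGaussian 0 S) ≤ t ^ 2 * quadForm S u / 2 := by
  have hL : MemLp (id : EuclideanSpace ℝ ι → EuclideanSpace ℝ ι) 2 (multivariateGaussian 0 S) :=
    IsGaussian.memLp_two_id
  have hu : MemLp (fun x => inner ℝ x u) 2 (multivariateGaussian 0 S) :=
    hL.inner_const u
  have hmean : ∫ x, inner ℝ u x ∂(multivariateGaussian 0 S) = 0 := by
    rw [integral_inner IsGaussian.integrable_fun_id, integral_id_multivariateGaussian,
      inner_zero_right]
  have hvar : ∫ x, inner ℝ x u ^ 2 ∂(multivariateGaussian 0 S) = quadForm S u := by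
    have h1 := covarianceBilin_multivariateGaussian (μ := 0) hS u u
    rw [covarianceBilin_self IsGaussian.memLp_two_id, variance_of_integral_eq_zero
      (by fun_prop) hmean] at h1
    simp only [real_inner_comm u]
    exact h1
  calc ∫ x, minSqInner u t x ∂(multivariateGaussian 0 S)
      ≤ ∫ x, t ^ 2 / 2 * inner ℝ x u ^ 2 ∂(multivariateGaussian 0 S) := by
        refine integral_mono ((minSqInner u t).integrable _) (hu.integrable_sq.const_mul _)
          fun x => ?_
        simp only [minSqInner_apply]
        exact (min_le_right _ _).trans_eq (by ring)
    _ = t ^ 2 * quadForm S u / 2 := by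
        rw [integral_const_mul, hvar]; ring

end Gaussian

/-! ### The sample covariance matrix -/

section SampleSigma

/-- The sample covariance is a population covariance for the uniform law on the indices, so the
covariance identities proved for general laws apply to it. -/
theorem sampleSigma_eq {𝒳 : Type*} {m p n : ℕ} (hn : 0 < n)
    (g : 𝒳 → EuclideanSpace ℝ (Fin p) → EuclideanSpace ℝ (Fin m)) (x : Fin n → 𝒳)
    (t : EuclideanSpace ℝ (Fin p)) :
    sampleSigma g x t = covMatrix (uniformOn Set.univ) fun i => augMoment g (x i) t := by
  ext a b
  simp only [sampleSigma, covMatrix, Matrix.of_apply, integral_uniformOn_fin hn]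
  rfl

theorem memLp_uniformOn_fin {n : ℕ} (hn : 0 < n) {E : Type*} [NormedAddCommGroup E]
    (f : Fin n → E) (q : ℝ≥0∞) : MemLp f q (uniformOn (Set.univ : Set (Fin n))) := by
  have := isProbabilityMeasure_uniformOn_fin (⟨0, hn⟩ : Fin n)
  refine MemLp.of_bound (C := ∑ i, ‖f i‖) ?_ (Eventually.of_forall fun i => ?_)
  · exact (StronglyMeasurable.of_discrete).aestronglyMeasurable
  · exact Finset.single_le_sum (f := fun i => ‖f i‖) (fun i _ => norm_nonneg _) (Finset.mem_univ i)

theorem quadForm_sampleSigma {𝒳 : Type*} {m p n : ℕ} (hn : 0 < n)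
    (g : 𝒳 → EuclideanSpace ℝ (Fin p) → EuclideanSpace ℝ (Fin m)) (x : Fin n → 𝒳)
    (t : EuclideanSpace ℝ (Fin p)) (u : EuclideanSpace ℝ (AugIdx m p)) :
    quadForm (sampleSigma g x t) u = (n : ℝ)⁻¹ * ∑ i,
      (inner ℝ (augMoment g (x i) t - avg x fun y => augMoment g y t) u) ^ 2 := by
  have := isProbabilityMeasure_uniformOn_fin (⟨0, hn⟩ : Fin n)
  rw [sampleSigma_eq hn, quadForm, dotProduct_covMatrix_mulVec (memLp_uniformOn_fin hn _ _),
    variance_eq_integral (AEMeasurable.of_discrete), integral_uniformOn_fin hn,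
    integral_uniformOn_fin hn, smul_eq_mul]
  simp only [avg, inner_sub_left, inner_smul_left, sum_inner, smul_eq_mul]
  simp

theorem transpose_sampleSigma {𝒳 : Type*} {m p n : ℕ}
    (g : 𝒳 → EuclideanSpace ℝ (Fin p) → EuclideanSpace ℝ (Fin m)) (x : Fin n → 𝒳)
    (t : EuclideanSpace ℝ (Fin p)) : (sampleSigma g x t)ᵀ = sampleSigma g x t := by
  ext a b
  simp only [sampleSigma, Matrix.transpose_apply, Matrix.of_apply, mul_comm]

theorem quadForm_single_add_single {ι : Type*} [Fintype ι] [DecidableEq ι] (A : Matrix ι ι ℝ)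
    (a b : ι) : quadForm A (EuclideanSpace.single a 1 + EuclideanSpace.single b 1)
      = A a a + A a b + (A b a + A b b) := by
  simp [quadForm, Matrix.mulVec_add, add_dotProduct]
  ring

/-- Convergence of symmetric matrices from convergence of quadratic forms. -/
theorem tendsto_matrix_of_tendsto_quadForm {ι : Type*} [Fintype ι] [DecidableEq ι]
    {A : ℕ → Matrix ι ι ℝ} {B : Matrix ι ι ℝ} (hA : ∀ j, (A j)ᵀ = A j) (hB : Bᵀ = B)
    (h : ∀ a b, Tendsto
      (fun j => quadForm (A j) (EuclideanSpace.single a 1 + EuclideanSpace.single b 1)) atTop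
      (𝓝 (quadForm B (EuclideanSpace.single a 1 + EuclideanSpace.single b 1)))) :
    Tendsto A atTop (𝓝 B) := by
  -- Polarization. The case a = b uses the direction 2e_a, whose quadratic form is 4 C a a; hence
  -- the divisions by 4.
  have key : ∀ {C : Matrix ι ι ℝ}, Cᵀ = C → ∀ a b, C a b
      = (quadForm C (EuclideanSpace.single a 1 + EuclideanSpace.single b 1)
        - quadForm C (EuclideanSpace.single a 1 + EuclideanSpace.single a 1) / 4
        - quadForm C (EuclideanSpace.single b 1 + EuclideanSpace.single b 1) / 4) / 2 := by
    intro C hC a b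
    have : C b a = C a b := congrFun (congrFun hC a) b
    simp only [quadForm_single_add_single, this]
    ring
  refine tendsto_pi_nhds.2 fun a => tendsto_pi_nhds.2 fun b => ?_
  rw [key hB a b]
  refine (((h a b).sub ((h a a).div_const 4)).sub ((h b b).div_const 4)).div_const 2 |>.congr
    fun j => ?_
  exact (key (hA j) a b).symm

/-- The inverse is the adjugate divided by the determinant. Individual `A j` may be singular, since
only the limiting determinant has to be nonzero. -/
theorem tendsto_matrix_inv {ι : Type*} [Fintype ι] [DecidableEq ι] {A : ℕ → Matrix ι ι ℝ}
    {B : Matrix ι ι ℝ} (hB : IsUnit B.det) (h : Tendsto A atTop (𝓝 B)) :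
    Tendsto (fun j => (A j)⁻¹) atTop (𝓝 B⁻¹) := by
  simp only [Matrix.inv_def, Ring.inverse_eq_inv']
  have h1 : Tendsto (fun j => (A j).det) atTop (𝓝 B.det) :=
    ((continuous_id.matrix_det).tendsto B).comp h
  have h2 : Tendsto (fun j => (A j).adjugate) atTop (𝓝 B.adjugate) :=
    ((continuous_id.matrix_adjugate).tendsto B).comp h
  exact (h1.inv₀ hB.ne_zero).smul h2

/-- A bootstrap central limit theorem forces the sample covariance matrix to converge. -/
theorem tendsto_sampleSigma_of_boot_clt {𝒳 : Type*} {m p : ℕ} {N : ℕ → ℕ}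
    (hN : Tendsto N atTop atTop) (hN0 : ∀ j, 0 < N j)
    {g : 𝒳 → EuclideanSpace ℝ (Fin p) → EuclideanSpace ℝ (Fin m)} {x : ∀ j, Fin (N j) → 𝒳}
    {s : ℕ → EuclideanSpace ℝ (Fin p)} {S : Matrix (AugIdx m p) (AugIdx m p) ℝ}
    (hS : S.PosSemidef)
    (hclt : ∀ (a b : AugIdx m p) (k : ℕ), ∀ f ∈ ({
        cosInner (EuclideanSpace.single a 1 + EuclideanSpace.single b 1) (k : ℝ)⁻¹,
        sinInner (EuclideanSpace.single a 1 + EuclideanSpace.single b 1) (k : ℝ)⁻¹,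
        minSqInner (EuclideanSpace.single a 1 + EuclideanSpace.single b 1) (k : ℝ)⁻¹} :
          Set (EuclideanSpace ℝ (AugIdx m p) →ᵇ ℝ)),
      Tendsto (fun j => ∫ I, f (√(N j : ℝ) • ((avg (x j ∘ I) fun y => augMoment g y (s j))
        - avg (x j) fun y => augMoment g y (s j))) ∂(bootMeasure (N j))) atTop
        (𝓝 (∫ y, f y ∂(multivariateGaussian 0 S)))) :
    Tendsto (fun j => sampleSigma g (x j) (s j)) atTop (𝓝 S) := by
  have hsymm : Sᵀ = S := by simpa using hS.isHermitian.eq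
  refine tendsto_matrix_of_tendsto_quadForm (fun j => transpose_sampleSigma _ _ _) hsymm
    fun a b => ?_
  set u : EuclideanSpace ℝ (AugIdx m p) :=
    EuclideanSpace.single a 1 + EuclideanSpace.single b 1 with hu
  -- The empirical variance of these centered projections is the quadratic form of the sample
  -- covariance at u, and their bootstrap sum is the projection of the normalized bootstrap
  -- deviation.
  let c : ∀ j, Fin (N j) → ℝ := fun j i =>
    inner ℝ (augMoment g (x j i) (s j) - avg (x j) fun y => augMoment g y (s j)) u
  have hNr : ∀ j, (N j : ℝ) ≠ 0 := fun j => by exact_mod_cast (hN0 j).ne'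
  have hsum : ∀ j, ∑ i, augMoment g (x j i) (s j)
      = (N j : ℝ) • avg (x j) fun y => augMoment g y (s j) := fun j => by
    rw [avg, smul_inv_smul₀ (hNr j)]
  have hc : ∀ j, ∑ i, c j i = 0 := fun j => by
    simp only [c, ← sum_inner, Finset.sum_sub_distrib, hsum, Finset.sum_const, Finset.card_univ,
      Fintype.card_fin, ← Nat.cast_smul_eq_nsmul ℝ, sub_self, inner_zero_left]
  have hboot : ∀ j (I : Fin (N j) → Fin (N j)), inner ℝ (√(N j : ℝ) •
      ((avg (x j ∘ I) fun y => augMoment g y (s j))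
        - avg (x j) fun y => augMoment g y (s j))) u = bootSum (c j) I := fun j I => by
    have e : (√(N j : ℝ))⁻¹ = √(N j : ℝ) * (N j : ℝ)⁻¹ := by
      rw [← div_eq_mul_inv, Real.sqrt_div_self]
    rw [bootSum, ← avg_sub_const (hN0 j), avg, smul_smul, inner_smul_left, sum_inner, e]
    rfl
  have h1 := fun k => hclt a b k _ (Or.inl rfl)
  have h2 := fun k => hclt a b k _ (Or.inr (Or.inl rfl))
  have h3 := fun k => hclt a b k _ (Or.inr (Or.inr rfl))
  simp only [cosInner_apply, ← hu, hboot] at h1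
  simp only [sinInner_apply, ← hu, hboot] at h2
  simp only [minSqInner_apply, ← hu, hboot] at h3
  have key := tendsto_variance_of_boot_clt hN (c := c) hc (v := quadForm S u)
    (L := fun k => ∫ y, minSqInner u (k : ℝ)⁻¹ y ∂(multivariateGaussian 0 S))
    (fun k _ => ?_) (fun k _ => ?_)
    (fun k => integral_minSqInner_multivariateGaussian_le hS u _) (fun k _ => h3 k)
  · refine key.congr fun j => ?_
    rw [quadForm_sampleSigma (hN0 j)]
  · rw [← integral_cosInner_multivariateGaussian hS]
    exact h1 k
  · rw [← integral_sinInner_multivariateGaussian hS u (k : ℝ)⁻¹]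
    exact h2 k

end SampleSigma

/-! ### The bootstrap estimator -/

section Bootstrap

theorem bootObjective_eq {𝒳 : Type*} {m p n : ℕ} (hn : 0 < n)
    (g : 𝒳 → EuclideanSpace ℝ (Fin p) → EuclideanSpace ℝ (Fin m)) (x : Fin n → 𝒳)
    (t : EuclideanSpace ℝ (Fin p)) (I : Fin n → Fin n) :
    bootObjective g x t I = fun θ => quadForm (sampleSigma g x t)⁻¹
      ((avg (x ∘ I) fun y => augMoment g y θ) - avg x fun z => augMoment g z t) := by
  ext θ
  rw [bootObjective, avg_sub_const hn]

theorem bootMeasure_le_bootDeviation_div {𝒳 B : Type*} [NormedAddCommGroup B] [NormedSpace ℝ B]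
    {n : ℕ} (x : Fin n → 𝒳) (Φ : 𝒳 → B) {η : ℝ} (hη : 0 < η) :
    bootMeasure n {I | η < ‖avg (x ∘ I) Φ - avg x Φ‖} ≤ ENNReal.ofReal (bootDeviation x Φ / η) := by
  rw [← ofReal_measureReal]
  refine ENNReal.ofReal_le_ofReal ((le_div_iff₀ hη).2 ?_)
  have h := mul_meas_ge_le_integral_of_nonneg (μ := bootMeasure n)
    (f := fun I => ‖avg (x ∘ I) Φ - avg x Φ‖) (Eventually.of_forall fun I => norm_nonneg _)
    Integrable.of_finite η
  rw [mul_comm]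
  exact le_trans (mul_le_mul_of_nonneg_left
    (measureReal_mono (fun I (hI : η < _) => hI.le) (measure_ne_top _ _)) hη.le) h

/-- The thresholds 1/(k+1) suffice for all ρ > 0, so bootstrap consistency is a countable condition
that can be realized along one subsequence. -/
theorem tendsto_bootMeasure_lt_norm {E : Type*} [NormedAddCommGroup E] {N : ℕ → ℕ}
    {v : ∀ j, (Fin (N j) → Fin (N j)) → E}
    (h : ∀ k : ℕ, Tendsto (fun j => bootMeasure (N j)
      {I | ENNReal.ofReal (1 / ((k : ℝ) + 1)) < ‖v j I‖ₑ}) atTop (𝓝 0)) {ρ : ℝ} (hρ : 0 < ρ) :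
    Tendsto (fun j => bootMeasure (N j) {I | ρ < ‖v j I‖}) atTop (𝓝 0) := by
  obtain ⟨k, hk⟩ := exists_nat_one_div_lt hρ
  refine tendsto_of_tendsto_of_tendsto_of_le_of_le tendsto_const_nhds (h k)
    (fun _ => zero_le) fun j => measure_mono fun I hI => ?_
  change ENNReal.ofReal _ < _
  rw [← ofReal_norm]
  exact (ENNReal.ofReal_lt_ofReal_iff_of_nonneg (by positivity)).2 (hk.trans hI)

variable {Ω 𝒳 : Type*} [MeasurableSpace Ω] [MeasurableSpace 𝒳] {m p : ℕ} {P : Measure Ω}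
  {F₀ : Measure 𝒳} {X : ℕ → Ω → 𝒳}
  {g : 𝒳 → EuclideanSpace ℝ (Fin p) → EuclideanSpace ℝ (Fin m)}
  {Θ : Set (EuclideanSpace ℝ (Fin p))} {W : Matrix (Fin m) (Fin m) ℝ}
  {θW : EuclideanSpace ℝ (Fin p)}

namespace GMMAssumptions

/-- Linearization of the bootstrap estimator along a sequence of samples. -/
theorem tendsto_bootMeasure_linearization (h : GMMAssumptions P F₀ X g Θ W θW)
    (hS : IsUnit (popSigma F₀ g θW).det)
    (hdet : IsUnit ((popGamma F₀ g θW)ᵀ * (popSigma F₀ g θW)⁻¹ * popGamma F₀ g θW).det)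
    {r : ℝ} (hr : 0 < r) (hrΘ : Metric.closedBall θW r ⊆ _root_.interior Θ)
    [CompactSpace (Metric.closedBall θW r)]
    {N : ℕ → ℕ} (hN0 : ∀ j, 0 < N j) {x : ∀ j, Fin (N j) → 𝒳}
    {s : ℕ → EuclideanSpace ℝ (Fin p)} {t : ∀ j, (Fin (N j) → Fin (N j)) → EuclideanSpace ℝ (Fin p)}
    (hsmooth : ∀ j i, ∀ u ∈ Θ, ContDiffAt ℝ 2 (g (x j i)) u)
    (hcont : ∀ j i, ContinuousOn (fderiv ℝ (augMoment g (x j i))) (Metric.closedBall θW r))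
    (hs : Tendsto s atTop (𝓝 θW))
    (hder : TendstoUniformlyOn (fun j u => avg (x j) fun y => fderiv ℝ (augMoment g y) u)
      (fun u => ∫ y, fderiv ℝ (augMoment g y) u ∂F₀) atTop (Metric.closedBall θW r))
    (hdev : Tendsto (fun j => bootDeviation (x j)
      (restrictMap (Metric.closedBall θW r) fun y => fderiv ℝ (augMoment g y))) atTop (𝓝 0))
    (hV : Tendsto (fun j => sampleSigma g (x j) (s j)) atTop (𝓝 (popSigma F₀ g θW)))
    (harg : ∀ j I, IsArgminOn (bootObjective g (x j) (s j) I) Θ (t j I))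
    (hcons : ∀ ρ : ℝ, 0 < ρ →
      Tendsto (fun j => bootMeasure (N j) {I | ρ < ‖t j I - θW‖}) atTop (𝓝 0))
    {ε : ℝ} (hε : 0 < ε) :
    Tendsto (fun j => bootMeasure (N j) {I | ¬ ‖(t j I - s j)
      + matrixCLM (((popGamma F₀ g θW)ᵀ * (popSigma F₀ g θW)⁻¹ * popGamma F₀ g θW)⁻¹
        * (popGamma F₀ g θW)ᵀ * (popSigma F₀ g θW)⁻¹)
          ((avg (x j ∘ I) fun y => augMoment g y (s j)) - avg (x j) fun y => augMoment g y (s j))‖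
      ≤ ε * ‖(avg (x j ∘ I) fun y => augMoment g y (s j))
          - avg (x j) fun y => augMoment g y (s j)‖}) atTop (𝓝 0) := by
  obtain ⟨η, hη, hlin⟩ := exists_norm_sub_add_le_of_isLocalMin (matrixCLM (popGamma F₀ g θW))
    (matrixCLM (popSigma F₀ g θW)⁻¹) _ (inv_apply_adjoint_apply_self hdet) hε
  -- Three comparisons share η: population derivative with Γ, sample with population, and bootstrap
  -- with sample.
  have hη3 : 0 < η / 3 := by positivity
  obtain ⟨ρ, hρ, hρr, hpop⟩ := h.exists_closedBall_norm_integral_fderiv_sub_le hr hrΘ hη3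
  have hsub : Metric.closedBall θW ρ ⊆ Metric.closedBall θW r :=
    Metric.closedBall_subset_closedBall hρr
  set Φ := restrictMap (Metric.closedBall θW r) fun y => fderiv ℝ (augMoment g y) with hΦ
  have hlim : Tendsto (fun j => bootMeasure (N j) {I | ρ < ‖t j I - θW‖}
      + ENNReal.ofReal (bootDeviation (x j) Φ / (η / 3))) atTop (𝓝 0) := by
    have h1 := (ENNReal.continuous_ofReal.tendsto _).comp (hdev.div_const (η / 3))
    simpa using (hcons ρ hρ).add h1
  refine tendsto_of_tendsto_of_tendsto_of_le_of_le' tendsto_const_nhds hlim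
    (Eventually.of_forall fun _ => zero_le) ?_
  filter_upwards [hs.eventually (Metric.closedBall_mem_nhds θW hρ),
    Metric.tendstoUniformlyOn_iff.1 hder (η / 3) hη3,
    Metric.tendsto_nhds.1 (tendsto_matrix_inv hS hV) η hη] with j hsj hderj hVj
  -- For large j the linearization can fail only if the minimizer leaves the ball or the bootstrap
  -- derivative deviates uniformly. The second event is bounded by Markov's inequality.
  refine (measure_mono (t := {I | ρ < ‖t j I - θW‖} ∪ {I | η / 3 < ‖avg (x j ∘ I) Φ - avg (x j) Φ‖})
    fun I hI => ?_).trans ((measure_union_le _ _).trans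
      (add_le_add_right (bootMeasure_le_bootDeviation_div (x j) Φ hη3) _))
  by_contra hbad
  simp only [Set.mem_union, Set.mem_ofPred_eq, not_or, not_lt] at hbad
  obtain ⟨hball, hdevI⟩ := hbad
  refine hI ?_
  have htball : t j I ∈ Metric.closedBall θW ρ := by rwa [mem_closedBall_iff_norm]
  have harg' := harg j I
  rw [bootObjective_eq (hN0 j)] at harg'
  have hdiff : ∀ i, ∀ u ∈ Metric.closedBall θW ρ, DifferentiableAt ℝ (augMoment g (x j i)) u :=
    fun i u hu => (contDiffAt_augMoment (hsmooth j i u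
      (interior_subset (hrΘ (hsub hu))))).differentiableAt (by norm_num)
  rw [← inv_apply_adjoint_apply_eq]
  refine hlin θW ρ (fun u => (avg (x j ∘ I) fun y => augMoment g y u)
      - avg (x j) fun y => augMoment g y (s j))
    (fun u => avg (x j ∘ I) fun y => fderiv ℝ (augMoment g y) u)
    (matrixCLM (sampleSigma g (x j) (s j))⁻¹) (s j) (t j I) ?_ ?_ ?_
    (inner_matrixCLM_symm ?_) hsj htball
    (isLocalMin_inner_of_isArgminOn harg' (hrΘ (hsub htball)))
  · intro u hu
    exact (hasFDerivAt_avg (x j ∘ I) fun i => hdiff (I i) u hu).sub_const _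
  · intro u hu
    have a1 := hderj u (hsub hu)
    rw [dist_comm, dist_eq_norm] at a1
    have a2 := norm_sub_le_norm_sub_add_norm_sub
      (avg (x j) fun y => fderiv ℝ (augMoment g y) u)
      (∫ y, fderiv ℝ (augMoment g y) u ∂F₀) (matrixCLM (popGamma F₀ g θW))
    have a3 := norm_sub_le_norm_sub_add_norm_sub
      (avg (x j ∘ I) fun y => fderiv ℝ (augMoment g y) u)
      (avg (x j) fun y => fderiv ℝ (augMoment g y) u) (matrixCLM (popGamma F₀ g θW))
    have a4 := (avg (x j ∘ I) Φ - avg (x j) Φ).norm_coe_le_norm ⟨u, hsub hu⟩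
    rw [ContinuousMap.sub_apply, avg_restrictMap_apply (φ := fun y => fderiv ℝ (augMoment g y))
      (x j ∘ I) (fun i => hcont j (I i)), avg_restrictMap_apply
      (φ := fun y => fderiv ℝ (augMoment g y)) (x j) (hcont j)] at a4
    linarith [hpop u hu]
  · have e : matrixCLM (sampleSigma g (x j) (s j))⁻¹ - matrixCLM (popSigma F₀ g θW)⁻¹
        = matrixCLM ((sampleSigma g (x j) (s j))⁻¹ - (popSigma F₀ g θW)⁻¹) := by
      simp [matrixCLM]
    rw [e, norm_matrixCLM, ← dist_eq_norm]
    exact hVj.le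
  · rw [Matrix.transpose_nonsing_inv, transpose_sampleSigma]

/-- Asymptotic distribution of the bootstrap estimator along a sequence of samples. -/
theorem tendsto_integral_boot [IsProbabilityMeasure P] (h : GMMAssumptions P F₀ X g Θ W θW)
    (hS : IsUnit (popSigma F₀ g θW).det) {N : ℕ → ℕ}
    {S : ∀ j, (Fin (N j) → Fin (N j)) → EuclideanSpace ℝ (AugIdx m p)}
    {d : ∀ j, (Fin (N j) → Fin (N j)) → EuclideanSpace ℝ (Fin p)}
    (hdet : IsUnit ((popGamma F₀ g θW)ᵀ * (popSigma F₀ g θW)⁻¹ * popGamma F₀ g θW).det)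
    (hlin : ∀ ε : ℝ, 0 < ε → Tendsto (fun j => bootMeasure (N j) {I | ¬ ‖d j I
      + matrixCLM (((popGamma F₀ g θW)ᵀ * (popSigma F₀ g θW)⁻¹ * popGamma F₀ g θW)⁻¹
        * (popGamma F₀ g θW)ᵀ * (popSigma F₀ g θW)⁻¹) (S j I)‖ ≤ ε * ‖S j I‖}) atTop (𝓝 0))
    (hcut : ∀ M : ℕ, Tendsto (fun j => ∫ I, normCutoff _ M (√(N j : ℝ) • S j I)
      ∂(bootMeasure (N j))) atTop
      (𝓝 (∫ y, normCutoff _ M y ∂(multivariateGaussian 0 (popSigma F₀ g θW)))))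
    (f : EuclideanSpace ℝ (Fin p) →ᵇ ℝ)
    (hf : Tendsto (fun j => ∫ I, f (matrixCLM (-(((popGamma F₀ g θW)ᵀ * (popSigma F₀ g θW)⁻¹
        * popGamma F₀ g θW)⁻¹ * (popGamma F₀ g θW)ᵀ * (popSigma F₀ g θW)⁻¹)) (√(N j : ℝ) • S j I))
      ∂(bootMeasure (N j))) atTop
      (𝓝 (∫ y, f (matrixCLM (-(((popGamma F₀ g θW)ᵀ * (popSigma F₀ g θW)⁻¹
        * popGamma F₀ g θW)⁻¹ * (popGamma F₀ g θW)ᵀ * (popSigma F₀ g θW)⁻¹)) y)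
          ∂(multivariateGaussian 0 (popSigma F₀ g θW))))) :
    Tendsto (fun j => ∫ I, f (√(N j : ℝ) • d j I) ∂(bootMeasure (N j))) atTop
      (𝓝 (∫ y, f y ∂(multivariateGaussian 0
        ((popGamma F₀ g θW)ᵀ * (popSigma F₀ g θW)⁻¹ * popGamma F₀ g θW)⁻¹))) := by
  have hsymm : (popSigma F₀ g θW)⁻¹ᵀ = (popSigma F₀ g θW)⁻¹ := by
    rw [Matrix.transpose_nonsing_inv]
    congr 1
    simpa using h.posSemidef_popSigma.isHermitian.eq
  set A := ((popGamma F₀ g θW)ᵀ * (popSigma F₀ g θW)⁻¹ * popGamma F₀ g θW)⁻¹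
        * (popGamma F₀ g θW)ᵀ * (popSigma F₀ g θW)⁻¹ with hA
  have hneg : ∀ ε : ℝ, 0 < ε → Tendsto (fun j => bootMeasure (N j)
      {I | ¬ ‖√(N j : ℝ) • d j I - matrixCLM (-A) (√(N j : ℝ) • S j I)‖
        ≤ ε * ‖√(N j : ℝ) • S j I‖}) atTop (𝓝 0) := by
    intro ε hε
    refine tendsto_of_tendsto_of_tendsto_of_le_of_le tendsto_const_nhds (hlin ε hε)
      (fun _ => zero_le) fun j => measure_mono fun I hI hI' => hI ?_
    have e : √(N j : ℝ) • d j I - matrixCLM (-A) (√(N j : ℝ) • S j I)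
        = √(N j : ℝ) • (d j I + matrixCLM A (S j I)) := by
      have : ∀ v, matrixCLM (-A) v = -matrixCLM A v := fun v => by simp [matrixCLM]
      rw [this, map_smul, sub_neg_eq_add, smul_add]
    rw [e, norm_smul, norm_smul, mul_left_comm]
    gcongr
  have hm : ∀ j, AEMeasurable (fun I => √(N j : ℝ) • S j I) (bootMeasure (N j)) :=
    fun j => AEMeasurable.of_discrete
  have htight := tight_of_tendsto_integral_normCutoff (fun j => bootMeasure (N j))
    (multivariateGaussian 0 (popSigma F₀ g θW)) hm hcut
  have h1 := tendsto_integral_sub_of_negligible (fun j => bootMeasure (N j)) (matrixCLM (-A))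
    hm (ξ := fun j I => √(N j : ℝ) • d j I) (fun j => AEMeasurable.of_discrete) hneg htight f
  have h2 := h1.add hf
  have hmap : (multivariateGaussian 0 (popSigma F₀ g θW)).map (matrixCLM (-A))
      = multivariateGaussian 0
        ((popGamma F₀ g θW)ᵀ * (popSigma F₀ g θW)⁻¹ * popGamma F₀ g θW)⁻¹ := by
    rw [map_multivariateGaussian_matrixCLM h.posSemidef_popSigma, hA,
      mul_mul_transpose_eq_sandwich _ hsymm, sandwich_inv hS hdet]
  rw [← hmap, integral_map (matrixCLM (-A)).continuous.measurable.aemeasurable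
    f.continuous.measurable.aestronglyMeasurable]
  rw [zero_add] at h2
  refine h2.congr fun j => ?_
  ring

end GMMAssumptions

end Bootstrap

/-! ### Bootstrap asymptotics along subsequences and assembly of the theorem -/

section Main

variable {Ω 𝒳 : Type*} [MeasurableSpace Ω] [MeasurableSpace 𝒳] {m p : ℕ} {P : Measure Ω}
  {F₀ : Measure 𝒳} {X : ℕ → Ω → 𝒳}
  {g : 𝒳 → EuclideanSpace ℝ (Fin p) → EuclideanSpace ℝ (Fin m)}
  {Θ : Set (EuclideanSpace ℝ (Fin p))} {W : Matrix (Fin m) (Fin m) ℝ}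
  {θW : EuclideanSpace ℝ (Fin p)}

namespace GMMAssumptions

theorem posDef_popSigma [IsProbabilityMeasure P] (h : GMMAssumptions P F₀ X g Θ W θW)
    (hS : IsUnit (popSigma F₀ g θW).det) : (popSigma F₀ g θW).PosDef :=
  h.posSemidef_popSigma.posDef_iff_isUnit.2 ((Matrix.isUnit_iff_isUnit_det _).2 hS)

/-- Asymptotic normality of the bootstrap ME-GMM estimator. -/
theorem tendstoInBootDistribution_star [IsProbabilityMeasure P]
    (h : GMMAssumptions P F₀ X g Θ W θW) (hS : IsUnit (popSigma F₀ g θW).det)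
    (hdet : IsUnit ((popGamma F₀ g θW)ᵀ * (popSigma F₀ g θW)⁻¹ * popGamma F₀ g θW).det)
    {θGMM : ℕ → Ω → EuclideanSpace ℝ (Fin p)}
    {θstar : (n : ℕ) → Ω → (Fin n → Fin n) → EuclideanSpace ℝ (Fin p)}
    (hθGMM : ∀ n, AEMeasurable (θGMM n) P) (hθstar : ∀ n I, AEMeasurable (fun ω => θstar n ω I) P)
    (hgmm : ∀ n, 0 < n → ∀ᵐ ω ∂P, IsArgminOn (gmmObjective g W (sample X n ω)) Θ (θGMM n ω))
    (hstar : ∀ n, 0 < n → ∀ᵐ ω ∂P, ∀ I,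
      IsArgminOn (bootObjective g (sample X n ω) (θGMM n ω) I) Θ (θstar n ω I))
    (hboot : BootAssumptions P F₀ X g Θ θW θGMM θstar) :
    TendstoInBootDistribution P (fun n ω I => √(n : ℝ) • (θstar n ω I - θGMM n ω))
      (multivariateGaussian 0
        ((popGamma F₀ g θW)ᵀ * (popSigma F₀ g θW)⁻¹ * popGamma F₀ g θW)⁻¹) := by
  intro f
  have hmeas : ∀ n : ℕ, AEStronglyMeasurable
      (fun ω => ∫ I, f (√(n : ℝ) • (θstar n ω I - θGMM n ω)) ∂(bootMeasure n)) P := by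
    intro n
    simp only [integral_fintype Integrable.of_finite]
    refine (Finset.aemeasurable_fun_sum _ fun I _ => ?_).aestronglyMeasurable
    exact (f.continuous.measurable.comp_aemeasurable
      (((hθstar n I).sub (hθGMM n)).const_smul (√(n : ℝ)))).const_mul _
  -- Convergence in probability is checked by extracting an almost surely convergent subsequence
  -- from every subsequence; this permits working with one ω at a time.
  refine (exists_seq_tendstoInMeasure_atTop_iff hmeas).2 fun ns hns => ?_
  set A := ((popGamma F₀ g θW)ᵀ * (popSigma F₀ g θW)⁻¹ * popGamma F₀ g θW)⁻¹
        * (popGamma F₀ g θW)ᵀ * (popSigma F₀ g θW)⁻¹ with hA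
  -- The countable family of test functions used: the given f after the linear map, the cutoffs for
  -- tightness, and the trigonometric and truncated-square functions for the converse central limit
  -- theorem.
  let T : Set (EuclideanSpace ℝ (AugIdx m p) →ᵇ ℝ) :=
    {f.compContinuous ⟨matrixCLM (-A), (matrixCLM (-A)).continuous⟩} ∪
      (Set.range (normCutoff (EuclideanSpace ℝ (AugIdx m p))) ∪
        ⋃ q : AugIdx m p × AugIdx m p × ℕ,
          {cosInner (EuclideanSpace.single q.1 1 + EuclideanSpace.single q.2.1 1) (q.2.2 : ℝ)⁻¹,
           sinInner (EuclideanSpace.single q.1 1 + EuclideanSpace.single q.2.1 1) (q.2.2 : ℝ)⁻¹,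
           minSqInner (EuclideanSpace.single q.1 1 + EuclideanSpace.single q.2.1 1)
            (q.2.2 : ℝ)⁻¹})
  have hTc : T.Countable := (Set.countable_singleton _).union ((Set.countable_range _).union
    (Set.countable_iUnion fun q => (Set.toFinite _).countable))
  have hTc' := hTc.to_subtype
  let Z : (n : ℕ) → Ω → (Fin n → Fin n) → EuclideanSpace ℝ (AugIdx m p) := fun n ω I =>
    √(n : ℝ) • ((avg (sample X n ω ∘ I) fun x => augMoment g x (θGMM n ω))
        - avg (sample X n ω) fun x => augMoment g x (θGMM n ω))
  let D : T ⊕ ℕ → ℕ → Ω → ℝ≥0∞ := fun k n ω => Sum.elim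
    (fun φ : T => edist (∫ I, φ.1 (Z (ns n) ω I) ∂(bootMeasure (ns n)))
      (∫ y, φ.1 y ∂(multivariateGaussian 0 (popSigma F₀ g θW))))
    (fun k : ℕ => bootMeasure (ns n)
      {I | ENNReal.ofReal (1 / ((k : ℝ) + 1)) < ‖θstar (ns n) ω I - θW‖ₑ}) k
  have hDlim : ∀ k, TendstoInMeasure P (D k) atTop fun _ => 0 := by
    rintro (φ | k)
    · intro ε hε
      have h1 := (hboot.clt φ.1).comp hns.tendsto_atTop ε hε
      simp only [ENNReal.edist_zero_right']
      exact h1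
    · exact (hboot.consistent _ (ENNReal.ofReal_pos.2 (by positivity))).comp hns.tendsto_atTop
  obtain ⟨ns', hns', hD⟩ := exists_seq_forall_tendsto_ae hDlim
  obtain ⟨r, hr, hrΘ⟩ := h.exists_closedBall_subset
  have hB : CompactSpace (Metric.closedBall θW r) :=
    isCompact_iff_compactSpace.1 (isCompact_closedBall _ _)
  have hcont := h.continuousOn_fderiv_augMoment (hrΘ.trans interior_subset)
  have hint := h.integrable_restrictMap_fderiv_augMoment hrΘ
  have hstar' : ∀ᵐ ω ∂P, ∀ n, 0 < n → ∀ I,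
      IsArgminOn (bootObjective g (sample X n ω) (θGMM n ω) I) Θ (θstar n ω I) :=
    ae_all_iff.2 fun n => by
      by_cases hn : 0 < n
      · filter_upwards [hstar n hn] with ω hω _ using hω
      · exact Eventually.of_forall fun ω hn' => absurd hn' hn
  -- The shift by one makes every sample size positive; strict monotonicity gives N j ≥ j + 1.
  let N : ℕ → ℕ := fun j => ns (ns' (j + 1))
  have hNmono : StrictMono N := hns.comp (hns'.comp fun a b hab => Nat.add_lt_add_right hab 1)
  have hN : Tendsto N atTop atTop := hNmono.tendsto_atTop
  have hN0 : ∀ j, 0 < N j := fun j =>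
    (Nat.succ_pos j).trans_le ((hns.comp hns').le_apply (x := j + 1))
  refine ⟨fun j => ns' (j + 1), fun a b hab => hns' (Nat.add_lt_add_right hab 1), ?_⟩
  filter_upwards [hD, hstar', h.tendsto_gmm_ae hgmm, ae_forall_sample h.law h.smooth,
    ae_forall_sample h.law hcont,
    tendstoUniformlyOn_avg_sample_ae (φ := fun x => fderiv ℝ (augMoment g x)) h.indep h.law
      hcont hint, tendsto_bootDeviation_ae h.indep h.law hint]
    with ω hDω harg hgmmω hsmooth hcontω hder hdev
  have hclt : ∀ φ ∈ T, Tendsto (fun j => ∫ I, φ (Z (N j) ω I) ∂(bootMeasure (N j))) atTop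
      (𝓝 (∫ y, φ y ∂(multivariateGaussian 0 (popSigma F₀ g θW)))) := fun φ hφ =>
    tendsto_iff_edist_tendsto_0.2 ((hDω (Sum.inl ⟨φ, hφ⟩)).comp (tendsto_add_atTop_nat 1))
  have hcons : ∀ ρ : ℝ, 0 < ρ → Tendsto (fun j => bootMeasure (N j)
      {I | ρ < ‖θstar (N j) ω I - θW‖}) atTop (𝓝 0) := fun ρ hρ =>
    tendsto_bootMeasure_lt_norm
      (fun k => (hDω (Sum.inr k)).comp (tendsto_add_atTop_nat 1)) hρ
  -- Consistency of the inverse weight is drawn from the bootstrap central limit theorem itself,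
  -- with no moment bound on ψψ' away from θW.
  have hV : Tendsto (fun j => sampleSigma g (sample X (N j) ω) (θGMM (N j) ω)) atTop
      (𝓝 (popSigma F₀ g θW)) :=
    tendsto_sampleSigma_of_boot_clt hN hN0 h.posSemidef_popSigma fun a b k φ hφ =>
      hclt φ (Or.inr (Or.inr (Set.mem_iUnion.2 ⟨(a, b, k), hφ⟩)))
  refine h.tendsto_integral_boot hS (N := N)
    (S := fun j I => (avg (sample X (N j) ω ∘ I) fun x => augMoment g x (θGMM (N j) ω))
        - avg (sample X (N j) ω) fun x => augMoment g x (θGMM (N j) ω))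
    (d := fun j I => θstar (N j) ω I - θGMM (N j) ω) hdet (fun ε hε => ?_)
    (fun M => hclt _ (Or.inr (Or.inl ⟨M, rfl⟩))) f (hclt _ (Or.inl rfl))
  exact h.tendsto_bootMeasure_linearization hS hdet hr hrΘ hN0
    (fun j i => hsmooth i) (fun j i => hcontω i) (hgmmω.comp hN)
    (fun U hU => hN.eventually (hder U hU)) (hdev.comp hN) hV
    (fun j I => harg (N j) (hN0 j) I) hcons hε

end GMMAssumptions

end Main

theorem theorem2 {Ω 𝒳 : Type*} [MeasurableSpace Ω] [MeasurableSpace 𝒳] {m p : ℕ}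
    (P : Measure Ω) [IsProbabilityMeasure P] (F₀ : Measure 𝒳) (X : ℕ → Ω → 𝒳)
    (g : 𝒳 → EuclideanSpace ℝ (Fin p) → EuclideanSpace ℝ (Fin m))
    (Θ : Set (EuclideanSpace ℝ (Fin p))) (W : Matrix (Fin m) (Fin m) ℝ)
    (θW : EuclideanSpace ℝ (Fin p))
    (hGMM : GMMAssumptions P F₀ X g Θ W θW)
    -- `θW` is the unique solution in `Θ` of `E[ψ̃(X, θ)] = 0`
    (hunique : ∀ θ ∈ Θ, ∫ x, recentered F₀ g θW x θ ∂F₀ = 0 ↔ θ = θW) :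
    -- asymptotic normality of the ME-GMM estimator with weight `Δ`
    (∀ Δ : Matrix (AugIdx m p) (AugIdx m p) ℝ, Δ.PosDef →
      IsUnit ((popGamma F₀ g θW)ᵀ * Δ * popGamma F₀ g θW).det →
      ∀ θME : ℕ → Ω → EuclideanSpace ℝ (Fin p), (∀ n, AEMeasurable (θME n) P) →
        (∀ n, 0 < n → ∀ᵐ ω ∂P, IsArgminOn (meObjective F₀ g θW Δ (sample X n ω)) Θ (θME n ω)) →
        TendstoInDistribution (fun (n : ℕ) ω => √(n : ℝ) • (θME n ω - θW)) atTop id (fun _ => P)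
          (multivariateGaussian 0 (sandwich (popGamma F₀ g θW) Δ (popSigma F₀ g θW)))) ∧
    -- the variance for the weight `Δ = Σ(θW)⁻¹`
    (IsUnit (popSigma F₀ g θW).det →
      IsUnit ((popGamma F₀ g θW)ᵀ * (popSigma F₀ g θW)⁻¹ * popGamma F₀ g θW).det →
      (popSigma F₀ g θW)⁻¹.PosDef ∧
      sandwich (popGamma F₀ g θW) (popSigma F₀ g θW)⁻¹ (popSigma F₀ g θW)
        = ((popGamma F₀ g θW)ᵀ * (popSigma F₀ g θW)⁻¹ * popGamma F₀ g θW)⁻¹) ∧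
    -- the double-recentered bootstrap ME-GMM estimator
    (IsUnit (popSigma F₀ g θW).det →
      IsUnit ((popGamma F₀ g θW)ᵀ * (popSigma F₀ g θW)⁻¹ * popGamma F₀ g θW).det →
      ∀ (θGMM : ℕ → Ω → EuclideanSpace ℝ (Fin p))
        (θstar : (n : ℕ) → Ω → (Fin n → Fin n) → EuclideanSpace ℝ (Fin p)),
        (∀ n, AEMeasurable (θGMM n) P) →
        (∀ n I, AEMeasurable (fun ω => θstar n ω I) P) →
        (∀ n, 0 < n → ∀ᵐ ω ∂P, IsArgminOn (gmmObjective g W (sample X n ω)) Θ (θGMM n ω)) →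
        (∀ n, 0 < n → ∀ᵐ ω ∂P, ∀ I,
          IsArgminOn (bootObjective g (sample X n ω) (θGMM n ω) I) Θ (θstar n ω I)) →
        BootAssumptions P F₀ X g Θ θW θGMM θstar →
        TendstoInBootDistribution P
          (fun n ω I => √(n : ℝ) • (θstar n ω I - θGMM n ω))
          (multivariateGaussian 0
            ((popGamma F₀ g θW)ᵀ * (popSigma F₀ g θW)⁻¹ * popGamma F₀ g θW)⁻¹)) := by
  refine ⟨fun Δ hΔ hdet θME hmeas hmin => ?_, fun hS hdet => ⟨?_, ?_⟩,
    fun hS hdet θGMM θstar h1 h2 h3 h4 h5 => ?_⟩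
  · exact hGMM.tendstoInDistribution_me hunique hΔ hdet hmeas hmin
  · exact (hGMM.posDef_popSigma hS).inv
  · exact sandwich_inv hS hdet
  · exact hGMM.tendstoInBootDistribution_star hS hdet h1 h2 h3 h4 h5
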